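/- Let $\mathfrak g$ be a finite-dimensional simple Lie algebra over $\mathbb C$ with a non-degenerate symmetric invariant bilinear form $(\cdot\,|\,\cdot)$. Let $x,f\in\mathfrak g$ be a good pair: $\operatorname{ad}x$ is diagonalizable with eigenvalues in $\frac12\mathbb Z$ and eigenspace decomposition $\mathfrak g=\bigoplus_{j\in\frac12\mathbb Z}\mathfrak g_j$, $f\in\mathfrak g_{-1}$, and the centralizer $\mathfrak g^f$ of $f$ lies in $\bigoplus_{j\le 0}\mathfrak g_j$. Let $\mathfrak l\subset\mathfrak g_{1/2}$ be any subspace that is isotropic for the skewsymmetric form $(f|[a,b])$, let $\mathfrak l^\perp\subset\mathfrak g_{1/2}$ be its orthogonal complement for this form, and put $\mathfrak m=\mathfrak l\oplus\mathfrak g_{\ge1}$ and $\mathfrak n=\mathfrak l^\perp\oplus\mathfrak g_{\ge1}$, where $\mathfrak g_{\ge 1}=\bigoplus_{j\ge1}\mathfrak g_j$. For $a\in\mathfrak n$ let $[a]\in\mathfrak l^\perp/\mathfrak l$ be its class under $\mathfrak n/\mathfrak m\simeq\mathfrak l^\perp/\mathfrak l$. (I) Let $r$ be the vector superspace $\mathfrak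 g\oplus\varphi^{\mathfrak n^*}\oplus\varphi_{\mathfrak n}\oplus\Phi_{\mathfrak l^\perp/\mathfrak l}$, where $\mathfrak g$ and $\Phi_{\mathfrak l^\perp/\mathfrak l}\simeq\mathfrak l^\perp/\mathfrak l$ are even and $\varphi^{\mathfrak n^*}\simeq\mathfrak n^*$, $\varphi_{\mathfrak n}\simeq\mathfrak n$ are odd, with the bracket of $\mathfrak g$ on $\mathfrak g$, with $[\varphi_a,\varphi^\phi]=[\varphi^\phi,\varphi_a]=\phi(a)$ and $[\Phi_{[a]},\Phi_{[b]}]=(f|[a,b])$, and with all other brackets of generators zero. Let $C^I=U(r)$ be the quotient of the tensor algebra $T(r)$ by the two-sided ideal generated by $a\otimes b-(-1)^{p(a)p(b)}b\otimes a-[a,b]$ for homogeneous $a,b\in r$ of parities $p(a),p(b)$. For a basis $(u_\alpha)$ of $\mathfrak n$ with dual basis $(v^\alpha)$ of $\mathfrak n^*$ and $\varphi^\alpha=\varphi^{v^\alpha}$, put $$d=\sum_\alpha\varphi^\alpha\big(u_\alpha+(f|u_\alpha)+\Phi_{[u_\alpha]}\big)+\frac12\sum_{\alpha,\beta}\varphi^\alpha\varphi^\beta\varphi_{[u_\beta,u_\alpha]}\in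 C^I .$$ This is an odd element with $[d,d]=0$. Let $d^I=\operatorname{ad}d$ (supercommutator with $d$) and $W^I=H(C^I,d^I)=\ker d^I/\operatorname{im}d^I$, an associative algebra. (II) Let $\mathbb C_{-\chi}$ be the one-dimensional representation of $\mathfrak m$ in which $m$ acts by $-(f|m)$, and let $M^0=U(\mathfrak g)\otimes_{U(\mathfrak m)}\mathbb C_{-\chi}$. The adjoint action of $\mathfrak n$ on $U(\mathfrak g)$ induces an action of $\mathfrak n$ on $M^0$, $n\cdot(A\otimes1)=[n,A]\otimes1$. Let $W^{II}=(M^0)^{\mathfrak n}$ be its space of invariants, an associative algebra with the product $(A\otimes1)(B\otimes1)=AB\otimes1$. Then there is an isomorphism of associative algebras $W^I\simeq W^{II}$. -/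

import Mathlib

open scoped TensorProduct

noncomputable section

namespace FiniteW

attribute [local instance 100] LieRing.ofAssociativeRing

/-! ### Good pairs and the associated subalgebras -/

/-- A good pair `(x, f)` in a complex Lie algebra `𝔤`, together with a non-degenerate symmetric
invariant bilinear form on `𝔤`. -/
structure GoodPair (𝔤 : Type*) [LieRing 𝔤] [LieAlgebra ℂ 𝔤] where
  /-- the bilinear form `(· | ·)` -/
  form : LinearMap.BilinForm ℂ 𝔤
  form_nondegenerate : form.Nondegenerate
  form_symm : form.IsSymm
  form_invariant : ∀ a b c : 𝔤, form ⁅a, b⁆ c = form a ⁅b, c⁆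
  x : 𝔤
  f : 𝔤
  /-- `ad x` is diagonalizable with eigenvalues in `½ℤ` -/
  diagonalizable :
    ⨆ k : ℤ, Module.End.eigenspace (LieAlgebra.ad ℂ 𝔤 x) ((k : ℂ) / 2) = ⊤
  /-- `f` has degree `-1` -/
  lie_x_f : ⁅x, f⁆ = -f
  /-- the centralizer of `f` lies in non-positive degrees -/
  centralizer_le : ∀ a : 𝔤, ⁅f, a⁆ = 0 →
    a ∈ ⨆ (k : ℤ) (_ : k ≤ 0),
      Module.End.eigenspace (LieAlgebra.ad ℂ 𝔤 x) ((k : ℂ) / 2)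

section Subalgebras

variable {𝔤 : Type*} [LieRing 𝔤] [LieAlgebra ℂ 𝔤]

namespace GoodPair

variable (P : GoodPair 𝔤)

/-- The component `𝔤_{k/2}` of the grading of `𝔤` by eigenvalues of `ad x`. -/
def gr (k : ℤ) : Submodule ℂ 𝔤 :=
  Module.End.eigenspace (LieAlgebra.ad ℂ 𝔤 P.x) ((k : ℂ) / 2)

/-- The sum `𝔤_{≥ k/2}` of the components `𝔤_{i/2}` with `i ≥ k`. -/
def ge (k : ℤ) : Submodule ℂ 𝔤 := ⨆ (i : ℤ) (_ : k ≤ i), P.gr i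

theorem mem_gr {k : ℤ} {a : 𝔤} : a ∈ P.gr k ↔ ⁅P.x, a⁆ = ((k : ℂ) / 2) • a := by
  simp [gr]

theorem lie_mem_gr {i j : ℤ} {a b : 𝔤} (ha : a ∈ P.gr i) (hb : b ∈ P.gr j) :
    ⁅a, b⁆ ∈ P.gr (i + j) := by
  rw [mem_gr] at *
  rw [leibniz_lie, ha, hb, smul_lie, lie_smul, ← add_smul]
  congr 1
  push_cast
  ring

theorem gr_le_ge {i k : ℤ} (h : k ≤ i) : P.gr i ≤ P.ge k :=
  le_iSup₂_of_le i h le_rfl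

theorem lie_mem_ge {i j : ℤ} {a b : 𝔤} (ha : a ∈ P.ge i) (hb : b ∈ P.ge j) :
    ⁅a, b⁆ ∈ P.ge (i + j) := by
  have key : P.ge i ≤ (P.ge (i + j)).comap (LieAlgebra.ad ℂ 𝔤 b) := by
    refine iSup₂_le fun p hp c hc => ?_
    have key2 : P.ge j ≤ (P.ge (i + j)).comap (LieAlgebra.ad ℂ 𝔤 c) := by
      refine iSup₂_le fun q hq e he => ?_
      exact P.gr_le_ge (add_le_add hp hq) (P.lie_mem_gr hc he)
    have h := key2 hb
    rw [Submodule.mem_comap, LieAlgebra.ad_apply] at h ⊢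
    rw [← lie_skew]
    exact neg_mem h
  have h := key ha
  rw [Submodule.mem_comap, LieAlgebra.ad_apply] at h
  rw [← lie_skew]
  exact neg_mem h

theorem ge_mono {i k : ℤ} (h : k ≤ i) : P.ge i ≤ P.ge k :=
  iSup₂_le fun _ hj => P.gr_le_ge (h.trans hj)

theorem form_f_gr {k : ℤ} (hk : k ≠ 2) {a : 𝔤} (ha : a ∈ P.gr k) : P.form P.f a = 0 := by
  rw [mem_gr] at ha
  have h := P.form_invariant P.f P.x a
  rw [ha, ← lie_skew, P.lie_x_f, neg_neg, map_smul, smul_eq_mul] at h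
  have h2 : (1 - (k : ℂ) / 2) * P.form P.f a = 0 := by linear_combination h
  rcases mul_eq_zero.mp h2 with h3 | h3
  · exfalso
    apply hk
    have : (k : ℂ) = (2 : ℤ) := by push_cast; linear_combination -2 * h3
    exact_mod_cast this
  · exact h3

theorem form_f_ge {k : ℤ} (hk : 2 < k) {a : 𝔤} (ha : a ∈ P.ge k) : P.form P.f a = 0 := by
  have : P.ge k ≤ LinearMap.ker (P.form P.f) :=
    iSup₂_le fun i hi b hb => P.form_f_gr (by omega) hb
  exact this ha

theorem disjoint_gr_ge : Disjoint (P.gr 1) (P.ge 2) := by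
  have h := Module.End.eigenspaces_iSupIndep (LieAlgebra.ad ℂ 𝔤 P.x) (((1 : ℤ) : ℂ) / 2)
  refine h.mono_right (iSup₂_le fun i hi => ?_)
  refine le_iSup₂_of_le ((i : ℂ) / 2) (fun h => ?_) le_rfl
  have h2 : (i : ℂ) = (1 : ℤ) := by linear_combination 2 * h
  have h3 : i = 1 := by exact_mod_cast h2
  omega

end GoodPair

namespace GoodPair

/-- The skewsymmetric bilinear form `(a, b) ↦ (f | [a, b])`. -/
def neForm (P : GoodPair 𝔤) : 𝔤 →ₗ[ℂ] 𝔤 →ₗ[ℂ] ℂ :=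
  LinearMap.mk₂ ℂ (fun a b => P.form P.f ⁅a, b⁆)
    (fun _ _ _ => by rw [add_lie, map_add])
    (fun _ _ _ => by rw [smul_lie, map_smul])
    (fun _ _ _ => by rw [lie_add, map_add])
    (fun _ _ _ => by rw [lie_smul, map_smul])

end GoodPair

/-- A subspace `𝔩 ⊆ 𝔤_{1/2}` isotropic for the form `(f | [a, b])`. -/
structure IsotropicSubspace (P : GoodPair 𝔤) where
  l : Submodule ℂ 𝔤
  le_gr : l ≤ P.gr 1
  isotropic : ∀ a ∈ l, ∀ b ∈ l, P.form P.f ⁅a, b⁆ = 0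

namespace IsotropicSubspace

variable {P : GoodPair 𝔤} (L : IsotropicSubspace P)

/-- The orthogonal complement `𝔩^⊥ ⊆ 𝔤_{1/2}` of `𝔩` for the form `(f | [a, b])`. -/
def perp : Submodule ℂ 𝔤 where
  carrier := {a | a ∈ P.gr 1 ∧ ∀ b ∈ L.l, P.form P.f ⁅a, b⁆ = 0}
  add_mem' := fun ha hb =>
    ⟨add_mem ha.1 hb.1, fun c hc => by rw [add_lie, map_add, ha.2 c hc, hb.2 c hc, add_zero]⟩
  zero_mem' := ⟨zero_mem _, fun c _ => by rw [zero_lie, map_zero]⟩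
  smul_mem' := fun r _ ha =>
    ⟨Submodule.smul_mem _ r ha.1, fun c hc => by rw [smul_lie, map_smul, ha.2 c hc, smul_zero]⟩

theorem l_le_perp : L.l ≤ L.perp := fun a ha => ⟨L.le_gr ha, fun b hb => L.isotropic a ha b hb⟩

theorem perp_le_gr : L.perp ≤ P.gr 1 := fun _ ha => ha.1

theorem sup_le_ge {s : Submodule ℂ 𝔤} (hs : s ≤ P.gr 1) : s ⊔ P.ge 2 ≤ P.ge 1 :=
  sup_le (hs.trans (P.gr_le_ge le_rfl)) (P.ge_mono (by norm_num))

theorem lie_mem_sup {s t : Submodule ℂ 𝔤} (hs : s ≤ P.gr 1) (ht : t ≤ P.gr 1) {a b : 𝔤}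
    (ha : a ∈ s ⊔ P.ge 2) (hb : b ∈ t ⊔ P.ge 2) : ⁅a, b⁆ ∈ P.ge 2 :=
  P.lie_mem_ge (i := 1) (j := 1) (sup_le_ge hs ha) (sup_le_ge ht hb)

/-- The subalgebra `𝔪_𝔩 = 𝔩 ⊕ 𝔤_{≥1}`. -/
def m : LieSubalgebra ℂ 𝔤 :=
  { L.l ⊔ P.ge 2 with
    lie_mem' := fun ha hb => Submodule.mem_sup_right (lie_mem_sup L.le_gr L.le_gr ha hb) }

/-- The subalgebra `𝔫_𝔩 = 𝔩^⊥ ⊕ 𝔤_{≥1}`. -/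
def n : LieSubalgebra ℂ 𝔤 :=
  { L.perp ⊔ P.ge 2 with
    lie_mem' := fun ha hb =>
      Submodule.mem_sup_right (lie_mem_sup L.perp_le_gr L.perp_le_gr ha hb) }

theorem mem_m {a : 𝔤} : a ∈ L.m ↔ a ∈ L.l ⊔ P.ge 2 := Iff.rfl

theorem mem_n {a : 𝔤} : a ∈ L.n ↔ a ∈ L.perp ⊔ P.ge 2 := Iff.rfl

theorem m_le_n {a : 𝔤} (ha : a ∈ L.m) : a ∈ L.n :=
  sup_le_sup_right L.l_le_perp _ ha

/-- `𝔪_𝔩` is an ideal of `𝔫_𝔩`. -/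
theorem lie_n_m {a b : 𝔤} (ha : a ∈ L.n) (hb : b ∈ L.m) : ⁅a, b⁆ ∈ L.m :=
  Submodule.mem_sup_right (lie_mem_sup L.perp_le_gr L.le_gr ha hb)

theorem form_lie_n_m {a b : 𝔤} (ha : a ∈ L.n) (hb : b ∈ L.m) : P.form P.f ⁅a, b⁆ = 0 := by
  obtain ⟨a₁, ha₁, a₂, ha₂, rfl⟩ := Submodule.mem_sup.mp (L.mem_n.mp ha)
  obtain ⟨b₁, hb₁, b₂, hb₂, rfl⟩ := Submodule.mem_sup.mp (L.mem_m.mp hb)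
  have hb' := sup_le_ge L.le_gr hb
  have ha₁' := P.gr_le_ge (le_refl 1) (L.perp_le_gr ha₁)
  rw [add_lie, lie_add, map_add, map_add, ha₁.2 b₁ hb₁,
    P.form_f_ge (k := 1 + 2) (by norm_num) (P.lie_mem_ge ha₁' hb₂),
    P.form_f_ge (k := 2 + 1) (by norm_num) (P.lie_mem_ge ha₂ hb'), add_zero, add_zero]

/-- The space `𝔩^⊥ / 𝔩`. -/
abbrev Ne : Type _ := L.perp ⧸ L.l.comap L.perp.subtype

/-- The bilinear form `([a], [b]) ↦ (f | [a, b])` on `𝔩^⊥ / 𝔩`. -/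
def neForm : L.Ne →ₗ[ℂ] L.Ne →ₗ[ℂ] ℂ :=
  LinearMap.liftQ₂ _ _
    (P.neForm.domRestrict₁₂ L.perp L.perp)
    (fun a ha => by
      ext b
      have h := b.2.2 a ha
      rw [← lie_skew, map_neg, neg_eq_zero] at h
      exact h)
    (fun b hb => by
      ext a
      exact a.2.2 b hb)

theorem neForm_mk (a b : L.perp) :
    L.neForm (Submodule.Quotient.mk a) (Submodule.Quotient.mk b) =
      P.form P.f ⁅(a : 𝔤), (b : 𝔤)⁆ := rfl

/-- The space `𝔫_𝔩 / 𝔪_𝔩`. -/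
abbrev NModM : Type _ := L.n ⧸ L.m.toSubmodule.comap L.n.toSubmodule.subtype

/-- The map `𝔩^⊥ / 𝔩 → 𝔫_𝔩 / 𝔪_𝔩` induced by the inclusion `𝔩^⊥ ⊆ 𝔫_𝔩`. -/
def neToNModM : L.Ne →ₗ[ℂ] L.NModM :=
  Submodule.mapQ _ _
    (Submodule.inclusion (show L.perp ≤ L.n.toSubmodule from le_sup_left))
    (fun _ ha => (le_sup_left : L.l ≤ L.l ⊔ P.ge 2) ha)

theorem neToNModM_bijective : Function.Bijective L.neToNModM := by
  constructor
  · rw [← LinearMap.ker_eq_bot, LinearMap.ker_eq_bot']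
    intro q hq
    obtain ⟨a, rfl⟩ := Submodule.Quotient.mk_surjective _ q
    have h : (a : 𝔤) ∈ L.l ⊔ P.ge 2 := (Submodule.Quotient.mk_eq_zero
      (L.m.toSubmodule.comap L.n.toSubmodule.subtype)).mp hq
    obtain ⟨b, hb, c, hc, hbc⟩ := Submodule.mem_sup.mp h
    have hc1 : c ∈ P.gr 1 := by
      have : c = a - b := by rw [← hbc]; abel
      rw [this]
      exact sub_mem (L.perp_le_gr a.2) (L.le_gr hb)
    have hc0 : c = 0 := Submodule.disjoint_def.mp P.disjoint_gr_ge c hc1 hc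
    refine (Submodule.Quotient.mk_eq_zero _).mpr ?_
    change (a : 𝔤) ∈ L.l
    rw [← hbc, hc0, add_zero]
    exact hb
  · intro q
    obtain ⟨a, rfl⟩ := Submodule.Quotient.mk_surjective _ q
    obtain ⟨b, hb, c, hc, hbc⟩ := Submodule.mem_sup.mp (L.mem_n.mp a.2)
    refine ⟨Submodule.Quotient.mk ⟨b, hb⟩, ?_⟩
    refine (Submodule.Quotient.eq _).mpr ?_
    change b - (a : 𝔤) ∈ L.l ⊔ P.ge 2
    rw [← hbc]
    refine Submodule.mem_sup_right ?_
    simpa using hc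

/-- The isomorphism `𝔩^⊥ / 𝔩 ≃ 𝔫_𝔩 / 𝔪_𝔩`. -/
def neEquiv : L.Ne ≃ₗ[ℂ] L.NModM :=
  LinearEquiv.ofBijective L.neToNModM L.neToNModM_bijective

/-- The map `𝔫_𝔩 → 𝔫_𝔩 / 𝔪_𝔩 ≃ 𝔩^⊥ / 𝔩`, `a ↦ [a]`. -/
def toNe : L.n →ₗ[ℂ] L.Ne :=
  L.neEquiv.symm.toLinearMap ∘ₗ Submodule.mkQ _

end IsotropicSubspace

end Subalgebras

/-! ### Enveloping superalgebras of non-linear brackets -/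

section Enveloping

variable (V₀ V₁ : Type*) [AddCommGroup V₀] [Module ℂ V₀] [AddCommGroup V₁] [Module ℂ V₁]

/-- The parity operator of the superspace `V₀ ⊕ V₁` (`1` on `V₀`, `-1` on `V₁`). -/
def parity : V₀ × V₁ →ₗ[ℂ] V₀ × V₁ := LinearMap.prodMap LinearMap.id (-LinearMap.id)

/-- A parity preserving linear map `[ , ] : V ⊗ V → T(V)` on a superspace `V = V₀ ⊕ V₁`, i.e. the
bracket of a non-linear Lie superalgebra. -/
structure SuperBracket where
  bracket : V₀ × V₁ →ₗ[ℂ] V₀ × V₁ →ₗ[ℂ] TensorAlgebra ℂ (V₀ × V₁)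
  parity_preserving : ∀ a b, bracket (parity V₀ V₁ a) (parity V₀ V₁ b) =
    TensorAlgebra.lift ℂ (TensorAlgebra.ι ℂ ∘ₗ parity V₀ V₁) (bracket a b)

variable {V₀ V₁}

/-- The relations `a ⊗ b - (-1)^{p(a)p(b)} b ⊗ a = [a, b]`, for homogeneous `a, b`. -/
inductive SuperBracket.Rel (β : SuperBracket V₀ V₁) :
    TensorAlgebra ℂ (V₀ × V₁) → TensorAlgebra ℂ (V₀ × V₁) → Prop
  | even_even (a b : V₀) : β.Rel
      (TensorAlgebra.ι ℂ (a, (0 : V₁)) * TensorAlgebra.ι ℂ (b, (0 : V₁)) -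
        TensorAlgebra.ι ℂ (b, (0 : V₁)) * TensorAlgebra.ι ℂ (a, (0 : V₁)))
      (β.bracket (a, 0) (b, 0))
  | even_odd (a : V₀) (b : V₁) : β.Rel
      (TensorAlgebra.ι ℂ (a, (0 : V₁)) * TensorAlgebra.ι ℂ ((0 : V₀), b) -
        TensorAlgebra.ι ℂ ((0 : V₀), b) * TensorAlgebra.ι ℂ (a, (0 : V₁)))
      (β.bracket (a, 0) (0, b))
  | odd_even (a : V₁) (b : V₀) : β.Rel
      (TensorAlgebra.ι ℂ ((0 : V₀), a) * TensorAlgebra.ι ℂ (b, (0 : V₁)) -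
        TensorAlgebra.ι ℂ (b, (0 : V₁)) * TensorAlgebra.ι ℂ ((0 : V₀), a))
      (β.bracket (0, a) (b, 0))
  | odd_odd (a b : V₁) : β.Rel
      (TensorAlgebra.ι ℂ ((0 : V₀), a) * TensorAlgebra.ι ℂ ((0 : V₀), b) +
        TensorAlgebra.ι ℂ ((0 : V₀), b) * TensorAlgebra.ι ℂ ((0 : V₀), a))
      (β.bracket (0, a) (0, b))

namespace SuperBracket

variable (β : SuperBracket V₀ V₁)

/-- The universal enveloping algebra `U(V)`: the quotient of `T(V)` by the two-sided ideal
generated by the elements `a ⊗ b - (-1)^{p(a)p(b)} b ⊗ a - [a, b]`. -/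
def Envelope : Type _ := RingQuot β.Rel

instance : Ring β.Envelope := inferInstanceAs (Ring (RingQuot β.Rel))

instance : Algebra ℂ β.Envelope := inferInstanceAs (Algebra ℂ (RingQuot β.Rel))

/-- The quotient map `T(V) → U(V)`. -/
def proj : TensorAlgebra ℂ (V₀ × V₁) →ₐ[ℂ] β.Envelope := RingQuot.mkAlgHom ℂ β.Rel

theorem proj_rel {s t : TensorAlgebra ℂ (V₀ × V₁)} (h : β.Rel s t) : β.proj s = β.proj t :=
  RingQuot.mkAlgHom_rel ℂ h

/-- The universal property of `U(V)`. -/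
def lift {B : Type*} [Ring B] [Algebra ℂ B] (g : TensorAlgebra ℂ (V₀ × V₁) →ₐ[ℂ] B)
    (hg : ∀ ⦃s t⦄, β.Rel s t → g s = g t) : β.Envelope →ₐ[ℂ] B :=
  RingQuot.liftAlgHom ℂ ⟨g, hg⟩

theorem lift_proj {B : Type*} [Ring B] [Algebra ℂ B] (g : TensorAlgebra ℂ (V₀ × V₁) →ₐ[ℂ] B)
    (hg : ∀ ⦃s t⦄, β.Rel s t → g s = g t) (t : TensorAlgebra ℂ (V₀ × V₁)) :
    β.lift g hg (β.proj t) = g t :=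
  RingQuot.liftAlgHom_mkAlgHom_apply ℂ g hg t

theorem hom_ext {B : Type*} [Ring B] [Algebra ℂ B] {g h : β.Envelope →ₐ[ℂ] B}
    (w : g.comp β.proj = h.comp β.proj) : g = h :=
  RingQuot.ringQuot_ext' ℂ g h w

/-- The canonical map `V → U(V)`. -/
def ι : V₀ × V₁ →ₗ[ℂ] β.Envelope := β.proj.toLinearMap ∘ₗ TensorAlgebra.ι ℂ

/-- The parity automorphism `A ↦ (-1)^{p(A)} A` of the superalgebra `U(V)`. -/
def σ : β.Envelope →ₐ[ℂ] β.Envelope :=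
  β.lift (β.proj.comp (TensorAlgebra.lift ℂ (TensorAlgebra.ι ℂ ∘ₗ parity V₀ V₁))) (by
      intro s t h
      cases h with
      | even_even a b =>
        have h := β.proj_rel (Rel.even_even (β := β) a b)
        have h2 := β.parity_preserving (a, 0) (b, 0)
        simp only [AlgHom.comp_apply, ← h2]
        simpa [parity] using h
      | even_odd a b =>
        have h := β.proj_rel (Rel.even_odd (β := β) a (-b))
        have h2 := β.parity_preserving (a, 0) (0, b)
        simp only [AlgHom.comp_apply, ← h2]
        simpa [parity] using h
      | odd_even a b =>
        have h := β.proj_rel (Rel.odd_even (β := β) (-a) b)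
        have h2 := β.parity_preserving (0, a) (b, 0)
        simp only [AlgHom.comp_apply, ← h2]
        simpa [parity] using h
      | odd_odd a b =>
        have h := β.proj_rel (Rel.odd_odd (β := β) (-a) (-b))
        have h2 := β.parity_preserving (0, a) (0, b)
        simp only [AlgHom.comp_apply, ← h2]
        simpa [parity] using h)

theorem σ_ι (v : V₀ × V₁) : β.σ (β.ι v) = β.ι (parity V₀ V₁ v) := by
  change β.lift _ _ (β.proj (TensorAlgebra.ι ℂ v)) = _
  rw [lift_proj, AlgHom.comp_apply, TensorAlgebra.lift_ι_apply]
  rfl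

theorem σ_σ (A : β.Envelope) : β.σ (β.σ A) = A := by
  have h : β.σ.comp β.σ = AlgHom.id ℂ _ := by
    apply β.hom_ext
    apply TensorAlgebra.hom_ext
    ext v
    · change β.σ (β.σ (β.ι (v, 0))) = β.ι (v, 0)
      simp [σ_ι, parity]
    · change β.σ (β.σ (β.ι (0, v))) = β.ι (0, v)
      simp [σ_ι, parity]
  exact DFunLike.congr_fun h A

end SuperBracket

end Enveloping

/-! ### Cohomology of an inner odd differential -/

/-- A superalgebra structure on `A`, given by its parity automorphism `σ a = (-1)^{p(a)} a`,
together with an odd element `d` such that `[d, d] = 2 d² = 0`. -/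
structure InnerDifferential (A : Type*) [Ring A] [Algebra ℂ A] where
  σ : A →ₐ[ℂ] A
  σ_σ : ∀ a, σ (σ a) = a
  d : A
  σ_d : σ d = -d
  d_mul_d : d * d = 0

namespace InnerDifferential

variable {A : Type*} [Ring A] [Algebra ℂ A] (δ : InnerDifferential A)

/-- The differential `ad d = [d, · ]`, that is `[d, a] = d a - (-1)^{p(a)} a d`. -/
def ad : A →ₗ[ℂ] A :=
  LinearMap.mulLeft ℂ δ.d - LinearMap.mulRight ℂ δ.d ∘ₗ δ.σ.toLinearMap

theorem ad_apply (a : A) : δ.ad a = δ.d * a - δ.σ a * δ.d := rfl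

theorem ad_mul (a b : A) : δ.ad (a * b) = δ.ad a * b + δ.σ a * δ.ad b := by
  simp only [ad_apply, map_mul]
  noncomm_ring

theorem ad_σ (a : A) : δ.ad (δ.σ a) = -δ.σ (δ.ad a) := by
  simp only [ad_apply, map_mul, map_sub, δ.σ_σ, δ.σ_d]
  noncomm_ring

theorem ad_ad (a : A) : δ.ad (δ.ad a) = 0 := by
  have h1 : δ.d * (δ.d * a) = 0 := by rw [← mul_assoc, δ.d_mul_d, zero_mul]
  have h2 : a * (δ.d * δ.d) = 0 := by rw [δ.d_mul_d, mul_zero]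
  simp only [ad_apply, map_mul, map_sub, δ.σ_σ, δ.σ_d]
  noncomm_ring
  simp [h1, h2]

/-- The cocycles `ker (ad d)`, a subalgebra of `A`. -/
def cocycles : Subalgebra ℂ A where
  carrier := {a | δ.ad a = 0}
  mul_mem' := fun {a b} ha hb => by
    rw [Set.mem_ofPred_eq] at *
    rw [ad_mul, ha, hb, zero_mul, mul_zero, add_zero]
  add_mem' := fun {a b} ha hb => by
    rw [Set.mem_ofPred_eq] at *
    rw [map_add, ha, hb, add_zero]
  algebraMap_mem' := fun r => by
    rw [Set.mem_ofPred_eq, ad_apply, AlgHom.commutes, Algebra.commutes, sub_self]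

theorem mem_cocycles {a : A} : a ∈ δ.cocycles ↔ δ.ad a = 0 := Iff.rfl

theorem ad_mem_cocycles (a : A) : δ.ad a ∈ δ.cocycles := δ.ad_ad a

/-- The coboundaries `im (ad d)`, an ideal of the algebra of cocycles. -/
def coboundaries : Ideal δ.cocycles where
  carrier := {a | ∃ b : A, δ.ad b = a}
  add_mem' := by
    rintro a b ⟨a', ha⟩ ⟨b', hb⟩
    exact ⟨a' + b', by rw [map_add, ha, hb]; rfl⟩
  zero_mem' := ⟨0, map_zero _⟩
  smul_mem' := by
    rintro c a ⟨a', ha⟩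
    refine ⟨δ.σ c * a', ?_⟩
    have hc : δ.ad (c : A) = 0 := c.2
    rw [ad_mul, ad_σ, hc, δ.σ_σ, ha, map_zero, neg_zero, zero_mul, zero_add]
    rfl

instance : δ.coboundaries.IsTwoSided where
  mul_mem_of_left := by
    rintro a b ⟨a', ha⟩
    refine ⟨a' * b, ?_⟩
    have hb : δ.ad (b : A) = 0 := b.2
    rw [ad_mul, hb, mul_zero, add_zero, ha]
    rfl

/-- The cohomology algebra `H(A, ad d) = ker (ad d) / im (ad d)`. -/
abbrev Cohomology : Type _ := δ.cocycles ⧸ δ.coboundaries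

end InnerDifferential

/-! ### The square of the BRST element -/

section BRST

variable {n : Type*} [LieRing n] [LieAlgebra ℂ n] {A : Type*} [Ring A] [Algebra ℂ A]
  {ι : Type*} [Fintype ι] (u : Module.Basis ι ℂ n)
  (c : Module.Dual ℂ n →ₗ[ℂ] A) (b : n →ₗ[ℂ] A)

theorem sum_coord_smul (F : n →ₗ[ℂ] A) (e : n) : ∑ i, u.coord i e • F (u i) = F e := by
  conv_rhs => rw [← u.sum_repr e, map_sum]
  refine Finset.sum_congr rfl fun i _ => ?_
  rw [map_smul, Module.Basis.coord_apply]

theorem sum_antisymm (cc : ∀ p q, c p * c q = -(c q * c p)) (G : ι → ι → A) :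
    ∑ i, ∑ j, c (u.coord i) * c (u.coord j) * G j i =
      -∑ i, ∑ j, c (u.coord i) * c (u.coord j) * G i j := by
  rw [Finset.sum_comm, ← Finset.sum_neg_distrib]
  refine Finset.sum_congr rfl fun i _ => ?_
  rw [← Finset.sum_neg_distrib]
  refine Finset.sum_congr rfl fun j _ => ?_
  rw [cc, neg_mul]

/-- `θ a = ∑_α φ^α φ_{[u_α, a]}` -/
def theta : n →ₗ[ℂ] A :=
  ∑ j, LinearMap.mulLeft ℂ (c (u.coord j)) ∘ₗ b ∘ₗ (LieAlgebra.ad ℂ n (u j) : n →ₗ[ℂ] n)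

theorem theta_apply (a : n) : theta u c b a = ∑ j, c (u.coord j) * b ⁅u j, a⁆ := by
  simp [theta]

theorem theta_c (cc : ∀ p q, c p * c q = -(c q * c p))
    (bc : ∀ a p, b a * c p = algebraMap ℂ A (p a) - c p * b a) (a : n) (p : Module.Dual ℂ n) :
    theta u c b a * c p = c p * theta u c b a + ∑ k, p ⁅u k, a⁆ • c (u.coord k) := by
  rw [theta_apply, Finset.sum_mul, Finset.mul_sum, ← Finset.sum_add_distrib]
  refine Finset.sum_congr rfl fun k _ => ?_
  rw [mul_assoc, bc, mul_sub, ← mul_assoc, cc _ p, ← Algebra.commutes, Algebra.smul_def]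
  noncomm_ring

theorem theta_b (bc : ∀ a p, b a * c p = algebraMap ℂ A (p a) - c p * b a)
    (bb : ∀ a e, b a * b e = -(b e * b a)) (a e : n) :
    theta u c b a * b e = b e * theta u c b a + b ⁅a, e⁆ := by
  have h := sum_coord_smul u (b ∘ₗ (LieAlgebra.ad ℂ n a : n →ₗ[ℂ] n)) e
  simp only [LinearMap.comp_apply, LieAlgebra.ad_apply] at h
  rw [theta_apply, Finset.sum_mul, Finset.mul_sum, ← h, ← Finset.sum_add_distrib]
  refine Finset.sum_congr rfl fun k _ => ?_
  rw [← mul_assoc, bc, mul_assoc, bb _ e, ← lie_skew, map_neg, Algebra.smul_def]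
  noncomm_ring

theorem theta_theta (cc : ∀ p q, c p * c q = -(c q * c p))
    (bc : ∀ a p, b a * c p = algebraMap ℂ A (p a) - c p * b a)
    (bb : ∀ a e, b a * b e = -(b e * b a)) (a e : n) :
    theta u c b a * theta u c b e - theta u c b e * theta u c b a = theta u c b ⁅a, e⁆ := by
  have h1 : theta u c b a * theta u c b e = theta u c b e * theta u c b a +
      (∑ j, (∑ k, u.coord j ⁅u k, a⁆ • c (u.coord k)) * b ⁅u j, e⁆ +
        ∑ j, c (u.coord j) * b ⁅a, ⁅u j, e⁆⁆) := by
    rw [theta_apply u c b e, Finset.sum_mul, Finset.mul_sum, ← Finset.sum_add_distrib,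
      ← Finset.sum_add_distrib]
    refine Finset.sum_congr rfl fun j _ => ?_
    rw [← mul_assoc, theta_c u c b cc bc, add_mul, mul_assoc, theta_b u c b bc bb]
    noncomm_ring
  have h2 : ∑ j, (∑ k, u.coord j ⁅u k, a⁆ • c (u.coord k)) * b ⁅u j, e⁆ =
      ∑ k, c (u.coord k) * b ⁅⁅u k, a⁆, e⁆ := by
    simp_rw [Finset.sum_mul]
    rw [Finset.sum_comm]
    refine Finset.sum_congr rfl fun k _ => ?_
    have h := sum_coord_smul u (-(b ∘ₗ (LieAlgebra.ad ℂ n e : n →ₗ[ℂ] n))) ⁅u k, a⁆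
    simp only [LinearMap.neg_apply, LinearMap.comp_apply, LieAlgebra.ad_apply, ← map_neg,
      lie_skew] at h
    rw [← h, Finset.mul_sum]
    refine Finset.sum_congr rfl fun j _ => ?_
    rw [smul_mul_assoc, mul_smul_comm]
  rw [h1, h2, add_sub_cancel_left, theta_apply, ← Finset.sum_add_distrib]
  refine Finset.sum_congr rfl fun k _ => ?_
  rw [← mul_add, ← map_add, leibniz_lie (u k) a e]

theorem two_mul_sum (cc : ∀ p q, c p * c q = -(c q * c p)) (F : n →ₗ[ℂ] A)
    (FF : ∀ a e, F a * F e - F e * F a = F ⁅a, e⁆) :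
    (2 : ℂ) • ∑ i, ∑ j, c (u.coord i) * c (u.coord j) * (F (u i) * F (u j)) =
      ∑ i, ∑ j, c (u.coord i) * c (u.coord j) * F ⁅u i, u j⁆ := by
  have h := sum_antisymm u c cc (fun i j => F (u i) * F (u j))
  simp_rw [← FF, mul_sub, Finset.sum_sub_distrib]
  rw [h, sub_neg_eq_add, two_smul]

theorem cross (cc : ∀ p q, c p * c q = -(c q * c p))
    (bc : ∀ a p, b a * c p = algebraMap ℂ A (p a) - c p * b a) (G : n →ₗ[ℂ] A) :
    (∑ i, c (u.coord i) * theta u c b (u i)) * (∑ j, c (u.coord j) * G (u j)) =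
      ∑ i, ∑ j, c (u.coord i) * c (u.coord j) * (theta u c b (u i) * G (u j)) -
      ∑ i, ∑ j, c (u.coord i) * c (u.coord j) * G ⁅u i, u j⁆ := by
  have h1 : ∑ i, ∑ j, c (u.coord i) * c (u.coord j) * G ⁅u i, u j⁆ =
      -∑ i, ∑ j, c (u.coord i) * ((∑ k, u.coord j ⁅u k, u i⁆ • c (u.coord k)) * G (u j)) := by
    rw [← neg_neg (∑ i, ∑ j, c (u.coord i) * c (u.coord j) * G ⁅u i, u j⁆),
      ← sum_antisymm u c cc (fun i j => G ⁅u i, u j⁆)]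
    congr 1
    refine Finset.sum_congr rfl fun i _ => ?_
    rw [← Finset.mul_sum]
    simp_rw [mul_assoc]
    rw [← Finset.mul_sum]
    congr 1
    simp_rw [Finset.sum_mul]
    rw [Finset.sum_comm]
    refine Finset.sum_congr rfl fun k _ => ?_
    rw [← sum_coord_smul u G ⁅u k, u i⁆, Finset.mul_sum]
    refine Finset.sum_congr rfl fun j _ => ?_
    rw [smul_mul_assoc, mul_smul_comm]
  rw [h1, sub_neg_eq_add, Finset.sum_mul, ← Finset.sum_add_distrib]
  refine Finset.sum_congr rfl fun i _ => ?_
  rw [Finset.mul_sum, ← Finset.sum_add_distrib]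
  refine Finset.sum_congr rfl fun j _ => ?_
  rw [mul_assoc, ← mul_assoc (theta u c b (u i)), theta_c u c b cc bc]
  noncomm_ring

theorem sum_theta_eq_zero (cc : ∀ p q, c p * c q = -(c q * c p)) :
    ∑ i, ∑ j, c (u.coord i) * c (u.coord j) * theta u c b ⁅u i, u j⁆ = 0 := by
  let T : ι → ι → ι → A := fun i j k =>
    c (u.coord i) * c (u.coord j) * c (u.coord k) * b ⁅u k, ⁅u i, u j⁆⁆
  let T' : ι → ι → ι → A := fun i j k =>
    c (u.coord i) * c (u.coord j) * c (u.coord k) * b ⁅u i, ⁅u j, u k⁆⁆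
  let T'' : ι → ι → ι → A := fun i j k =>
    c (u.coord i) * c (u.coord j) * c (u.coord k) * b ⁅u j, ⁅u k, u i⁆⁆
  have cyc : ∀ p q r, c p * c q * c r = c q * c r * c p := fun p q r => by
    rw [cc p q, neg_mul, mul_assoc, cc p r, mul_neg, neg_neg, mul_assoc]
  have h0 : ∑ i, ∑ j, c (u.coord i) * c (u.coord j) * theta u c b ⁅u i, u j⁆ =
      ∑ i, ∑ j, ∑ k, T i j k := by
    simp only [theta_apply, Finset.mul_sum, T, mul_assoc]
  have h1 : ∑ i, ∑ j, ∑ k, T i j k = ∑ i, ∑ j, ∑ k, T' i j k := by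
    rw [Finset.sum_congr rfl fun i _ => Finset.sum_comm, Finset.sum_comm]
    refine Finset.sum_congr rfl fun k _ => Finset.sum_congr rfl fun i _ =>
      Finset.sum_congr rfl fun j _ => ?_
    simp only [T, T']
    rw [cyc (u.coord k)]
  have h2 : ∑ i, ∑ j, ∑ k, T' i j k = ∑ i, ∑ j, ∑ k, T'' i j k := by
    rw [Finset.sum_congr rfl fun i _ => Finset.sum_comm, Finset.sum_comm]
    refine Finset.sum_congr rfl fun k _ => Finset.sum_congr rfl fun i _ =>
      Finset.sum_congr rfl fun j _ => ?_
    simp only [T', T'']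
    rw [cyc (u.coord k)]
  have h3 : ∑ i, ∑ j, ∑ k, T i j k + ∑ i, ∑ j, ∑ k, T' i j k + ∑ i, ∑ j, ∑ k, T'' i j k = 0 := by
    simp only [← Finset.sum_add_distrib]
    refine Finset.sum_eq_zero fun i _ => Finset.sum_eq_zero fun j _ =>
      Finset.sum_eq_zero fun k _ => ?_
    simp only [T, T', T'', ← mul_add, ← map_add]
    rw [add_assoc, add_comm, lie_jacobi, map_zero, mul_zero]
  rw [← h2, ← h1] at h3
  rw [h0]
  have h4 : (3 : ℂ) • ∑ i, ∑ j, ∑ k, T i j k = 0 := by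
    rw [← h3]
    module
  exact (smul_eq_zero.mp h4).resolve_left (by norm_num)

theorem brst_sq (cc : ∀ p q, c p * c q = -(c q * c p))
    (bc : ∀ a p, b a * c p = algebraMap ℂ A (p a) - c p * b a)
    (bb : ∀ a e, b a * b e = -(b e * b a)) (X : n →ₗ[ℂ] A)
    (XX : ∀ a e, X a * X e - X e * X a = X ⁅a, e⁆)
    (Xc : ∀ a p, X a * c p = c p * X a) (Xb : ∀ a e, X a * b e = b e * X a) :
    (∑ i, c (u.coord i) * X (u i) + (1 / 2 : ℂ) • ∑ i, ∑ j,
      c (u.coord i) * c (u.coord j) * b ⁅u j, u i⁆) *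
    (∑ i, c (u.coord i) * X (u i) + (1 / 2 : ℂ) • ∑ i, ∑ j,
      c (u.coord i) * c (u.coord j) * b ⁅u j, u i⁆) = 0 := by
  have e1 : ∑ i, ∑ j, c (u.coord i) * c (u.coord j) * b ⁅u j, u i⁆ =
      ∑ i, c (u.coord i) * theta u c b (u i) := by
    simp only [theta_apply, Finset.mul_sum, mul_assoc]
  rw [e1]
  have Xt : ∀ a e, X a * theta u c b e = theta u c b e * X a := fun a e => by
    rw [theta_apply, Finset.mul_sum, Finset.sum_mul]
    refine Finset.sum_congr rfl fun j _ => ?_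
    rw [← mul_assoc, Xc, mul_assoc, Xb, mul_assoc]
  have q1 : (∑ i, c (u.coord i) * X (u i)) * (∑ j, c (u.coord j) * X (u j)) =
      ∑ i, ∑ j, c (u.coord i) * c (u.coord j) * (X (u i) * X (u j)) := by
    rw [Finset.sum_mul]
    refine Finset.sum_congr rfl fun i _ => ?_
    rw [Finset.mul_sum]
    refine Finset.sum_congr rfl fun j _ => ?_
    rw [mul_assoc, ← mul_assoc (X _), Xc]
    noncomm_ring
  have q2 : (∑ i, c (u.coord i) * X (u i)) * (∑ j, c (u.coord j) * theta u c b (u j)) =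
      -∑ i, ∑ j, c (u.coord i) * c (u.coord j) * (theta u c b (u i) * X (u j)) := by
    rw [← sum_antisymm u c cc (fun i j => theta u c b (u i) * X (u j)), Finset.sum_mul]
    refine Finset.sum_congr rfl fun i _ => ?_
    rw [Finset.mul_sum]
    refine Finset.sum_congr rfl fun j _ => ?_
    rw [mul_assoc, ← mul_assoc (X _), Xc, ← Xt]
    noncomm_ring
  have q3 := cross u c b cc bc X
  have q4 := cross u c b cc bc (theta u c b)
  have q5 := two_mul_sum u c cc X XX
  have q6 := two_mul_sum u c cc (theta u c b) (theta_theta u c b cc bc bb)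
  rw [sum_theta_eq_zero u c b cc] at q4 q6
  have q7 := (smul_eq_zero.mp q6).resolve_left (by norm_num)
  rw [q7, sub_zero] at q4
  rw [add_mul, mul_add, mul_add, mul_smul_comm, smul_mul_assoc, smul_mul_smul_comm, q1, q2, q3, q4,
    ← q5]
  module

end BRST

/-! ### The first definition: quantum Hamiltonian reduction -/

namespace IsotropicSubspace

variable {𝔤 : Type*} [LieRing 𝔤] [LieAlgebra ℂ 𝔤] {P : GoodPair 𝔤} (L : IsotropicSubspace P)

/-- The even part `𝔤 ⊕ Φ_{𝔩^⊥/𝔩}` of the superspace `r`. -/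
abbrev REven : Type _ := 𝔤 × L.Ne

/-- The odd part `φ^{𝔫*} ⊕ φ_𝔫` of the superspace `r`. -/
abbrev ROdd : Type _ := Module.Dual ℂ L.n × L.n

/-- The superspace `r = 𝔤 ⊕ φ^{𝔫*} ⊕ φ_𝔫 ⊕ Φ_{𝔩^⊥/𝔩}`. -/
abbrev R : Type _ := L.REven × L.ROdd

/-- The scalar part of the non-linear bracket of `r`: `[φ_a, φ^ψ] = [φ^ψ, φ_a] = ψ(a)` and
`[Φ_[a], Φ_[b]] = (f | [a, b])`. -/
def scalarBracket : L.R →ₗ[ℂ] L.R →ₗ[ℂ] ℂ :=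
  LinearMap.mk₂ ℂ
    (fun r s => L.neForm r.1.2 s.1.2 + (r.2.1 s.2.2 + s.2.1 r.2.2))
    (fun r r' s => by simp; ring)
    (fun c r s => by simp; ring)
    (fun r s s' => by simp; ring)
    (fun c r s => by simp; ring)

/-- The Lie bracket of the summand `𝔤` of `r`. -/
def lieBracket : L.R →ₗ[ℂ] L.R →ₗ[ℂ] L.R :=
  LinearMap.mk₂ ℂ
    (fun r s => ((⁅r.1.1, s.1.1⁆, 0), 0))
    (fun r r' s => by simp)
    (fun c r s => by simp)
    (fun r s s' => by simp)
    (fun c r s => by simp)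

/-- The non-linear Lie superalgebra bracket on `r`. -/
def rBracket : SuperBracket L.REven L.ROdd where
  bracket := L.lieBracket.compr₂ (TensorAlgebra.ι ℂ) +
    L.scalarBracket.compr₂ (Algebra.linearMap ℂ (TensorAlgebra ℂ L.R))
  parity_preserving := fun a b => by
    simp [lieBracket, scalarBracket, parity]

/-- The algebra `C^I = U(r)`. -/
abbrev CI : Type _ := L.rBracket.Envelope

/-- The generators `a ∈ 𝔤` of `C^I`. -/
def genG : 𝔤 →ₗ[ℂ] L.CI :=
  L.rBracket.ι ∘ₗ LinearMap.inl ℂ _ _ ∘ₗ LinearMap.inl ℂ _ _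

/-- The generators `Φ_[a]`, `[a] ∈ 𝔩^⊥/𝔩`, of `C^I`. -/
def genNe : L.Ne →ₗ[ℂ] L.CI :=
  L.rBracket.ι ∘ₗ LinearMap.inl ℂ _ _ ∘ₗ LinearMap.inr ℂ _ _

/-- The generators `φ^ψ`, `ψ ∈ 𝔫*`, of `C^I`. -/
def genUp : Module.Dual ℂ L.n →ₗ[ℂ] L.CI :=
  L.rBracket.ι ∘ₗ LinearMap.inr ℂ _ _ ∘ₗ LinearMap.inl ℂ _ _

/-- The generators `φ_a`, `a ∈ 𝔫`, of `C^I`. -/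
def genDown : L.n →ₗ[ℂ] L.CI :=
  L.rBracket.ι ∘ₗ LinearMap.inr ℂ _ _ ∘ₗ LinearMap.inr ℂ _ _

/-- The element `X_a = a + (f | a) + Φ_[a]` of `C^I`, for `a ∈ 𝔫`. -/
def X : L.n →ₗ[ℂ] L.CI :=
  L.genG ∘ₗ L.n.toSubmodule.subtype +
    Algebra.linearMap ℂ L.CI ∘ₗ P.form P.f ∘ₗ L.n.toSubmodule.subtype +
    L.genNe ∘ₗ L.toNe

/-- The odd element
`d = ∑_α φ^α (u_α + (f | u_α) + Φ_[u_α]) + ½ ∑_{α,β} φ^α φ^β φ_{[u_β, u_α]}` of `C^I`,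
where `u` is a basis of `𝔫` and `φ^α` corresponds to the dual basis of `𝔫*`. -/
def dI {ι : Type*} [Fintype ι] (u : Module.Basis ι ℂ L.n) : L.CI :=
  ∑ α, L.genUp (u.coord α) *
      (L.genG (u α) + algebraMap ℂ L.CI (P.form P.f (u α)) + L.genNe (L.toNe (u α))) +
    (1 / 2 : ℂ) • ∑ α, ∑ β,
      L.genUp (u.coord α) * L.genUp (u.coord β) * L.genDown ⁅u β, u α⁆

theorem proj_rBracket (r s : L.R) :
    L.rBracket.proj (L.rBracket.bracket r s) =
      L.rBracket.ι (L.lieBracket r s) + algebraMap ℂ L.CI (L.scalarBracket r s) := by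
  change L.rBracket.proj
    (TensorAlgebra.ι ℂ (L.lieBracket r s) + algebraMap ℂ _ (L.scalarBracket r s)) = _
  rw [map_add, AlgHom.commutes]
  rfl

theorem ι_mul_even_even (a b : L.REven) :
    L.rBracket.ι (a, 0) * L.rBracket.ι (b, 0) - L.rBracket.ι (b, 0) * L.rBracket.ι (a, 0) =
      L.rBracket.ι (L.lieBracket (a, 0) (b, 0)) +
        algebraMap ℂ L.CI (L.scalarBracket (a, 0) (b, 0)) := by
  have h := L.rBracket.proj_rel (SuperBracket.Rel.even_even (β := L.rBracket) a b)
  rw [proj_rBracket, map_sub, map_mul, map_mul] at h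
  exact h

theorem ι_mul_even_odd (a : L.REven) (b : L.ROdd) :
    L.rBracket.ι (a, 0) * L.rBracket.ι (0, b) - L.rBracket.ι (0, b) * L.rBracket.ι (a, 0) =
      L.rBracket.ι (L.lieBracket (a, 0) (0, b)) +
        algebraMap ℂ L.CI (L.scalarBracket (a, 0) (0, b)) := by
  have h := L.rBracket.proj_rel (SuperBracket.Rel.even_odd (β := L.rBracket) a b)
  rw [proj_rBracket, map_sub, map_mul, map_mul] at h
  exact h

theorem ι_mul_odd_odd (a b : L.ROdd) :
    L.rBracket.ι (0, a) * L.rBracket.ι (0, b) + L.rBracket.ι (0, b) * L.rBracket.ι (0, a) =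
      L.rBracket.ι (L.lieBracket (0, a) (0, b)) +
        algebraMap ℂ L.CI (L.scalarBracket (0, a) (0, b)) := by
  have h := L.rBracket.proj_rel (SuperBracket.Rel.odd_odd (β := L.rBracket) a b)
  rw [proj_rBracket, map_add, map_mul, map_mul] at h
  exact h

theorem lieBracket_odd (r : L.R) (b : L.ROdd) : L.lieBracket r (0, b) = 0 := by
  simp [lieBracket]

theorem genUp_genUp (p q : Module.Dual ℂ L.n) :
    L.genUp p * L.genUp q = -(L.genUp q * L.genUp p) := by
  have h := L.ι_mul_odd_odd (p, 0) (q, 0)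
  rw [lieBracket_odd, map_zero] at h
  rw [← sub_eq_zero, sub_neg_eq_add]
  simpa [scalarBracket, genUp] using h

theorem genDown_genDown (a b : L.n) :
    L.genDown a * L.genDown b = -(L.genDown b * L.genDown a) := by
  have h := L.ι_mul_odd_odd (0, a) (0, b)
  rw [lieBracket_odd, map_zero] at h
  rw [← sub_eq_zero, sub_neg_eq_add]
  simpa [scalarBracket, genDown] using h

theorem genDown_genUp (a : L.n) (p : Module.Dual ℂ L.n) :
    L.genDown a * L.genUp p = algebraMap ℂ L.CI (p a) - L.genUp p * L.genDown a := by
  have h := L.ι_mul_odd_odd (0, a) (p, 0)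
  rw [lieBracket_odd, map_zero] at h
  rw [eq_sub_iff_add_eq]
  simpa [scalarBracket, genDown, genUp] using h

theorem ι_even_odd_comm (a : L.REven) (b : L.ROdd) :
    L.rBracket.ι (a, 0) * L.rBracket.ι (0, b) = L.rBracket.ι (0, b) * L.rBracket.ι (a, 0) := by
  have h := L.ι_mul_even_odd a b
  rw [lieBracket_odd, map_zero] at h
  rw [← sub_eq_zero, h]
  simp [scalarBracket]

theorem X_apply (a : L.n) : L.X a = L.rBracket.ι (((a : 𝔤), L.toNe a), 0) +
    algebraMap ℂ L.CI (P.form P.f a) := by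
  have h : (((a : 𝔤), L.toNe a), (0 : L.ROdd)) = (((a : 𝔤), (0 : L.Ne)), (0 : L.ROdd)) +
    (((0 : 𝔤), L.toNe a), (0 : L.ROdd)) := by simp
  rw [h, map_add]
  change L.rBracket.ι (((a : 𝔤), 0), 0) + algebraMap ℂ L.CI (P.form P.f a) +
    L.rBracket.ι ((0, L.toNe a), 0) = _
  abel

theorem X_genUp (a : L.n) (p : Module.Dual ℂ L.n) : L.X a * L.genUp p = L.genUp p * L.X a := by
  rw [X_apply, add_mul, mul_add, Algebra.commutes]
  congr 1
  exact L.ι_even_odd_comm _ _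

theorem X_genDown (a b : L.n) : L.X a * L.genDown b = L.genDown b * L.X a := by
  rw [X_apply, add_mul, mul_add, Algebra.commutes]
  congr 1
  exact L.ι_even_odd_comm _ _

theorem toNe_eq_zero {a : L.n} (ha : (a : 𝔤) ∈ P.ge 2) : L.toNe a = 0 := by
  have : (Submodule.Quotient.mk a : L.NModM) = 0 :=
    (Submodule.Quotient.mk_eq_zero (L.m.toSubmodule.comap L.n.toSubmodule.subtype)).mpr
      ((le_sup_right : P.ge 2 ≤ L.l ⊔ P.ge 2) ha)
  change L.neEquiv.symm (Submodule.Quotient.mk a) = 0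
  rw [this, map_zero]

theorem toNe_eq_mk {a : L.n} {b : L.perp} (h : (b : 𝔤) - a ∈ P.ge 2) :
    L.toNe a = Submodule.Quotient.mk b := by
  change L.neEquiv.symm (Submodule.Quotient.mk a) = _
  rw [LinearEquiv.symm_apply_eq]
  refine ((Submodule.Quotient.eq (L.m.toSubmodule.comap L.n.toSubmodule.subtype)).mpr ?_).symm
  exact (le_sup_right : P.ge 2 ≤ L.l ⊔ P.ge 2) h

theorem neForm_toNe (a b : L.n) :
    L.neForm (L.toNe a) (L.toNe b) = P.form P.f ⁅(a : 𝔤), (b : 𝔤)⁆ := by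
  obtain ⟨a₁, ha₁, a₂, ha₂, ha⟩ := Submodule.mem_sup.mp (L.mem_n.mp a.2)
  obtain ⟨b₁, hb₁, b₂, hb₂, hb⟩ := Submodule.mem_sup.mp (L.mem_n.mp b.2)
  have hb' := sup_le_ge L.perp_le_gr b.2
  have ha₁' := P.gr_le_ge (le_refl 1) (L.perp_le_gr ha₁)
  rw [L.toNe_eq_mk (b := ⟨a₁, ha₁⟩) (by rw [← ha]; simpa using ha₂),
    L.toNe_eq_mk (b := ⟨b₁, hb₁⟩) (by rw [← hb]; simpa using hb₂), neForm_mk]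
  rw [← ha, add_lie, map_add, P.form_f_ge (k := 2 + 1) (by norm_num) (P.lie_mem_ge ha₂ hb'),
    ← hb, lie_add, map_add, P.form_f_ge (k := 1 + 2) (by norm_num) (P.lie_mem_ge ha₁' hb₂)]
  simp

theorem sub_mul_algebraMap {A : Type*} [Ring A] [Algebra ℂ A] (a b : A) (r s : ℂ) :
    (a + algebraMap ℂ A r) * (b + algebraMap ℂ A s) -
      (b + algebraMap ℂ A s) * (a + algebraMap ℂ A r) = a * b - b * a := by
  have h1 := Algebra.commutes r b
  have h2 := Algebra.commutes s a
  have h3 := Algebra.commutes r (algebraMap ℂ A s)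
  rw [add_mul, add_mul, mul_add, mul_add, mul_add, mul_add, h1, ← h2, h3]
  abel

theorem X_X (a b : L.n) : L.X a * L.X b - L.X b * L.X a = L.X ⁅a, b⁆ := by
  have h := L.ι_mul_even_even ((a : 𝔤), L.toNe a) ((b : 𝔤), L.toNe b)
  have h0 : L.toNe ⁅a, b⁆ = 0 :=
    L.toNe_eq_zero (lie_mem_sup L.perp_le_gr L.perp_le_gr a.2 b.2)
  have h1 : L.scalarBracket (((a : 𝔤), L.toNe a), 0) (((b : 𝔤), L.toNe b), 0) =
      P.form P.f (⁅a, b⁆ : L.n) := by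
    simp [scalarBracket, neForm_toNe]
  rw [h1] at h
  rw [X_apply L ⁅a, b⁆, h0]
  refine Eq.trans ?_ h
  rw [X_apply, X_apply, sub_mul_algebraMap]

/-- The differential `d^I = ad d` of the superalgebra `C^I`. -/
def differentialI {ι : Type*} [Fintype ι] (u : Module.Basis ι ℂ L.n) :
    InnerDifferential L.CI where
  σ := L.rBracket.σ
  σ_σ := L.rBracket.σ_σ
  d := L.dI u
  σ_d := by
    have h1 : ∀ p, L.rBracket.σ (L.genUp p) = -L.genUp p := fun p => by
      simp [genUp, SuperBracket.σ_ι, parity, ← map_neg]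
    have h2 : ∀ a, L.rBracket.σ (L.genDown a) = -L.genDown a := fun p => by
      simp [genDown, SuperBracket.σ_ι, parity, ← map_neg]
    have h3 : ∀ a, L.rBracket.σ (L.genG a) = L.genG a := fun p => by
      simp [genG, SuperBracket.σ_ι, parity]
    have h4 : ∀ a, L.rBracket.σ (L.genNe a) = L.genNe a := fun p => by
      simp [genNe, SuperBracket.σ_ι, parity]
    rw [dI, map_add, map_sum, map_smul, map_sum, neg_add, ← Finset.sum_neg_distrib]
    congr 1
    · refine Finset.sum_congr rfl fun α _ => ?_
      rw [map_mul, map_add, map_add, h1, h3, h4, AlgHom.commutes, neg_mul]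
    · rw [← smul_neg, ← Finset.sum_neg_distrib]
      congr 1
      refine Finset.sum_congr rfl fun α _ => ?_
      rw [map_sum, ← Finset.sum_neg_distrib]
      refine Finset.sum_congr rfl fun β _ => ?_
      rw [map_mul, map_mul, h1, h1, h2, neg_mul_neg, mul_neg]
  d_mul_d := brst_sq u L.genUp L.genDown L.genUp_genUp L.genDown_genUp L.genDown_genDown L.X
    L.X_X L.X_genUp L.X_genDown

/-- The finite `W`-algebra `W^I = H(C^I, d^I)`. -/
abbrev WI {ι : Type*} [Fintype ι] (u : Module.Basis ι ℂ L.n) : Type _ :=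
  (L.differentialI u).Cohomology

end IsotropicSubspace

/-! ### Induction along a homomorphism of non-commutative algebras -/

section Induction

variable {A B V : Type*} [Ring A] [Algebra ℂ A] [Ring B] [Algebra ℂ B] [AddCommGroup V]
  [Module ℂ V]

/-- The relations `a i(b) ⊗ v = a ⊗ b v` defining `A ⊗_B V` as a quotient of `A ⊗_ℂ V`, for an
algebra homomorphism `i : B → A` and a representation `ρ` of `B` on `V`. Since this set of relations
is stable under left multiplication by `A`, the `A`-submodule it spans is the subgroup it
generates. -/
def indRel (i : B →ₐ[ℂ] A) (ρ : B →ₐ[ℂ] Module.End ℂ V) : Submodule A (A ⊗[ℂ] V) :=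
  Submodule.span A {t | ∃ (a : A) (b : B) (v : V), t = (a * i b) ⊗ₜ[ℂ] v - a ⊗ₜ[ℂ] (ρ b v)}

/-- The induced module `A ⊗_B V`, a left `A`-module. -/
abbrev Ind (i : B →ₐ[ℂ] A) (ρ : B →ₐ[ℂ] Module.End ℂ V) : Type _ :=
  (A ⊗[ℂ] V) ⧸ indRel i ρ

end Induction

/-! ### The second definition: Whittaker models -/

namespace IsotropicSubspace

variable {𝔤 : Type*} [LieRing 𝔤] [LieAlgebra ℂ 𝔤] {P : GoodPair 𝔤} (L : IsotropicSubspace P)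

/-- The inclusion `U(𝔪_𝔩) → U(𝔤)`. -/
def iUm : UniversalEnvelopingAlgebra ℂ L.m →ₐ[ℂ] UniversalEnvelopingAlgebra ℂ 𝔤 :=
  UniversalEnvelopingAlgebra.lift ℂ ((UniversalEnvelopingAlgebra.ι ℂ).comp L.m.incl)

/-- The one-dimensional representation `ℂ_{-χ}` of `𝔪_𝔩`, on which `m` acts by the scalar
`-(f | m)`. -/
def negChi : L.m →ₗ⁅ℂ⁆ Module.End ℂ ℂ where
  toFun a := (-P.form P.f (a : 𝔤)) • (1 : Module.End ℂ ℂ)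
  map_add' a b := by
    have h : ((a + b : L.m) : 𝔤) = a + b := rfl
    rw [← add_smul, h, map_add, neg_add]
  map_smul' c a := by
    have h : ((c • a : L.m) : 𝔤) = c • (a : 𝔤) := rfl
    rw [h, map_smul, RingHom.id_apply, smul_smul, smul_eq_mul, mul_neg]
  map_lie' := fun {a b} => by
    have h : P.form P.f ((⁅a, b⁆ : L.m) : 𝔤) = 0 := L.form_lie_n_m (L.m_le_n a.2) b.2
    rw [h, LieRing.of_associative_ring_bracket, neg_zero, zero_smul, smul_mul_smul_comm,
      smul_mul_smul_comm, mul_comm, sub_self]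

/-- The representation `ℂ_{-χ}`, as a representation of `U(𝔪_𝔩)`. -/
def rhoChi : UniversalEnvelopingAlgebra ℂ L.m →ₐ[ℂ] Module.End ℂ ℂ :=
  UniversalEnvelopingAlgebra.lift ℂ L.negChi

/-- The left `U(𝔤)`-module `M⁰_𝔩 = U(𝔤) ⊗_{U(𝔪_𝔩)} ℂ_{-χ}`. -/
abbrev M0 : Type _ := Ind L.iUm L.rhoChi

/-- The class `A ⊗ 1` in `M⁰_𝔩`. -/
def cls : UniversalEnvelopingAlgebra ℂ 𝔤 →ₗ[UniversalEnvelopingAlgebra ℂ 𝔤] L.M0 :=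
  (indRel L.iUm L.rhoChi).mkQ ∘ₗ
    (TensorProduct.AlgebraTensorModule.rid ℂ (UniversalEnvelopingAlgebra ℂ 𝔤)
      (UniversalEnvelopingAlgebra ℂ 𝔤)).symm.toLinearMap

theorem cls_apply (A : UniversalEnvelopingAlgebra ℂ 𝔤) :
    L.cls A = Submodule.Quotient.mk (A ⊗ₜ[ℂ] (1 : ℂ)) := rfl

theorem cls_surjective : Function.Surjective L.cls :=
  (Submodule.mkQ_surjective _).comp (LinearEquiv.surjective _)

theorem cls_mul_iUm (A : UniversalEnvelopingAlgebra ℂ 𝔤) (u : UniversalEnvelopingAlgebra ℂ L.m) :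
    L.cls (A * L.iUm u) = Submodule.Quotient.mk (A ⊗ₜ[ℂ] L.rhoChi u 1) :=
  (Submodule.Quotient.eq _).mpr (Submodule.subset_span ⟨A, u, 1, rfl⟩)

theorem iUm_ι (a : L.m) : L.iUm (UniversalEnvelopingAlgebra.ι ℂ a) =
    UniversalEnvelopingAlgebra.ι ℂ (a : 𝔤) :=
  UniversalEnvelopingAlgebra.lift_ι_apply ℂ _ a

theorem rhoChi_ι (a : L.m) : L.rhoChi (UniversalEnvelopingAlgebra.ι ℂ a) = L.negChi a :=
  UniversalEnvelopingAlgebra.lift_ι_apply ℂ _ a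

theorem negChi_apply (a : L.m) (z : ℂ) : L.negChi a z = -P.form P.f (a : 𝔤) * z := rfl

/-- The adjoint action of `x ∈ 𝔤` on `U(𝔤)`, `A ↦ [x, A] = x A - A x`. -/
def adU (x : 𝔤) : UniversalEnvelopingAlgebra ℂ 𝔤 →ₗ[ℂ] UniversalEnvelopingAlgebra ℂ 𝔤 :=
  LinearMap.mulLeft ℂ (UniversalEnvelopingAlgebra.ι ℂ x) -
    LinearMap.mulRight ℂ (UniversalEnvelopingAlgebra.ι ℂ x)

theorem adU_apply (x : 𝔤) (A : UniversalEnvelopingAlgebra ℂ 𝔤) :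
    adU x A = UniversalEnvelopingAlgebra.ι ℂ x * A - A * UniversalEnvelopingAlgebra.ι ℂ x := rfl

theorem adU_mul (x : 𝔤) (A B : UniversalEnvelopingAlgebra ℂ 𝔤) :
    adU x (A * B) = adU x A * B + A * adU x B := by
  simp only [adU_apply]
  noncomm_ring

theorem adU_ι (x y : 𝔤) : adU x (UniversalEnvelopingAlgebra.ι ℂ y) =
    UniversalEnvelopingAlgebra.ι ℂ ⁅x, y⁆ := by
  rw [LieHom.map_lie, LieRing.of_associative_ring_bracket, adU_apply]

theorem mem_of_ι_mem {𝔥 : Type*} [LieRing 𝔥] [LieAlgebra ℂ 𝔥]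
    (S : Subalgebra ℂ (UniversalEnvelopingAlgebra ℂ 𝔥))
    (hS : ∀ x, UniversalEnvelopingAlgebra.ι ℂ x ∈ S) (u : UniversalEnvelopingAlgebra ℂ 𝔥) :
    u ∈ S := by
  let g : 𝔥 →ₗ⁅ℂ⁆ S :=
    { toFun := fun x => ⟨UniversalEnvelopingAlgebra.ι ℂ x, hS x⟩
      map_add' := fun x y => Subtype.ext (map_add _ x y)
      map_smul' := fun c x => Subtype.ext (map_smul _ c x)
      map_lie' := fun {x y} => Subtype.ext (LieHom.map_lie _ x y) }
  have h : S.val.comp (UniversalEnvelopingAlgebra.lift ℂ g) = AlgHom.id ℂ _ := by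
    ext x
    change ((UniversalEnvelopingAlgebra.lift ℂ g (UniversalEnvelopingAlgebra.ι ℂ x) : S) :
      UniversalEnvelopingAlgebra ℂ 𝔥) = UniversalEnvelopingAlgebra.ι ℂ x
    rw [UniversalEnvelopingAlgebra.lift_ι_apply]
    rfl
  have h2 := DFunLike.congr_fun h u
  change ((UniversalEnvelopingAlgebra.lift ℂ g u : S) : UniversalEnvelopingAlgebra ℂ 𝔥) = u at h2
  rw [← h2]
  exact SetLike.coe_mem _

/-- `[x, U(𝔪_𝔩)]`, for `x ∈ 𝔫_𝔩`, lies in the part of `U(𝔪_𝔩)` that acts by zero on `ℂ_{-χ}`. -/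
theorem exists_adU_iUm (x : L.n) (u : UniversalEnvelopingAlgebra ℂ L.m) :
    ∃ u', adU (x : 𝔤) (L.iUm u) = L.iUm u' ∧ L.rhoChi u' = 0 := by
  let S : Subalgebra ℂ (UniversalEnvelopingAlgebra ℂ L.m) :=
    { carrier := {u | ∃ u', adU (x : 𝔤) (L.iUm u) = L.iUm u' ∧ L.rhoChi u' = 0}
      mul_mem' := by
        rintro a b ⟨a', ha, ha0⟩ ⟨b', hb, hb0⟩
        refine ⟨a' * b + a * b', ?_, ?_⟩
        · rw [map_mul, adU_mul, ha, hb, map_add, map_mul, map_mul]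
        · rw [map_add, map_mul, map_mul, ha0, hb0, zero_mul, mul_zero, add_zero]
      add_mem' := by
        rintro a b ⟨a', ha, ha0⟩ ⟨b', hb, hb0⟩
        exact ⟨a' + b', by rw [map_add, map_add, ha, hb, map_add],
          by rw [map_add, ha0, hb0, add_zero]⟩
      algebraMap_mem' := fun r => ⟨0, by
        rw [AlgHom.commutes, adU_apply, Algebra.commutes, sub_self, map_zero], map_zero _⟩ }
  refine mem_of_ι_mem S (fun y => ?_) u
  refine ⟨UniversalEnvelopingAlgebra.ι ℂ ⟨⁅(x : 𝔤), (y : 𝔤)⁆, L.lie_n_m x.2 y.2⟩, ?_, ?_⟩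
  · rw [iUm_ι, iUm_ι, adU_ι]
  · rw [rhoChi_ι]
    ext
    rw [negChi_apply, L.form_lie_n_m x.2 y.2]
    simp

/-- The operator `A ⊗ v ↦ [x, A] ⊗ v` on `U(𝔤) ⊗_ℂ ℂ`. -/
def adTensor (x : 𝔤) :
    UniversalEnvelopingAlgebra ℂ 𝔤 ⊗[ℂ] ℂ →ₗ[ℂ] UniversalEnvelopingAlgebra ℂ 𝔤 ⊗[ℂ] ℂ :=
  (adU x).rTensor ℂ

theorem adTensor_smul (x : 𝔤) (A : UniversalEnvelopingAlgebra ℂ 𝔤)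
    (t : UniversalEnvelopingAlgebra ℂ 𝔤 ⊗[ℂ] ℂ) :
    adTensor x (A • t) = adU x A • t + A • adTensor x t := by
  induction t using TensorProduct.induction_on with
  | zero => simp only [smul_zero, map_zero, add_zero]
  | tmul B v =>
    simp only [adTensor, TensorProduct.smul_tmul', smul_eq_mul, LinearMap.rTensor_tmul, adU_mul,
      TensorProduct.add_tmul]
  | add s t hs ht =>
    rw [smul_add, map_add, hs, ht, smul_add, map_add, smul_add]
    abel

theorem adTensor_mem (x : L.n) {t : UniversalEnvelopingAlgebra ℂ 𝔤 ⊗[ℂ] ℂ}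
    (ht : t ∈ indRel L.iUm L.rhoChi) : adTensor (x : 𝔤) t ∈ indRel L.iUm L.rhoChi := by
  induction ht using Submodule.span_induction with
  | mem t ht =>
    obtain ⟨a, u, v, rfl⟩ := ht
    obtain ⟨u', hu, hu0⟩ := L.exists_adU_iUm x u
    have h1 : (adU (x : 𝔤) a * L.iUm u) ⊗ₜ[ℂ] v - adU (x : 𝔤) a ⊗ₜ[ℂ] (L.rhoChi u v) ∈
        indRel L.iUm L.rhoChi := Submodule.subset_span ⟨_, _, _, rfl⟩
    have h2 : (a * L.iUm u') ⊗ₜ[ℂ] v - a ⊗ₜ[ℂ] (L.rhoChi u' v) ∈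
        indRel L.iUm L.rhoChi := Submodule.subset_span ⟨_, _, _, rfl⟩
    rw [hu0, LinearMap.zero_apply, TensorProduct.tmul_zero, sub_zero] at h2
    rw [adTensor, map_sub, LinearMap.rTensor_tmul, LinearMap.rTensor_tmul, adU_mul, hu,
      TensorProduct.add_tmul, add_sub_right_comm]
    exact add_mem h1 h2
  | zero => rw [map_zero]; exact zero_mem _
  | add s t _ _ hs ht => rw [map_add]; exact add_mem hs ht
  | smul A t ht h =>
    rw [adTensor_smul]
    exact add_mem (Submodule.smul_mem _ _ ht) (Submodule.smul_mem _ _ h)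

/-- The adjoint action of `𝔫_𝔩` on `M⁰_𝔩`: `x · (A ⊗ v) = [x, A] ⊗ v`. -/
def adM0 (x : L.n) : L.M0 →ₗ[ℂ] L.M0 :=
  (Submodule.Quotient.restrictScalarsEquiv ℂ (indRel L.iUm L.rhoChi)).toLinearMap ∘ₗ
    Submodule.mapQ ((indRel L.iUm L.rhoChi).restrictScalars ℂ)
      ((indRel L.iUm L.rhoChi).restrictScalars ℂ) (adTensor (x : 𝔤))
      (fun _ ht => L.adTensor_mem x ht) ∘ₗ
    (Submodule.Quotient.restrictScalarsEquiv ℂ (indRel L.iUm L.rhoChi)).symm.toLinearMap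

theorem adM0_cls (x : L.n) (A : UniversalEnvelopingAlgebra ℂ 𝔤) :
    L.adM0 x (L.cls A) = L.cls (adU (x : 𝔤) A) := rfl

theorem adM0_smul (x : L.n) (A : UniversalEnvelopingAlgebra ℂ 𝔤) (w : L.M0) :
    L.adM0 x (A • w) = adU (x : 𝔤) A • w + A • L.adM0 x w := by
  obtain ⟨B, rfl⟩ := L.cls_surjective w
  rw [← map_smul, adM0_cls, adM0_cls, ← map_smul, ← map_smul, ← map_add, smul_eq_mul, adU_mul]
  rfl

/-- The finite `W`-algebra `W^II = (M⁰_𝔩)^{𝔫_𝔩}`, the space of invariants of the adjoint action of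
`𝔫_𝔩`. -/
def WII : Submodule ℂ L.M0 := ⨅ x : L.n, LinearMap.ker (L.adM0 x)

theorem mem_WII {w : L.M0} : w ∈ L.WII ↔ ∀ x, L.adM0 x w = 0 := by
  simp [WII]

theorem iUm_ι_smul {w : L.M0} (hw : w ∈ L.WII) (y : L.m) (z : ℂ) :
    L.iUm (UniversalEnvelopingAlgebra.ι ℂ y) • z • w =
      L.rhoChi (UniversalEnvelopingAlgebra.ι ℂ y) z • w := by
  obtain ⟨A, rfl⟩ := L.cls_surjective w
  have h := L.mem_WII.mp hw ⟨y, L.m_le_n y.2⟩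
  rw [adM0_cls, adU_apply, map_sub, sub_eq_zero] at h
  have h2 := L.cls_mul_iUm A (UniversalEnvelopingAlgebra.ι ℂ y)
  rw [iUm_ι] at h2
  have h3 : L.cls (UniversalEnvelopingAlgebra.ι ℂ (y : 𝔤) * A) =
      (-P.form P.f (y : 𝔤)) • L.cls A := by
    refine h.trans (h2.trans ?_)
    rw [rhoChi_ι, negChi_apply, ← smul_eq_mul, TensorProduct.tmul_smul]
    rfl
  rw [iUm_ι, rhoChi_ι, negChi_apply, smul_comm, ← map_smul, smul_eq_mul, h3, smul_smul, mul_comm]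

/-- On an invariant vector `w`, the left action of `u ∈ U(𝔪_𝔩)` is by the character `-χ`. -/
theorem iUm_smul {w : L.M0} (hw : w ∈ L.WII) (u : UniversalEnvelopingAlgebra ℂ L.m) (z : ℂ) :
    L.iUm u • z • w = L.rhoChi u z • w := by
  let S : Subalgebra ℂ (UniversalEnvelopingAlgebra ℂ L.m) :=
    { carrier := {u | ∀ z : ℂ, L.iUm u • z • w = L.rhoChi u z • w}
      mul_mem' := by
        intro a b ha hb z
        rw [map_mul, mul_smul, hb, ha, map_mul, Module.End.mul_apply]
      add_mem' := by
        intro a b ha hb z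
        rw [map_add, add_smul, hb, ha, map_add, LinearMap.add_apply, add_smul]
      algebraMap_mem' := fun r z => by
        rw [AlgHom.commutes, AlgHom.commutes, algebraMap_smul, Module.algebraMap_end_apply,
          smul_assoc] }
  have hS : u ∈ S := by
    refine mem_of_ι_mem S (fun y z => ?_) u
    exact L.iUm_ι_smul hw y z
  exact hS z

/-- For `w ∈ W^II` the map `M⁰_𝔩 → M⁰_𝔩` of left `U(𝔤)`-modules with `A ⊗ 1 ↦ A w`. -/
def mulRight (w : L.WII) : L.M0 →ₗ[UniversalEnvelopingAlgebra ℂ 𝔤] L.M0 :=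
  (indRel L.iUm L.rhoChi).liftQ
    (LinearMap.toSpanSingleton (UniversalEnvelopingAlgebra ℂ 𝔤) L.M0 w ∘ₗ
      (TensorProduct.AlgebraTensorModule.rid ℂ (UniversalEnvelopingAlgebra ℂ 𝔤)
        (UniversalEnvelopingAlgebra ℂ 𝔤)).toLinearMap)
    (Submodule.span_le.mpr (by
      rintro _ ⟨a, u, v, rfl⟩
      have h := L.iUm_smul w.2 u v
      change _ = (0 : L.M0)
      rw [LinearMap.comp_apply, map_sub, map_sub]
      change (v • (a * L.iUm u)) • (w : L.M0) - (L.rhoChi u v • a) • (w : L.M0) = 0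
      rw [smul_assoc, mul_smul, ← smul_comm a v, ← smul_comm (L.iUm u) v, h, smul_comm a,
        smul_assoc, sub_self]))

theorem mulRight_cls (w : L.WII) (A : UniversalEnvelopingAlgebra ℂ 𝔤) :
    L.mulRight w (L.cls A) = A • (w : L.M0) := by
  change ((1 : ℂ) • A) • (w : L.M0) = _
  rw [one_smul]

theorem adM0_mulRight (x : L.n) (w : L.WII) (y : L.M0) :
    L.adM0 x (L.mulRight w y) = L.mulRight w (L.adM0 x y) := by
  obtain ⟨A, rfl⟩ := L.cls_surjective y
  rw [mulRight_cls, adM0_smul, L.mem_WII.mp w.2 x, smul_zero, add_zero, adM0_cls, mulRight_cls]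

theorem cls_one_mem : L.cls 1 ∈ L.WII :=
  L.mem_WII.mpr fun x => by rw [adM0_cls, adU_apply, mul_one, one_mul, sub_self, map_zero]

/-- The product of `W^II`, induced by that of `U(𝔤)`: `(A ⊗ 1) (B ⊗ 1) = A B ⊗ 1`. -/
instance : Mul L.WII where
  mul y w := ⟨L.mulRight w y, L.mem_WII.mpr fun x => by
    rw [adM0_mulRight, L.mem_WII.mp y.2 x, map_zero]⟩

instance : One L.WII := ⟨⟨L.cls 1, L.cls_one_mem⟩⟩

theorem WII.coe_mul (y w : L.WII) : ((y * w : L.WII) : L.M0) = L.mulRight w y := rfl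

theorem WII.coe_one : ((1 : L.WII) : L.M0) = L.cls 1 := rfl

theorem WII.coe_mul_of_eq_cls {y w : L.WII} {A B : UniversalEnvelopingAlgebra ℂ 𝔤}
    (hy : (y : L.M0) = L.cls A) (hw : (w : L.M0) = L.cls B) :
    ((y * w : L.WII) : L.M0) = L.cls (A * B) := by
  rw [WII.coe_mul, hy, mulRight_cls, hw, ← map_smul, smul_eq_mul]

theorem WII.coe_mul_eq_smul {y w : L.WII} {A : UniversalEnvelopingAlgebra ℂ 𝔤}
    (hy : (y : L.M0) = L.cls A) : ((y * w : L.WII) : L.M0) = A • (w : L.M0) := by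
  rw [WII.coe_mul, hy, mulRight_cls]

instance : Ring L.WII :=
  { (inferInstance : AddCommGroup L.WII), (inferInstance : Mul L.WII),
    (inferInstance : One L.WII) with
    mul_assoc := fun a b c => by
      obtain ⟨A, hA⟩ := L.cls_surjective (a : L.M0)
      obtain ⟨B, hB⟩ := L.cls_surjective (b : L.M0)
      apply Subtype.ext
      rw [WII.coe_mul_eq_smul L (WII.coe_mul_of_eq_cls L hA.symm hB.symm),
        WII.coe_mul_eq_smul L hA.symm, WII.coe_mul_eq_smul L hB.symm, mul_smul]
    one_mul := fun a => Subtype.ext (by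
      rw [WII.coe_mul_eq_smul L (WII.coe_one L), one_smul])
    mul_one := fun a => by
      obtain ⟨A, hA⟩ := L.cls_surjective (a : L.M0)
      exact Subtype.ext (by
        rw [WII.coe_mul_of_eq_cls L hA.symm (WII.coe_one L), mul_one, hA])
    left_distrib := fun a b c => by
      obtain ⟨A, hA⟩ := L.cls_surjective (a : L.M0)
      apply Subtype.ext
      rw [WII.coe_mul_eq_smul L hA.symm, Submodule.coe_add, Submodule.coe_add, smul_add,
        WII.coe_mul_eq_smul L hA.symm, WII.coe_mul_eq_smul L hA.symm]
    right_distrib := fun a b c => Subtype.ext (by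
      rw [WII.coe_mul, Submodule.coe_add, Submodule.coe_add, map_add, WII.coe_mul, WII.coe_mul])
    zero_mul := fun a => Subtype.ext (map_zero (L.mulRight a))
    mul_zero := fun a => by
      obtain ⟨A, hA⟩ := L.cls_surjective (a : L.M0)
      apply Subtype.ext
      rw [WII.coe_mul_eq_smul L hA.symm, Submodule.coe_zero, smul_zero] }

instance : Algebra ℂ L.WII :=
  Algebra.ofModule
    (fun r x y => Subtype.ext (by
      rw [WII.coe_mul, Submodule.coe_smul, Submodule.coe_smul, WII.coe_mul]
      exact ((L.mulRight y).restrictScalars ℂ).map_smul r x))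
    (fun r x y => by
      obtain ⟨A, hA⟩ := L.cls_surjective (x : L.M0)
      apply Subtype.ext
      rw [WII.coe_mul_eq_smul L hA.symm, Submodule.coe_smul, Submodule.coe_smul,
        WII.coe_mul_eq_smul L hA.symm, smul_comm])

end IsotropicSubspace

end FiniteW

end

open scoped TensorProduct

noncomputable section

namespace FiniteW

attribute [local instance 100] LieRing.ofAssociativeRing


/-! Let `I` be the left ideal of `C^I` generated by all `X_a` and `φ_a` (`vacIdeal`). It contains
`d`, so it is a subcomplex for `ad d`, and on the quotient `C^I / I` (`VacModule`) the differential
becomes left multiplication by `d`. Morally the quotient is the Chevalley–Eilenberg complex of `𝔫`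
with coefficients in `M⁰`, and its degree zero cocycles are the `𝔫`-invariants of `M⁰`, that is
`W^II`. The theorem follows from two facts: `I` is acyclic, and every cocycle of the quotient is
cohomologous to a vector of `U(𝔤) vac`.

Both facts come from a homotopy `h` whose Laplacian `E = D h + h D` is triangular for a filtration
by words, with natural numbers on the diagonal. Where these numbers are non-zero, each vector is
killed by some `p(E)` with `p(0) ≠ 0`, and cocycles are exact (`exists_eq_of_mem_unitTorsion`,
`exists_mem_add_eq`). Such arguments need only spanning sets of words, so no PBW basis is used.

On `I` (`vacIdeal_le_unitTorsion`) the homotopy replaces a letter of `𝔤` by a trailing `φ` of its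
projection to `𝔫`. It comes from the coaction `b ↦ b ⊗ 1 + 1 ⊗ ad b` of `C^I` and a functional on
`End 𝔤` that vanishes at the identity; simplicity of `𝔤` provides this functional. The diagonal
entries count the letters `X_a` and `φ_a`, the final one included, hence are positive.

On the quotient (`Frame.exists_genU_smul_vac`) the homotopy is left multiplication by `η = ∑ w_α
φ_α`, where `w_α` is dual to a homogeneous basis of `𝔫` under `(f | [·, ·])`; goodness of the pair
makes this possible. For a variant of the Kazhdan filtration the Laplacian counts the letters `w_α`
and `φ^α`, so all words containing some `φ^α` are in the invertible part.

To compare with `M⁰`, `C^I` is represented on `Hom(Λ(𝔫), M⁰)`. This gives a linear projection `pr :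
C^I → M⁰` that kills `I` and all coboundaries and sends `B ∈ U(𝔤)` to `B ⊗ 1`; by
`genU_mem_vacIdeal`, `U(𝔤) vac` is then a copy of `M⁰`. On cocycles `pr` is multiplicative
(`pr_mul`), has kernel the coboundaries (`cocyclesToWII_eq_zero`) and image `W^II`
(`cocyclesToWII_surjective`). -/

/-! ### Homotopies that are invertible up to a locally finite part -/

section UnitTorsion

open Polynomial

variable {V : Type*} [AddCommGroup V] [Module ℂ V]

/-- The vectors annihilated by `p(E)` for some polynomial `p` with `p(0) ≠ 0`. On this space
`E` is invertible. -/
def unitTorsion (E : Module.End ℂ V) : Submodule ℂ V where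
  carrier := {v | ∃ p : ℂ[X], p.eval 0 ≠ 0 ∧ aeval E p v = 0}
  add_mem' := by
    rintro v w ⟨p, hp, hpv⟩ ⟨q, hq, hqw⟩
    refine ⟨p * q, by rw [eval_mul]; exact mul_ne_zero hp hq, ?_⟩
    have h1 : aeval E (p * q) v = 0 := by
      rw [mul_comm, map_mul, Module.End.mul_apply, hpv, map_zero]
    have h2 : aeval E (p * q) w = 0 := by
      rw [map_mul, Module.End.mul_apply, hqw, map_zero]
    rw [map_add, h1, h2, add_zero]
  zero_mem' := ⟨1, by simp, by simp⟩
  smul_mem' := by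
    rintro c v ⟨p, hp, hpv⟩
    exact ⟨p, hp, by rw [map_smul, hpv, smul_zero]⟩

/-- The induction step for triangular operators: if `E` acts as `q` up to vectors already treated,
multiply their polynomial by `X - q`, whose value at `0` is `-q ≠ 0`. -/
theorem mem_unitTorsion_of_sub {E : Module.End ℂ V} {v : V} {q : ℂ} (hq : q ≠ 0)
    (h : E v - q • v ∈ unitTorsion E) : v ∈ unitTorsion E := by
  obtain ⟨p, hp, hpv⟩ := h
  refine ⟨p * (X - C q), ?_, ?_⟩
  · simpa using ⟨hp, hq⟩
  · rw [map_mul, Module.End.mul_apply]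
    simpa [Module.algebraMap_end_apply] using hpv

variable {D h : Module.End ℂ V}

/-- From `D² = 0`, both `D E` and `E D` equal `D h D` for `E = D h + h D`; polynomials in `E`
inherit this. -/
theorem aeval_homotopy_comm (hD : ∀ v, D (D v) = 0) (p : ℂ[X]) (v : V) :
    D (aeval (D * h + h * D) p v) = aeval (D * h + h * D) p (D v) := by
  have hc : Commute D (D * h + h * D) := by
    have h0 : D * D = 0 := LinearMap.ext hD
    change D * (D * h + h * D) = (D * h + h * D) * D
    rw [mul_add, add_mul, ← mul_assoc, h0, mul_assoc h, h0, zero_mul, mul_zero, zero_add, add_zero,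
      mul_assoc]
  have hp : Commute D (aeval (D * h + h * D) p) := by
    rw [aeval_eq_sum_range]
    exact Commute.sum_right _ _ _ fun i _ => (hc.pow_right i).smul_right _
  exact LinearMap.congr_fun hp.eq v

/-- Write `p = X q + p(0)`. The vector `y = q(E) v` is again a cocycle, so `E y = D h y`: on
cocycles `p(E)` is the scalar `p(0)` up to a coboundary. -/
theorem exists_sub_eq (hD : ∀ v, D (D v) = 0) (p : ℂ[X]) {v : V} (hv : D v = 0) :
    ∃ y, aeval (D * h + h * D) p v = p.eval 0 • v + D (h y) := by
  refine ⟨aeval (D * h + h * D) p.divX v, ?_⟩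
  conv_lhs => rw [← p.X_mul_divX_add]
  rw [map_add, map_mul, aeval_X, aeval_C, LinearMap.add_apply, Module.End.mul_apply,
    LinearMap.add_apply, Module.End.mul_apply, Module.End.mul_apply, aeval_homotopy_comm hD, hv,
    map_zero, map_zero, add_zero, Module.algebraMap_end_apply, coeff_zero_eq_eval_zero, add_comm]

/-- A cocycle in the unit torsion of the operator `D h + h D` is a coboundary. -/
theorem exists_eq_of_mem_unitTorsion (hD : ∀ v, D (D v) = 0) {v : V}
    (hv : v ∈ unitTorsion (D * h + h * D)) (hv0 : D v = 0) : ∃ y, v = D (h y) := by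
  obtain ⟨p, hp, hpv⟩ := hv
  obtain ⟨y, hy⟩ := exists_sub_eq (h := h) hD p hv0
  refine ⟨-(p.eval 0)⁻¹ • y, ?_⟩
  rw [hpv] at hy
  rw [map_smul, map_smul, eq_neg_of_add_eq_zero_right hy.symm, neg_smul, smul_neg, neg_neg,
    smul_smul, inv_mul_cancel₀ hp, one_smul]

/-- A cocycle is cohomologous to an element of a subspace stable under `D h + h D` which together
with the unit torsion of `D h + h D` spans. -/
theorem exists_mem_add_eq (hD : ∀ v, D (D v) = 0) {N : Submodule ℂ V}
    (hN : ∀ v ∈ N, (D * h + h * D) v ∈ N) {v : V} (hv0 : D v = 0)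
    (hv : v ∈ N ⊔ unitTorsion (D * h + h * D)) : ∃ w ∈ N, ∃ y, v = w + D y := by
  obtain ⟨w, hw, t, ⟨p, hp, hpt⟩, rfl⟩ := Submodule.mem_sup.mp hv
  obtain ⟨y, hy⟩ := exists_sub_eq (h := h) hD p hv0
  -- `p(E)` removes the torsion summand, so `p(E) v = p(E) w`, which remains in `N`.
  rw [map_add, hpt, add_zero] at hy
  have hN' : ∀ x ∈ N, aeval (D * h + h * D) p x ∈ N := fun x hx => by
    rw [aeval_eq_sum_range, LinearMap.sum_apply]
    refine sum_mem fun i hi => N.smul_mem _ ?_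
    clear hi
    induction i with
    | zero => exact hx
    | succ i ih => rw [pow_succ', Module.End.mul_apply]; exact hN _ ih
  refine ⟨(p.eval 0)⁻¹ • aeval (D * h + h * D) p w, N.smul_mem _ (hN' w hw),
    -(p.eval 0)⁻¹ • h y, ?_⟩
  rw [hy, map_smul, smul_add, smul_smul, inv_mul_cancel₀ hp, one_smul]
  module

end UnitTorsion


/-! ### The differential on the generators -/

namespace IsotropicSubspace

variable {𝔤 : Type*} [LieRing 𝔤] [LieAlgebra ℂ 𝔤] {P : GoodPair 𝔤} (L : IsotropicSubspace P)

theorem σ_genUp (p : Module.Dual ℂ L.n) : L.rBracket.σ (L.genUp p) = -L.genUp p := by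
  simp [genUp, SuperBracket.σ_ι, parity, ← map_neg]

theorem σ_genDown (a : L.n) : L.rBracket.σ (L.genDown a) = -L.genDown a := by
  simp [genDown, SuperBracket.σ_ι, parity, ← map_neg]

theorem σ_genG (b : 𝔤) : L.rBracket.σ (L.genG b) = L.genG b := by
  simp [genG, SuperBracket.σ_ι, parity]

theorem σ_genNe (v : L.Ne) : L.rBracket.σ (L.genNe v) = L.genNe v := by
  simp [genNe, SuperBracket.σ_ι, parity]

theorem σ_X (a : L.n) : L.rBracket.σ (L.X a) = L.X a := by
  simp only [X, LinearMap.add_apply, LinearMap.comp_apply, map_add, σ_genG, σ_genNe,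
    Algebra.linearMap_apply, AlgHom.commutes]

theorem X_def (a : L.n) :
    L.X a = L.genG a + algebraMap ℂ L.CI (P.form P.f a) + L.genNe (L.toNe a) := rfl

theorem genG_genUp (b : 𝔤) (p : Module.Dual ℂ L.n) :
    L.genG b * L.genUp p = L.genUp p * L.genG b := L.ι_even_odd_comm _ _

theorem genG_genDown (b : 𝔤) (a : L.n) : L.genG b * L.genDown a = L.genDown a * L.genG b :=
  L.ι_even_odd_comm _ _

theorem genNe_genUp (v : L.Ne) (p : Module.Dual ℂ L.n) :
    L.genNe v * L.genUp p = L.genUp p * L.genNe v := L.ι_even_odd_comm _ _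

theorem genNe_genDown (v : L.Ne) (a : L.n) : L.genNe v * L.genDown a = L.genDown a * L.genNe v :=
  L.ι_even_odd_comm _ _

theorem genNe_genG (v : L.Ne) (b : 𝔤) : L.genNe v * L.genG b = L.genG b * L.genNe v := by
  have h := L.ι_mul_even_even (0, v) (b, 0)
  rw [← sub_eq_zero]
  refine Eq.trans h ?_
  simp [lieBracket, scalarBracket]
  exact map_zero _

theorem genNe_genNe (v w : L.Ne) :
    L.genNe v * L.genNe w = L.genNe w * L.genNe v + algebraMap ℂ L.CI (L.neForm v w) := by
  have h := L.ι_mul_even_even (0, v) (0, w)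
  rw [← sub_eq_iff_eq_add']
  refine Eq.trans h ?_
  simp [lieBracket, scalarBracket]
  exact map_zero _

theorem genG_genG (b c : 𝔤) :
    L.genG b * L.genG c = L.genG c * L.genG b + L.genG ⁅b, c⁆ := by
  have h := L.ι_mul_even_even (b, 0) (c, 0)
  rw [← sub_eq_iff_eq_add']
  refine Eq.trans h ?_
  simp [lieBracket, scalarBracket, genG]

theorem X_genG (a : L.n) (b : 𝔤) : L.X a * L.genG b = L.genG b * L.X a + L.genG ⁅(a : 𝔤), b⁆ := by
  rw [X_def, add_mul, add_mul, mul_add, mul_add, genG_genG, genNe_genG, Algebra.commutes]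
  abel

theorem X_genNe (a : L.n) (v : L.Ne) :
    L.X a * L.genNe v = L.genNe v * L.X a + algebraMap ℂ L.CI (L.neForm (L.toNe a) v) := by
  rw [X_def, add_mul, add_mul, mul_add, mul_add, genNe_genG, genNe_genNe, Algebra.commutes]
  abel

/-- A subspace of `C^I` that contains `1` and is stable under left multiplication by the generators
is the whole of `C^I`. -/
theorem CI_induction (S : Submodule ℂ L.CI) (h1 : 1 ∈ S)
    (hG : ∀ b, ∀ A ∈ S, L.genG b * A ∈ S) (hNe : ∀ v, ∀ A ∈ S, L.genNe v * A ∈ S)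
    (hUp : ∀ p, ∀ A ∈ S, L.genUp p * A ∈ S) (hDown : ∀ a, ∀ A ∈ S, L.genDown a * A ∈ S)
    (A : L.CI) : A ∈ S := by
  have key : ∀ t : TensorAlgebra ℂ L.R, ∀ A ∈ S, L.rBracket.proj t * A ∈ S := by
    intro t
    induction t using TensorAlgebra.induction with
    | algebraMap r =>
      intro A hA
      rw [AlgHom.commutes, ← Algebra.smul_def]
      exact S.smul_mem r hA
    | ι v =>
      intro A hA
      have hv : L.rBracket.proj (TensorAlgebra.ι ℂ v) =
          L.genG v.1.1 + L.genNe v.1.2 + L.genUp v.2.1 + L.genDown v.2.2 := by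
        change L.rBracket.ι v = L.rBracket.ι ((v.1.1, 0), 0) + L.rBracket.ι ((0, v.1.2), 0) +
          L.rBracket.ι (0, (v.2.1, 0)) + L.rBracket.ι (0, (0, v.2.2))
        rw [← map_add, ← map_add, ← map_add]
        congr 1
        simp
      rw [hv, add_mul, add_mul, add_mul]
      exact add_mem (add_mem (add_mem (hG _ _ hA) (hNe _ _ hA)) (hUp _ _ hA)) (hDown _ _ hA)
    | mul s t hs ht =>
      intro A hA
      rw [map_mul, mul_assoc]
      exact hs _ (ht _ hA)
    | add s t hs ht =>
      intro A hA
      rw [map_add, add_mul]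
      exact add_mem (hs _ hA) (ht _ hA)
  obtain ⟨t, rfl⟩ := RingQuot.mkAlgHom_surjective ℂ L.rBracket.Rel A
  have h := key t 1 h1
  rw [mul_one] at h
  exact h

/-! ### The values of `d^I` on generators, and independence of the basis. -/

section Differential

variable {ι : Type*} [Fintype ι] (u : Module.Basis ι ℂ L.n)

/-- The differential `d^I` as a linear operator. -/
abbrev D : Module.End ℂ L.CI := (L.differentialI u).ad

/-- `θ_a = ∑_β φ^β φ_{[u_β, a]}` -/
abbrev θ : L.n →ₗ[ℂ] L.CI := theta u L.genUp L.genDown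

/-- `J_a = d^I φ_a = X_a + θ_a` -/
def J : L.n →ₗ[ℂ] L.CI := L.X + L.θ u

theorem J_apply (a : L.n) : L.J u a = L.X a + L.θ u a := rfl

theorem dI_eq : L.dI u = ∑ i, L.genUp (u.coord i) * L.X (u i) +
    (1 / 2 : ℂ) • ∑ i, L.genUp (u.coord i) * L.θ u (u i) := by
  rw [dI]
  simp only [theta_apply, Finset.mul_sum, mul_assoc]
  rfl

theorem D_apply (A : L.CI) : L.D u A = L.dI u * A - L.rBracket.σ A * L.dI u := rfl

theorem D_mul (A B : L.CI) : L.D u (A * B) = L.D u A * B + L.rBracket.σ A * L.D u B :=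
  (L.differentialI u).ad_mul A B

theorem D_D (A : L.CI) : L.D u (L.D u A) = 0 := (L.differentialI u).ad_ad A

theorem D_σ (A : L.CI) : L.D u (L.rBracket.σ A) = -L.rBracket.σ (L.D u A) :=
  (L.differentialI u).ad_σ A

theorem θ_genG (a : L.n) (b : 𝔤) : L.θ u a * L.genG b = L.genG b * L.θ u a := by
  rw [theta_apply, Finset.sum_mul, Finset.mul_sum]
  refine Finset.sum_congr rfl fun j _ => ?_
  rw [← mul_assoc, genG_genUp, mul_assoc, ← genG_genDown, mul_assoc]

theorem θ_genNe (a : L.n) (v : L.Ne) : L.θ u a * L.genNe v = L.genNe v * L.θ u a := by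
  rw [theta_apply, Finset.sum_mul, Finset.mul_sum]
  refine Finset.sum_congr rfl fun j _ => ?_
  rw [← mul_assoc, genNe_genUp, mul_assoc, ← genNe_genDown, mul_assoc]

theorem θ_genUp (a : L.n) (p : Module.Dual ℂ L.n) :
    L.θ u a * L.genUp p = L.genUp p * L.θ u a + ∑ k, p ⁅u k, a⁆ • L.genUp (u.coord k) :=
  theta_c u _ _ L.genUp_genUp L.genDown_genUp a p

theorem θ_genDown (a e : L.n) :
    L.θ u a * L.genDown e = L.genDown e * L.θ u a + L.genDown ⁅a, e⁆ :=
  theta_b u _ _ L.genDown_genUp L.genDown_genDown a e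

theorem J_genG (a : L.n) (b : 𝔤) :
    L.J u a * L.genG b = L.genG b * L.J u a + L.genG ⁅(a : 𝔤), b⁆ := by
  rw [J_apply, add_mul, mul_add, X_genG, θ_genG]
  abel

theorem J_genUp (a : L.n) (p : Module.Dual ℂ L.n) :
    L.J u a * L.genUp p = L.genUp p * L.J u a + ∑ k, p ⁅u k, a⁆ • L.genUp (u.coord k) := by
  rw [J_apply, add_mul, mul_add, X_genUp, θ_genUp]
  abel

theorem D_genG (b : 𝔤) :
    L.D u (L.genG b) = ∑ i, L.genUp (u.coord i) * L.genG ⁅(u i : 𝔤), b⁆ := by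
  rw [D_apply, dI_eq, σ_genG, add_mul, mul_add, smul_mul_assoc, mul_smul_comm,
    Finset.sum_mul, Finset.sum_mul, Finset.mul_sum, Finset.mul_sum, add_sub_add_comm,
    ← Finset.sum_sub_distrib, ← smul_sub, ← Finset.sum_sub_distrib]
  have h : ∀ i, L.genUp (u.coord i) * L.θ u (u i) * L.genG b -
      L.genG b * (L.genUp (u.coord i) * L.θ u (u i)) = 0 := fun i => by
    rw [mul_assoc, θ_genG, ← mul_assoc, ← mul_assoc, genG_genUp, sub_self]
  simp only [h, Finset.sum_const_zero, smul_zero, add_zero]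
  refine Finset.sum_congr rfl fun i _ => ?_
  rw [mul_assoc, X_genG, ← mul_assoc (L.genG b), genG_genUp, mul_add, mul_assoc,
    add_sub_cancel_left]

theorem D_genNe (v : L.Ne) :
    L.D u (L.genNe v) = ∑ i, L.neForm (L.toNe (u i)) v • L.genUp (u.coord i) := by
  rw [D_apply, dI_eq, σ_genNe, add_mul, mul_add, smul_mul_assoc, mul_smul_comm,
    Finset.sum_mul, Finset.sum_mul, Finset.mul_sum, Finset.mul_sum, add_sub_add_comm,
    ← Finset.sum_sub_distrib, ← smul_sub, ← Finset.sum_sub_distrib]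
  have h : ∀ i, L.genUp (u.coord i) * L.θ u (u i) * L.genNe v -
      L.genNe v * (L.genUp (u.coord i) * L.θ u (u i)) = 0 := fun i => by
    rw [mul_assoc, θ_genNe, ← mul_assoc, ← mul_assoc, genNe_genUp, sub_self]
  simp only [h, Finset.sum_const_zero, smul_zero, add_zero]
  refine Finset.sum_congr rfl fun i _ => ?_
  rw [mul_assoc, X_genNe, ← mul_assoc (L.genNe v), genNe_genUp, mul_add, mul_assoc,
    add_sub_cancel_left, ← Algebra.commutes, Algebra.smul_def]

/-- The part `∑ φ^i X_i` of `d` anticommutes with `φ^p`, so only the cubic term contributes, as the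
Chevalley–Eilenberg differential on `𝔫*`. -/
theorem D_genUp (p : Module.Dual ℂ L.n) : L.D u (L.genUp p) =
    (1 / 2 : ℂ) • ∑ i, ∑ k, p ⁅u k, u i⁆ • (L.genUp (u.coord i) * L.genUp (u.coord k)) := by
  rw [D_apply, dI_eq, σ_genUp, neg_mul, sub_neg_eq_add, add_mul, mul_add, smul_mul_assoc,
    mul_smul_comm, Finset.sum_mul, Finset.sum_mul, Finset.mul_sum, Finset.mul_sum, add_add_add_comm,
    ← Finset.sum_add_distrib, ← smul_add, ← Finset.sum_add_distrib]
  have h : ∀ i, L.genUp (u.coord i) * L.X (u i) * L.genUp p +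
      L.genUp p * (L.genUp (u.coord i) * L.X (u i)) = 0 := fun i => by
    rw [mul_assoc, X_genUp, ← mul_assoc, ← mul_assoc, genUp_genUp, neg_mul, neg_add_cancel]
  simp only [h, Finset.sum_const_zero, zero_add]
  congr 1
  refine Finset.sum_congr rfl fun i _ => ?_
  rw [mul_assoc, θ_genUp, ← mul_assoc (L.genUp p), L.genUp_genUp p, mul_add, neg_mul, mul_assoc,
    Finset.mul_sum]
  simp only [mul_smul_comm]
  abel

/-- In the cubic term `φ_a` contracts either of the two factors `φ`. Both contractions sum to `θ_a`,
which cancels the factor `1/2`. -/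
theorem D_genDown (a : L.n) : L.D u (L.genDown a) = L.J u a := by
  rw [D_apply, dI_eq, σ_genDown, neg_mul, sub_neg_eq_add, add_mul, mul_add, smul_mul_assoc,
    mul_smul_comm, Finset.sum_mul, Finset.sum_mul, Finset.mul_sum, Finset.mul_sum, add_add_add_comm,
    ← Finset.sum_add_distrib, ← smul_add, ← Finset.sum_add_distrib]
  have h1 : ∀ i, L.genUp (u.coord i) * L.X (u i) * L.genDown a +
      L.genDown a * (L.genUp (u.coord i) * L.X (u i)) = u.coord i a • L.X (u i) := fun i => by
    rw [mul_assoc, X_genDown, ← mul_assoc, ← mul_assoc, genDown_genUp, sub_mul, Algebra.smul_def]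
    abel
  have h2 : ∀ i, L.genUp (u.coord i) * L.θ u (u i) * L.genDown a +
      L.genDown a * (L.genUp (u.coord i) * L.θ u (u i)) =
      u.coord i a • L.θ u (u i) + L.genUp (u.coord i) * L.genDown ⁅u i, a⁆ := fun i => by
    rw [mul_assoc, θ_genDown, ← mul_assoc (L.genDown a), genDown_genUp, sub_mul, Algebra.smul_def,
      mul_add, mul_assoc]
    abel
  simp only [h1, h2, Finset.sum_add_distrib]
  rw [sum_coord_smul, sum_coord_smul, ← theta_apply, J_apply]
  module

/-- The sum evaluates `B` on the canonical element of `𝔫* ⊗ 𝔫`. This lets the arbitrary basis of the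
theorem be traded for a homogeneous one. -/
theorem sum_coord_eq {A κ : Type*} [AddCommGroup A] [Module ℂ A] [Fintype κ]
    (u' : Module.Basis κ ℂ L.n) (B : Module.Dual ℂ L.n →ₗ[ℂ] L.n →ₗ[ℂ] A) :
    ∑ i, B (u.coord i) (u i) = ∑ j, B (u'.coord j) (u' j) := by
  have h1 : ∀ i, B (u.coord i) (u i) = ∑ j, u'.coord j (u i) • B (u.coord i) (u' j) := fun i => by
    conv_lhs => rw [← u'.sum_repr (u i), map_sum]
    simp
  have h2 : ∀ j, B (u'.coord j) (u' j) = ∑ i, u'.coord j (u i) • B (u.coord i) (u' j) := fun j => by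
    have h : u'.coord j = ∑ i, u'.coord j (u i) • u.coord i := by
      refine u.ext fun k => ?_
      rw [LinearMap.sum_apply]
      classical
      simp [Finsupp.single_apply]
    conv_lhs => rw [h, map_sum, LinearMap.sum_apply]
    simp
  rw [Finset.sum_congr rfl fun i _ => h1 i, Finset.sum_congr rfl fun i _ => h2 i, Finset.sum_comm]

theorem θ_eq {κ : Type*} [Fintype κ] (u' : Module.Basis κ ℂ L.n) : L.θ u = L.θ u' := by
  ext a
  rw [theta_apply, theta_apply]
  have h := L.sum_coord_eq u u' ((LinearMap.mul ℂ L.CI ∘ₗ L.genUp).compl₂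
    (-(L.genDown ∘ₗ (LieAlgebra.ad ℂ L.n a : L.n →ₗ[ℂ] L.n))))
  simpa only [LinearMap.compl₂_apply, LinearMap.comp_apply, LinearMap.neg_apply,
    LieAlgebra.ad_apply, ← map_neg, lie_skew, LinearMap.mul_apply'] using h

/-- The element `d` does not depend on the choice of a basis. -/
theorem dI_eq_dI {κ : Type*} [Fintype κ] (u' : Module.Basis κ ℂ L.n) : L.dI u = L.dI u' := by
  rw [dI_eq, dI_eq, L.θ_eq u u']
  have h1 := L.sum_coord_eq u u' ((LinearMap.mul ℂ L.CI ∘ₗ L.genUp).compl₂ L.X)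
  have h2 := L.sum_coord_eq u u' ((LinearMap.mul ℂ L.CI ∘ₗ L.genUp).compl₂ (L.θ u'))
  simp only [LinearMap.compl₂_apply, LinearMap.comp_apply, LinearMap.mul_apply'] at h1 h2
  rw [h1, h2]

end Differential

end IsotropicSubspace


/-! ### A homotopy built from the adjoint representation -/

namespace IsotropicSubspace

variable {𝔤 : Type*} [LieRing 𝔤] [LieAlgebra ℂ 𝔤] {P : GoodPair 𝔤} (L : IsotropicSubspace P)

/-- The algebra `C^I ⊗ End 𝔤`. -/
def CIEnd : Type _ := L.CI ⊗[ℂ] Module.End ℂ 𝔤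

instance : Ring L.CIEnd := inferInstanceAs (Ring (L.CI ⊗[ℂ] Module.End ℂ 𝔤))

instance : Algebra ℂ L.CIEnd := inferInstanceAs (Algebra ℂ (L.CI ⊗[ℂ] Module.End ℂ 𝔤))

/-- The inclusion `C^I → C^I ⊗ End 𝔤`. -/
def inlCI : L.CI →ₐ[ℂ] L.CIEnd := Algebra.TensorProduct.includeLeft (R := ℂ) (S := ℂ)

/-- The inclusion `End 𝔤 → C^I ⊗ End 𝔤`. -/
def inrEnd : Module.End ℂ 𝔤 →ₐ[ℂ] L.CIEnd :=
  Algebra.TensorProduct.includeRight (R := ℂ) (A := L.CI)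

theorem inrEnd_mul_inlCI (g : Module.End ℂ 𝔤) (A : L.CI) :
    L.inrEnd g * L.inlCI A = L.inlCI A * L.inrEnd g := by
  refine (Algebra.TensorProduct.tmul_mul_tmul (1 : L.CI) A g 1).trans
    (Eq.trans ?_ (Algebra.TensorProduct.tmul_mul_tmul A (1 : L.CI) 1 g).symm)
  rw [mul_one, one_mul, mul_one, one_mul]

/-- The map `r ↦ r ⊗ 1 + 1 ⊗ ad r`, where only the component of `r` in `𝔤` acts. -/
def coactLin : L.R →ₗ[ℂ] L.CIEnd :=
  L.inlCI.toLinearMap ∘ₗ L.rBracket.ι + L.inrEnd.toLinearMap ∘ₗ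
    (LieAlgebra.ad ℂ 𝔤 : 𝔤 →ₗ[ℂ] Module.End ℂ 𝔤) ∘ₗ LinearMap.fst ℂ _ _ ∘ₗ LinearMap.fst ℂ _ _

theorem coactLin_apply (r : L.R) : L.coactLin r =
    L.inlCI (L.rBracket.ι r) + L.inrEnd (LieAlgebra.ad ℂ 𝔤 r.1.1) := rfl

theorem lift_coactLin_bracket (r s : L.R) :
    TensorAlgebra.lift ℂ L.coactLin (L.rBracket.bracket r s) =
      L.inlCI (L.rBracket.proj (L.rBracket.bracket r s)) +
        L.inrEnd (LieAlgebra.ad ℂ 𝔤 ⁅r.1.1, s.1.1⁆) := by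
  rw [proj_rBracket]
  change TensorAlgebra.lift ℂ L.coactLin
    (TensorAlgebra.ι ℂ (L.lieBracket r s) + algebraMap ℂ _ (L.scalarBracket r s)) = _
  rw [map_add, TensorAlgebra.lift_ι_apply, AlgHom.commutes, coactLin_apply, map_add,
    AlgHom.commutes]
  have h : (L.lieBracket r s).1.1 = ⁅r.1.1, s.1.1⁆ := rfl
  rw [h]
  abel

/-- The two tensor factors commute without signs, since `End 𝔤` is purely even here; what is left is
that `ad` preserves brackets. -/
theorem coactLin_commutator (r s : L.R) :
    L.coactLin r * L.coactLin s - L.coactLin s * L.coactLin r =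
      L.inlCI (L.rBracket.ι r * L.rBracket.ι s - L.rBracket.ι s * L.rBracket.ι r) +
        L.inrEnd (LieAlgebra.ad ℂ 𝔤 ⁅r.1.1, s.1.1⁆) := by
  simp only [coactLin_apply, mul_add, add_mul, LieHom.map_lie, LieRing.of_associative_ring_bracket,
    map_sub, map_mul, inrEnd_mul_inlCI]
  abel

/-- The homomorphism `C^I → C^I ⊗ End 𝔤` with `b ↦ b ⊗ 1 + 1 ⊗ ad b` for `b ∈ 𝔤` and `y ↦ y ⊗ 1`
for the other generators. -/
def coact : L.CI →ₐ[ℂ] L.CIEnd :=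
  L.rBracket.lift (TensorAlgebra.lift ℂ L.coactLin) (by
    intro s t h
    cases h with
    | even_even a b =>
      rw [lift_coactLin_bracket, ← L.rBracket.proj_rel (SuperBracket.Rel.even_even a b)]
      simp only [map_sub, map_mul, TensorAlgebra.lift_ι_apply, coactLin_commutator]
      rfl
    | even_odd a b =>
      rw [lift_coactLin_bracket, ← L.rBracket.proj_rel (SuperBracket.Rel.even_odd a b)]
      simp only [map_sub, map_mul, TensorAlgebra.lift_ι_apply, coactLin_commutator]
      rfl
    | odd_even a b =>
      rw [lift_coactLin_bracket, ← L.rBracket.proj_rel (SuperBracket.Rel.odd_even a b)]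
      simp only [map_sub, map_mul, TensorAlgebra.lift_ι_apply, coactLin_commutator]
      rfl
    | odd_odd a b =>
      rw [lift_coactLin_bracket, ← L.rBracket.proj_rel (SuperBracket.Rel.odd_odd a b)]
      simp only [map_add, map_mul, TensorAlgebra.lift_ι_apply, coactLin_apply, Prod.fst_zero,
        zero_lie, map_zero, add_zero]
      rfl)

theorem coact_ι (r : L.R) : L.coact (L.rBracket.ι r) =
    L.inlCI (L.rBracket.ι r) + L.inrEnd (LieAlgebra.ad ℂ 𝔤 r.1.1) := by
  change L.rBracket.lift _ _ (L.rBracket.proj (TensorAlgebra.ι ℂ r)) = _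
  rw [SuperBracket.lift_proj, TensorAlgebra.lift_ι_apply, coactLin_apply]

theorem coact_genG (b : 𝔤) :
    L.coact (L.genG b) = L.inlCI (L.genG b) + L.inrEnd (LieAlgebra.ad ℂ 𝔤 b) := L.coact_ι _

theorem coact_genNe (v : L.Ne) : L.coact (L.genNe v) = L.inlCI (L.genNe v) := by
  refine (L.coact_ι _).trans ?_
  simp [genNe]

theorem coact_genUp (p : Module.Dual ℂ L.n) : L.coact (L.genUp p) = L.inlCI (L.genUp p) := by
  refine (L.coact_ι _).trans ?_
  simp [genUp]

theorem coact_genDown (a : L.n) : L.coact (L.genDown a) = L.inlCI (L.genDown a) := by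
  refine (L.coact_ι _).trans ?_
  simp [genDown]

/-- The map `c ⊗ g ↦ c φ_{μ(g)}`. -/
def contr (μ : Module.End ℂ 𝔤 →ₗ[ℂ] L.n) : L.CIEnd →ₗ[ℂ] L.CI :=
  LinearMap.mul' ℂ L.CI ∘ₗ (L.genDown ∘ₗ μ).lTensor L.CI

theorem contr_tmul (μ : Module.End ℂ 𝔤 →ₗ[ℂ] L.n) (A : L.CI) (g : Module.End ℂ 𝔤) :
    L.contr μ (A ⊗ₜ[ℂ] g : L.CI ⊗[ℂ] Module.End ℂ 𝔤) = A * L.genDown (μ g) := rfl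

theorem contr_one (μ : Module.End ℂ 𝔤 →ₗ[ℂ] L.n) : L.contr μ 1 = L.genDown (μ 1) :=
  (L.contr_tmul μ 1 1).trans (one_mul _)

theorem CIEnd_induction {p : L.CIEnd → Prop} (h0 : p 0)
    (htmul : ∀ (A : L.CI) (g : Module.End ℂ 𝔤), p (A ⊗ₜ[ℂ] g : L.CI ⊗[ℂ] Module.End ℂ 𝔤))
    (hadd : ∀ s t, p s → p t → p (s + t)) (t : L.CIEnd) : p t :=
  TensorProduct.induction_on (motive := p) t h0 htmul hadd

theorem contr_inlCI_mul (μ : Module.End ℂ 𝔤 →ₗ[ℂ] L.n) (A : L.CI) (t : L.CIEnd) :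
    L.contr μ (L.inlCI A * t) = A * L.contr μ t := by
  induction t using L.CIEnd_induction with
  | h0 => simp only [mul_zero, map_zero]
  | htmul B g =>
    refine (congrArg (L.contr μ) (Algebra.TensorProduct.tmul_mul_tmul A B 1 g)).trans ?_
    rw [contr_tmul, contr_tmul, one_mul, mul_assoc]
  | hadd s t hs ht => rw [mul_add, map_add, hs, ht, map_add, mul_add]

/-- The functional `g ↦ μ(ad b ∘ g)`. -/
def twist (μ : Module.End ℂ 𝔤 →ₗ[ℂ] L.n) (b : 𝔤) : Module.End ℂ 𝔤 →ₗ[ℂ] L.n :=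
  μ ∘ₗ LinearMap.mulLeft ℂ (LieAlgebra.ad ℂ 𝔤 b)

theorem twist_one (μ : Module.End ℂ 𝔤 →ₗ[ℂ] L.n) (b : 𝔤) :
    L.twist μ b 1 = μ (LieAlgebra.ad ℂ 𝔤 b) := by
  simp [twist]

/-- Factors `ad b` in the second leg are absorbed into the functional. This is why the formulas and
inductions below run over all `μ` at once. -/
theorem contr_inrEnd_mul (μ : Module.End ℂ 𝔤 →ₗ[ℂ] L.n) (b : 𝔤) (t : L.CIEnd) :
    L.contr μ (L.inrEnd (LieAlgebra.ad ℂ 𝔤 b) * t) = L.contr (L.twist μ b) t := by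
  induction t using L.CIEnd_induction with
  | h0 => simp only [mul_zero, map_zero]
  | htmul B g =>
    refine (congrArg (L.contr μ) (Algebra.TensorProduct.tmul_mul_tmul 1 B
      (LieAlgebra.ad ℂ 𝔤 b) g)).trans ?_
    rw [contr_tmul, contr_tmul, one_mul]
    rfl
  | hadd s t hs ht => rw [mul_add, map_add, hs, ht, map_add]

/-- The operator `A ↦ (1 ⊗ φ μ)(Δ(σ A))` on `C^I`. -/
def htpy (μ : Module.End ℂ 𝔤 →ₗ[ℂ] L.n) : Module.End ℂ L.CI :=
  L.contr μ ∘ₗ L.coact.toLinearMap ∘ₗ L.rBracket.σ.toLinearMap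

variable (μ : Module.End ℂ 𝔤 →ₗ[ℂ] L.n)

theorem htpy_apply (A : L.CI) : L.htpy μ A = L.contr μ (L.coact (L.rBracket.σ A)) := rfl

theorem htpy_one : L.htpy μ 1 = L.genDown (μ 1) := by
  rw [htpy_apply, map_one, map_one, contr_one]

/-- Either `b` stays in place or it is consumed by the functional. If `μ(1) = 0` and `μ(ad b) =
π(b)`, the leading terms of `htpy μ` replace one letter of `𝔤` by a trailing `φ_{π(b)}`; terms
consuming several letters are of lower order. -/
theorem htpy_genG_mul (b : 𝔤) (A : L.CI) :
    L.htpy μ (L.genG b * A) = L.genG b * L.htpy μ A + L.htpy (L.twist μ b) A := by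
  rw [htpy_apply, map_mul, map_mul, σ_genG, coact_genG, add_mul, map_add, contr_inlCI_mul,
    contr_inrEnd_mul]
  rfl

theorem htpy_genNe_mul (v : L.Ne) (A : L.CI) :
    L.htpy μ (L.genNe v * A) = L.genNe v * L.htpy μ A := by
  rw [htpy_apply, map_mul, map_mul, σ_genNe, coact_genNe, contr_inlCI_mul, ← htpy_apply]

theorem htpy_genUp_mul (p : Module.Dual ℂ L.n) (A : L.CI) :
    L.htpy μ (L.genUp p * A) = -(L.genUp p * L.htpy μ A) := by
  rw [htpy_apply, map_mul, σ_genUp, neg_mul, map_neg, map_mul, coact_genUp, map_neg,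
    contr_inlCI_mul, ← htpy_apply]

theorem htpy_genDown_mul (a : L.n) (A : L.CI) :
    L.htpy μ (L.genDown a * A) = -(L.genDown a * L.htpy μ A) := by
  rw [htpy_apply, map_mul, σ_genDown, neg_mul, map_neg, map_mul, coact_genDown, map_neg,
    contr_inlCI_mul, ← htpy_apply]

theorem htpy_X_mul (a : L.n) (A : L.CI) :
    L.htpy μ (L.X a * A) = L.X a * L.htpy μ A + L.htpy (L.twist μ a) A := by
  rw [X_def, add_mul, add_mul, map_add, map_add, htpy_genG_mul, htpy_genNe_mul,
    ← Algebra.smul_def, map_smul, add_mul, add_mul, ← Algebra.smul_def]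
  abel

variable {ι : Type*} [Fintype ι] (u : Module.Basis ι ℂ L.n)

theorem htpy_θ_mul (a : L.n) (A : L.CI) : L.htpy μ (L.θ u a * A) = L.θ u a * L.htpy μ A := by
  rw [theta_apply, Finset.sum_mul, Finset.sum_mul, map_sum]
  refine Finset.sum_congr rfl fun j _ => ?_
  rw [mul_assoc, htpy_genUp_mul, htpy_genDown_mul, mul_neg, neg_neg, mul_assoc]

/-- The operator `d h + h d`. -/
abbrev lap : Module.End ℂ L.CI := L.D u * L.htpy μ + L.htpy μ * L.D u

theorem lap_apply (A : L.CI) : L.lap μ u A = L.D u (L.htpy μ A) + L.htpy μ (L.D u A) := rfl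

theorem D_one : L.D u 1 = 0 := by
  rw [D_apply, map_one, mul_one, one_mul, sub_self]

theorem lap_one : L.lap μ u 1 = L.J u (μ 1) := by
  rw [lap_apply, htpy_one, D_genDown, D_one, map_zero, add_zero]

/-- The homotopy fails to commute with `b` by its twist, so the Laplacian picks up the twisted
Laplacian. The last sum is the same failure for the letters `[u_i, b]` that occur in `d b`. -/
theorem lap_genG_mul (b : 𝔤) (A : L.CI) : L.lap μ u (L.genG b * A) =
    L.genG b * L.lap μ u A + L.lap (L.twist μ b) u A -
      ∑ i, L.genUp (u.coord i) * L.htpy (L.twist μ ⁅(u i : 𝔤), b⁆) A := by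
  have h : L.htpy μ (L.D u (L.genG b) * A) = -(L.D u (L.genG b) * L.htpy μ A) -
      ∑ i, L.genUp (u.coord i) * L.htpy (L.twist μ ⁅(u i : 𝔤), b⁆) A := by
    rw [D_genG, Finset.sum_mul, Finset.sum_mul, map_sum, ← Finset.sum_neg_distrib,
      ← Finset.sum_sub_distrib]
    refine Finset.sum_congr rfl fun i _ => ?_
    rw [mul_assoc, htpy_genUp_mul, htpy_genG_mul, mul_add, mul_assoc]
    abel
  rw [lap_apply, htpy_genG_mul, map_add, D_mul, D_mul, map_add, h, σ_genG, htpy_genG_mul,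
    lap_apply, lap_apply, mul_add]
  abel

theorem lap_genNe_mul (v : L.Ne) (A : L.CI) :
    L.lap μ u (L.genNe v * A) = L.genNe v * L.lap μ u A := by
  have h : L.htpy μ (L.D u (L.genNe v) * A) = -(L.D u (L.genNe v) * L.htpy μ A) := by
    rw [D_genNe, Finset.sum_mul, Finset.sum_mul, map_sum, ← Finset.sum_neg_distrib]
    refine Finset.sum_congr rfl fun i _ => ?_
    rw [smul_mul_assoc, map_smul, htpy_genUp_mul, smul_mul_assoc, smul_neg]
  rw [lap_apply, htpy_genNe_mul, D_mul, D_mul, map_add, h, σ_genNe, htpy_genNe_mul,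
    lap_apply, mul_add]
  abel

theorem lap_genUp_mul (p : Module.Dual ℂ L.n) (A : L.CI) :
    L.lap μ u (L.genUp p * A) = L.genUp p * L.lap μ u A := by
  have h : L.htpy μ (L.D u (L.genUp p) * A) = L.D u (L.genUp p) * L.htpy μ A := by
    rw [D_genUp, smul_mul_assoc, smul_mul_assoc, map_smul, Finset.sum_mul, Finset.sum_mul, map_sum]
    congr 1
    refine Finset.sum_congr rfl fun i _ => ?_
    rw [Finset.sum_mul, Finset.sum_mul, map_sum]
    refine Finset.sum_congr rfl fun k _ => ?_
    rw [smul_mul_assoc, map_smul, mul_assoc, htpy_genUp_mul, htpy_genUp_mul, mul_neg, neg_neg,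
      smul_mul_assoc, mul_assoc]
  rw [lap_apply, htpy_genUp_mul, D_mul, map_neg, D_mul, map_add, h, σ_genUp, neg_mul, neg_mul,
    map_neg,
    htpy_genUp_mul, lap_apply, mul_add]
  abel

/-- The extra term appears because `d φ_a = X_a + θ_a`: the homotopy supercommutes with `θ_a` but
not with `X_a`. -/
theorem lap_genDown_mul (a : L.n) (A : L.CI) : L.lap μ u (L.genDown a * A) =
    L.genDown a * L.lap μ u A + L.htpy (L.twist μ a) A := by
  have h : L.htpy μ (L.D u (L.genDown a) * A) =
      L.D u (L.genDown a) * L.htpy μ A + L.htpy (L.twist μ a) A := by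
    rw [D_genDown, J_apply, add_mul, add_mul, map_add, htpy_X_mul, htpy_θ_mul]
    abel
  rw [lap_apply, htpy_genDown_mul, D_mul, map_neg, D_mul, map_add, h, σ_genDown, neg_mul, neg_mul,
    map_neg,
    htpy_genDown_mul, lap_apply, mul_add]
  abel

theorem lap_X_mul (a : L.n) (A : L.CI) : L.lap μ u (L.X a * A) =
    L.X a * L.lap μ u A + L.lap (L.twist μ a) u A -
      ∑ i, L.genUp (u.coord i) * L.htpy (L.twist μ ⁅(u i : 𝔤), (a : 𝔤)⁆) A := by
  rw [X_def, add_mul, add_mul, map_add, map_add, lap_genG_mul, lap_genNe_mul,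
    ← Algebra.smul_def, map_smul, add_mul, add_mul, ← Algebra.smul_def]
  abel

end IsotropicSubspace


/-! ### Acyclicity of the left ideal generated by `X_a` and `φ_a` -/

namespace IsotropicSubspace

variable {𝔤 : Type*} [LieRing 𝔤] [LieAlgebra ℂ 𝔤] {P : GoodPair 𝔤} (L : IsotropicSubspace P)

/-- Generators of `C^I` adapted to a projection `π : 𝔤 → 𝔫`. -/
inductive Letter (π : 𝔤 →ₗ[ℂ] L.n)
  | g (c : LinearMap.ker π)
  | ne (v : L.Ne)
  | up (p : Module.Dual ℂ L.n)
  | xe (a : L.n)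
  | down (a : L.n)

variable {L} {π : 𝔤 →ₗ[ℂ] L.n}

namespace Letter

/-- The element of `C^I` corresponding to a letter. -/
def val : Letter L π → L.CI
  | g c => L.genG c
  | ne v => L.genNe v
  | up p => L.genUp p
  | xe a => L.X a
  | down a => L.genDown a

/-- The degree of a letter. -/
def deg : Letter L π → ℕ
  -- The value `2` rather than `1` pays for `∑ φ^i φ_{π[u_i, c]}`, of degree `1`, which a letter `c
  -- ∈ ker π` creates in the Laplacian.
  | g _ => 2
  | ne _ => 1
  | up _ => 0
  | xe _ => 1
  | down _ => 1

/-- The number (`0` or `1`) of factors `X_a` or `φ_a`. -/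
def num : Letter L π → ℕ
  | g _ => 0
  | ne _ => 0
  | up _ => 0
  | xe _ => 1
  | down _ => 1

/-- The product of the letters of a word. -/
def wval : List (Letter L π) → L.CI
  | [] => 1
  | y :: w => y.val * wval w

/-- The degree of a word. -/
def wdeg : List (Letter L π) → ℕ
  | [] => 0
  | y :: w => wdeg w + y.deg

/-- The number of factors `X_a` or `φ_a` of a word. -/
def wnum : List (Letter L π) → ℕ
  | [] => 0
  | y :: w => wnum w + y.num

theorem wval_append (w w' : List (Letter L π)) : wval (w ++ w') = wval w * wval w' := by
  induction w with
  | nil => exact (one_mul _).symm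
  | cons y w ih => rw [List.cons_append, wval, ih, wval, mul_assoc]

theorem wdeg_append (w w' : List (Letter L π)) : wdeg (w ++ w') = wdeg w + wdeg w' := by
  induction w with
  | nil => exact (Nat.zero_add _).symm
  | cons y w ih => rw [List.cons_append, wdeg, ih, wdeg]; omega

theorem σ_wval (w : List (Letter L π)) : ∃ ε : ℂ, L.rBracket.σ (wval w) = ε • wval w := by
  induction w with
  | nil => exact ⟨1, by rw [wval, map_one, one_smul]⟩
  | cons y w ih =>
    obtain ⟨ε, h⟩ := ih
    have hy : ∃ η : ℂ, L.rBracket.σ y.val = η • y.val := by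
      cases y with
      | g c => exact ⟨1, by rw [val, σ_genG, one_smul]⟩
      | ne v => exact ⟨1, by rw [val, σ_genNe, one_smul]⟩
      | up p => exact ⟨-1, by rw [val, σ_genUp, neg_one_smul]⟩
      | xe a => exact ⟨1, by rw [val, σ_X, one_smul]⟩
      | down a => exact ⟨-1, by rw [val, σ_genDown, neg_one_smul]⟩
    obtain ⟨η, h'⟩ := hy
    exact ⟨η * ε, by rw [wval, map_mul, h, h', smul_mul_smul_comm]⟩

end Letter

open Letter

variable (L) in
/-- The elements `X_a` and `φ_a`. -/
def tails : Set L.CI := Set.range L.X ∪ Set.range L.genDown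

theorem X_mem_tails (a : L.n) : L.X a ∈ L.tails := Or.inl ⟨a, rfl⟩

theorem genDown_mem_tails (a : L.n) : L.genDown a ∈ L.tails := Or.inr ⟨a, rfl⟩

variable (L) in
/-- The left ideal of `C^I` generated by the elements `X_a` and `φ_a`. -/
def vacIdeal : Submodule L.CI L.CI := Submodule.span L.CI L.tails

variable (π) in
/-- The span of the words of degree at most `k` whose last letter is some `X_a` or `φ_a`. -/
def fil (k : ℕ) : Submodule ℂ L.CI :=
  Submodule.span ℂ {A | ∃ (w : List (Letter L π)) (s : L.CI), s ∈ L.tails ∧ wdeg w + 1 ≤ k ∧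
    A = wval w * s}

theorem wval_mul_mem_fil {w : List (Letter L π)} {s : L.CI} (hs : s ∈ L.tails) {k : ℕ}
    (hk : wdeg w + 1 ≤ k) : wval w * s ∈ fil π k :=
  Submodule.subset_span ⟨w, s, hs, hk, rfl⟩

theorem fil_mono {k k' : ℕ} (h : k ≤ k') : fil π k ≤ fil π k' :=
  Submodule.span_mono fun _ ⟨w, s, hs, hk, hA⟩ => ⟨w, s, hs, hk.trans h, hA⟩

theorem fil_zero : fil π 0 = ⊥ := by
  rw [fil, Submodule.span_eq_bot]
  rintro _ ⟨w, s, _, hk, _⟩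
  omega

theorem val_mul_mem_fil (y : Letter L π) {k : ℕ} {A : L.CI} (hA : A ∈ fil π k) :
    y.val * A ∈ fil π (k + y.deg) := by
  have : fil π k ≤ (fil π (k + y.deg)).comap (LinearMap.mulLeft ℂ y.val) := by
    refine Submodule.span_le.mpr ?_
    rintro _ ⟨w, s, hs, hk, rfl⟩
    refine Submodule.subset_span ⟨y :: w, s, hs, ?_, ?_⟩
    · rw [wdeg]; omega
    · rw [wval, mul_assoc]; rfl
  exact this hA

theorem genNe_mul_mem_fil (v : L.Ne) {k : ℕ} {A : L.CI} (hA : A ∈ fil π k) :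
    L.genNe v * A ∈ fil π (k + 1) := val_mul_mem_fil (ne v) hA

theorem genUp_mul_mem_fil (p : Module.Dual ℂ L.n) {k : ℕ} {A : L.CI} (hA : A ∈ fil π k) :
    L.genUp p * A ∈ fil π k := val_mul_mem_fil (up p) hA

theorem X_mul_mem_fil (a : L.n) {k : ℕ} {A : L.CI} (hA : A ∈ fil π k) :
    L.X a * A ∈ fil π (k + 1) := val_mul_mem_fil (xe a) hA

theorem genDown_mul_mem_fil (a : L.n) {k : ℕ} {A : L.CI} (hA : A ∈ fil π k) :
    L.genDown a * A ∈ fil π (k + 1) := val_mul_mem_fil (down a) hA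

/-- Split `b = (b - π b) + π b`: the first part is a letter of degree `2`, and `π b` equals `X_{π
b}` minus a scalar and a `Φ`, all of degree at most `1`. -/
theorem genG_mul_mem_fil (hπ : ∀ a : L.n, π a = a) (b : 𝔤) {k : ℕ} {A : L.CI}
    (hA : A ∈ fil π k) : L.genG b * A ∈ fil π (k + 2) := by
  have hc : b - π b ∈ LinearMap.ker π := by
    rw [LinearMap.mem_ker, map_sub, hπ, sub_self]
  have h1 : L.genG b = (g ⟨b - π b, hc⟩ : Letter L π).val + (L.X (π b) -
      algebraMap ℂ L.CI (P.form P.f (π b : 𝔤)) - L.genNe (L.toNe (π b))) := by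
    rw [X_def, Letter.val, map_sub]
    abel
  have h2 := val_mul_mem_fil (g ⟨b - π b, hc⟩ : Letter L π) hA
  have h3 := fil_mono (Nat.le_succ (k + 1)) (X_mul_mem_fil (π b) hA)
  have h4 := fil_mono (Nat.le_add_right k 2)
    (Submodule.smul_mem (fil π k) (P.form P.f (π b : 𝔤)) hA)
  have h5 := fil_mono (Nat.le_succ (k + 1)) (genNe_mul_mem_fil (L.toNe (π b)) hA)
  rw [h1, add_mul, sub_mul, sub_mul, ← Algebra.smul_def]
  exact add_mem h2 (sub_mem (sub_mem h3 h4) h5)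

theorem exists_letter {s : L.CI} (hs : s ∈ L.tails) :
    ∃ y : Letter L π, y.val = s ∧ y.deg = 1 := by
  rcases hs with ⟨a, rfl⟩ | ⟨a, rfl⟩
  · exact ⟨xe a, rfl, rfl⟩
  · exact ⟨down a, rfl, rfl⟩

theorem exists_word (w : List (Letter L π)) {s : L.CI} (hs : s ∈ L.tails) :
    ∃ w' : List (Letter L π), wval w' = wval w * s ∧ wdeg w' = wdeg w + 1 := by
  obtain ⟨y, hy, hd⟩ := exists_letter (π := π) hs
  refine ⟨w ++ [y], ?_, ?_⟩
  · rw [wval_append, wval, wval, hy, mul_one]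
  · rw [wdeg_append, wdeg, wdeg, hd]

theorem σ_wval_mul_genDown_mem (w : List (Letter L π)) (a : L.n) :
    L.rBracket.σ (wval w) * L.genDown a ∈ fil π (wdeg w + 1) := by
  obtain ⟨ε, h⟩ := σ_wval w
  rw [h, smul_mul_assoc]
  exact Submodule.smul_mem _ _ (wval_mul_mem_fil (genDown_mem_tails a) le_rfl)

/-! ### Leading terms of the homotopy and of its Laplacian on words. -/

section Htpy

/-- The top term is the one in which no letter is consumed; any consumption removes a letter of
positive degree. -/
theorem htpy_wval (w : List (Letter L π)) : ∀ μ : Module.End ℂ 𝔤 →ₗ[ℂ] L.n,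
    L.htpy μ (wval w) - L.rBracket.σ (wval w) * L.genDown (μ 1) ∈ fil π (wdeg w) := by
  induction w with
  | nil =>
    intro μ
    rw [wval, htpy_one, map_one L.rBracket.σ, one_mul, sub_self]
    exact zero_mem _
  | cons y w ih =>
    intro μ
    have ih' : ∀ μ, L.htpy μ (wval w) ∈ fil π (wdeg w + 1) := fun μ => by
      rw [← sub_add_cancel (L.htpy μ (wval w)) (L.rBracket.σ (wval w) * L.genDown (μ 1))]
      exact add_mem (fil_mono (by omega) (ih μ)) (σ_wval_mul_genDown_mem w _)
    have h := val_mul_mem_fil y (ih μ)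
    rw [wval, wdeg, map_mul L.rBracket.σ]
    cases y with
    | g c =>
      rw [val, htpy_genG_mul, σ_genG, mul_assoc, add_sub_right_comm, ← mul_sub]
      exact add_mem h (fil_mono (by rw [deg]; omega) (ih' _))
    | ne v =>
      rw [val, htpy_genNe_mul, σ_genNe, mul_assoc, ← mul_sub]
      exact h
    | up p =>
      rw [val, htpy_genUp_mul, σ_genUp, neg_mul, neg_mul, mul_assoc, neg_sub_neg, ← neg_sub,
        ← mul_sub]
      exact neg_mem h
    | xe a =>
      rw [val, htpy_X_mul, σ_X, mul_assoc, add_sub_right_comm, ← mul_sub]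
      exact add_mem h (ih' _)
    | down a =>
      rw [val, htpy_genDown_mul, σ_genDown, neg_mul, neg_mul, mul_assoc, neg_sub_neg, ← neg_sub,
        ← mul_sub]
      exact neg_mem h

theorem htpy_wval_mem (w : List (Letter L π)) (μ : Module.End ℂ 𝔤 →ₗ[ℂ] L.n) :
    L.htpy μ (wval w) ∈ fil π (wdeg w + 1) := by
  rw [← sub_add_cancel (L.htpy μ (wval w)) (L.rBracket.σ (wval w) * L.genDown (μ 1))]
  exact add_mem (fil_mono (by omega) (htpy_wval w μ)) (σ_wval_mul_genDown_mem w _)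

variable {ι : Type*} [Fintype ι] (u : Module.Basis ι ℂ L.n)

theorem wval_mul_J_mem (w : List (Letter L π)) (a : L.n) :
    wval w * L.J u a ∈ fil π (wdeg w + 1) := by
  rw [J_apply, mul_add, theta_apply, Finset.mul_sum]
  refine add_mem (wval_mul_mem_fil (X_mem_tails a) le_rfl) (sum_mem fun j _ => ?_)
  have h : wval w * (L.genUp (u.coord j) * L.genDown ⁅u j, a⁆) =
      wval (w ++ [up (u.coord j)]) * L.genDown ⁅u j, a⁆ := by
    rw [wval_append, wval, wval, mul_one, ← mul_assoc]
    rfl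
  rw [h]
  refine wval_mul_mem_fil (genDown_mem_tails _) ?_
  rw [wdeg_append]
  exact le_rfl

/-- To leading order the homotopy is signed right multiplication by `φ_{μ(1)}`, so its Laplacian is
right multiplication by `d φ_{μ(1)} = J_{μ(1)}`. -/
theorem lap_wval (w : List (Letter L π)) : ∀ μ : Module.End ℂ 𝔤 →ₗ[ℂ] L.n,
    L.lap μ u (wval w) - wval w * L.J u (μ 1) ∈ fil π (wdeg w) := by
  induction w with
  | nil =>
    intro μ
    rw [wval, lap_one, one_mul, sub_self]
    exact zero_mem _
  | cons y w ih =>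
    intro μ
    have ih' : ∀ μ, L.lap μ u (wval w) ∈ fil π (wdeg w + 1) := fun μ => by
      rw [← sub_add_cancel (L.lap μ u (wval w)) (wval w * L.J u (μ 1))]
      exact add_mem (fil_mono (by omega) (ih μ)) (wval_mul_J_mem u w _)
    have h := val_mul_mem_fil y (ih μ)
    have hs : ∀ b : 𝔤, ∑ i, L.genUp (u.coord i) * L.htpy (L.twist μ ⁅(u i : 𝔤), b⁆) (wval w) ∈
        fil π (wdeg w + 1) := fun b =>
      sum_mem fun i _ => genUp_mul_mem_fil _ (htpy_wval_mem w _)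
    rw [wval, wdeg]
    cases y with
    | g c =>
      rw [val, lap_genG_mul, mul_assoc, sub_right_comm, add_sub_right_comm, ← mul_sub]
      exact sub_mem (add_mem h (fil_mono (by rw [deg]; omega) (ih' _)))
        (fil_mono (by rw [deg]; omega) (hs _))
    | ne v =>
      rw [val, lap_genNe_mul, mul_assoc, ← mul_sub]
      exact h
    | up p =>
      rw [val, lap_genUp_mul, mul_assoc, ← mul_sub]
      exact h
    | xe a =>
      rw [val, lap_X_mul, mul_assoc, sub_right_comm, add_sub_right_comm, ← mul_sub]
      exact sub_mem (add_mem h (ih' _)) (hs _)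
    | down a =>
      rw [val, lap_genDown_mul, mul_assoc, add_sub_right_comm, ← mul_sub]
      exact add_mem h (htpy_wval_mem w _)

/-- Only letters `φ_a` fail to supercommute with `φ^p`. Each failure trades a letter of degree `1`
for a scalar; the factor `φ_c` keeps the result in the vacuum ideal. -/
theorem wval_genUp_comm (w : List (Letter L π)) (p : Module.Dual ℂ L.n) (c : L.n) :
    (wval w * L.genUp p - L.genUp p * L.rBracket.σ (wval w)) * L.genDown c ∈
      fil π (wdeg w) := by
  induction w with
  | nil =>
    rw [wval, map_one, one_mul, mul_one, sub_self, zero_mul]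
    exact zero_mem _
  | cons y w ih =>
    have h := val_mul_mem_fil y ih
    have h2 := σ_wval_mul_genDown_mem w c
    have key : ∀ z : L.CI, (y.val * wval w * L.genUp p - L.genUp p * (z * L.rBracket.σ (wval w))) *
        L.genDown c = y.val * ((wval w * L.genUp p - L.genUp p * L.rBracket.σ (wval w)) *
          L.genDown c) + (y.val * L.genUp p - L.genUp p * z) *
          (L.rBracket.σ (wval w) * L.genDown c) := fun z => by noncomm_ring
    rw [wval, wdeg, map_mul, key]
    refine add_mem h ?_
    cases y with
    | g c => rw [val, σ_genG, genG_genUp, sub_self, zero_mul]; exact zero_mem _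
    | ne v => rw [val, σ_genNe, genNe_genUp, sub_self, zero_mul]; exact zero_mem _
    | up q =>
      rw [val, σ_genUp, L.genUp_genUp q, mul_neg, sub_self, zero_mul]; exact zero_mem _
    | xe a => rw [val, σ_X, X_genUp, sub_self, zero_mul]; exact zero_mem _
    | down a =>
      rw [val, σ_genDown, genDown_genUp, mul_neg, sub_neg_eq_add, sub_add_cancel,
        ← Algebra.smul_def]
      exact Submodule.smul_mem _ _ h2

/-- Only letters `φ^q` fail to supercommute with `φ_a`. The result has lost `φ_a`, and hence one
degree. -/
theorem genDown_comm_mem (w : List (Letter L π)) {s : L.CI} (hs : s ∈ L.tails) (a : L.n) :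
    L.genDown a * (wval w * s) - L.rBracket.σ (wval w * s) * L.genDown a ∈
      fil π (wdeg w + 1) := by
  induction w with
  | nil =>
    rw [wval, one_mul]
    convert zero_mem (fil π _) using 1
    rcases hs with ⟨b, rfl⟩ | ⟨b, rfl⟩
    · rw [σ_X, X_genDown, sub_self]
    · rw [σ_genDown, genDown_genDown, neg_mul, sub_self]
  | cons y w ih =>
    have h2 : wval w * s ∈ fil π (wdeg w + 1) := wval_mul_mem_fil hs le_rfl
    have hy : L.rBracket.σ y.val * (L.genDown a * (wval w * s) -
        L.rBracket.σ (wval w * s) * L.genDown a) ∈ fil π (wdeg w + 1 + y.deg) := by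
      obtain ⟨ε, hε⟩ := σ_wval [y]
      rw [wval, wval, mul_one] at hε
      rw [hε, smul_mul_assoc]
      exact Submodule.smul_mem _ _ (val_mul_mem_fil y ih)
    have key : L.genDown a * (y.val * wval w * s) - L.rBracket.σ (y.val * wval w * s) *
        L.genDown a = L.rBracket.σ y.val * (L.genDown a * (wval w * s) -
        L.rBracket.σ (wval w * s) * L.genDown a) +
        (L.genDown a * y.val - L.rBracket.σ y.val * L.genDown a) * (wval w * s) := by
      simp only [map_mul]
      noncomm_ring
    rw [wval, wdeg, key, add_right_comm]
    refine add_mem hy ?_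
    cases y with
    | g c => rw [val, σ_genG, genG_genDown, sub_self, zero_mul]; exact zero_mem _
    | ne v => rw [val, σ_genNe, genNe_genDown, sub_self, zero_mul]; exact zero_mem _
    | up q =>
      rw [val, σ_genUp, genDown_genUp, neg_mul, sub_neg_eq_add, sub_add_cancel,
        ← Algebra.smul_def]
      exact Submodule.smul_mem _ _ h2
    | xe b => rw [val, σ_X, X_genDown, sub_self, zero_mul]; exact zero_mem _
    | down b =>
      rw [val, σ_genDown, genDown_genDown, neg_mul, sub_self, zero_mul]; exact zero_mem _

theorem htpy_twist_sub_mem {μ : Module.End ℂ 𝔤 →ₗ[ℂ] L.n}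
    (hμ : ∀ b : 𝔤, μ (LieAlgebra.ad ℂ 𝔤 b) = π b) (w : List (Letter L π)) {s : L.CI}
    (hs : s ∈ L.tails) (b : 𝔤) : L.htpy (L.twist μ b) (wval w * s) - L.genDown (π b) * (wval w * s) ∈ fil π (wdeg w + 1) := by
  obtain ⟨w', h1, h2⟩ := exists_word w hs
  have h3 := htpy_wval w' (L.twist μ b)
  rw [twist_one, hμ, h1, h2] at h3
  have h4 := genDown_comm_mem w hs (π b)
  have h5 := sub_mem h3 h4
  rwa [sub_sub_sub_cancel_right] at h5

variable (hπ : ∀ a : L.n, π a = a)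
include hπ

/-- Commuting `X_a` past a letter never raises the degree of that letter, while the degree `1` of
`X_a` itself is lost. -/
theorem X_comm_mem (w : List (Letter L π)) {s : L.CI} (hs : s ∈ L.tails) (a : L.n) :
    L.X a * (wval w * s) - wval w * s * L.X a ∈ fil π (wdeg w + 1) := by
  induction w with
  | nil =>
    rw [wval, one_mul, wdeg]
    rcases hs with ⟨b, rfl⟩ | ⟨b, rfl⟩
    · rw [X_X, ← one_mul (L.X ⁅a, b⁆)]
      exact wval_mul_mem_fil (w := ([] : List (Letter L π))) (X_mem_tails ⁅a, b⁆) le_rfl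
    · rw [X_genDown, sub_self]
      exact zero_mem _
  | cons y w ih =>
    have h2 : wval w * s ∈ fil π (wdeg w + 1) := wval_mul_mem_fil hs le_rfl
    have key : L.X a * (y.val * wval w * s) - y.val * wval w * s * L.X a =
        y.val * (L.X a * (wval w * s) - wval w * s * L.X a) +
        (L.X a * y.val - y.val * L.X a) * (wval w * s) := by noncomm_ring
    rw [wval, wdeg, key, add_right_comm]
    refine add_mem (val_mul_mem_fil y ih) ?_
    cases y with
    | g c =>
      rw [val, X_genG, add_sub_cancel_left]
      exact genG_mul_mem_fil hπ _ h2
    | ne v =>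
      rw [val, X_genNe, add_sub_cancel_left, ← Algebra.smul_def]
      exact fil_mono (by omega) (Submodule.smul_mem _ _ h2)
    | up q => rw [val, X_genUp, sub_self, zero_mul]; exact zero_mem _
    | xe b => rw [val, X_X]; exact X_mul_mem_fil _ h2
    | down b => rw [val, X_genDown, sub_self, zero_mul]; exact zero_mem _

variable {μ : Module.End ℂ 𝔤 →ₗ[ℂ] L.n} (hμ1 : μ 1 = 0)
  (hμ : ∀ b : 𝔤, μ (LieAlgebra.ad ℂ 𝔤 b) = π b)
include hμ1 hμ

/-- With `μ(1) = 0` the leading terms of the previous lemmas vanish, and the next order counts: each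
`X_a` or `φ_a` is reproduced once, the other letters contribute nothing, and the final factor gives
the `1`. -/
theorem lap_wval_mul (w : List (Letter L π)) {s : L.CI} (hs : s ∈ L.tails) :
    L.lap μ u (wval w * s) - ((wnum w + 1 : ℕ) : ℂ) • (wval w * s) ∈ fil π (wdeg w) := by
  induction w with
  | nil =>
    rw [wval, one_mul, wnum, zero_add, Nat.cast_one, one_smul]
    -- The target `fil π 0` is zero, so here the identity must be exact. For `X_b` it reads `J_b -
    -- θ_b = X_b`.
    convert zero_mem (fil π _) using 1
    rw [← mul_one s]
    rcases hs with ⟨b, rfl⟩ | ⟨b, rfl⟩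
    · rw [lap_X_mul, lap_one, lap_one, twist_one, hμ1, map_zero, mul_zero, zero_add, hμ, hπ,
        J_apply, theta_apply]
      have h : ∀ i, L.htpy (L.twist μ ⁅(u i : 𝔤), (b : 𝔤)⁆) 1 = L.genDown ⁅u i, b⁆ := fun i => by
        rw [htpy_one, twist_one, hμ]
        exact congrArg L.genDown (hπ ⁅u i, b⁆)
      simp only [h]
      rw [mul_one, add_sub_cancel_right, sub_self]
    · rw [lap_genDown_mul, lap_one, hμ1, map_zero, mul_zero, zero_add, htpy_one, twist_one, hμ, hπ,
        mul_one, sub_self]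
  | cons y w ih =>
    have h := val_mul_mem_fil y ih
    obtain ⟨w', h1, h2⟩ := exists_word w hs
    have hA : wval w * s ∈ fil π (wdeg w + 1) := wval_mul_mem_fil hs le_rfl
    rw [wval, wdeg, wnum, mul_assoc]
    cases y with
    | g c =>
      -- The leading term of the twisted Laplacian is right multiplication by `J_{π(c)}`, and `π(c)
      -- = 0`.
      have h3 := lap_wval u w' (L.twist μ c)
      rw [twist_one, hμ, c.2, map_zero, mul_zero, sub_zero, h1, h2] at h3
      rw [val, lap_genG_mul, num, add_zero, ← mul_smul_comm, sub_right_comm, add_sub_right_comm,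
        ← mul_sub]
      refine sub_mem (add_mem h (fil_mono (by rw [deg]; omega) h3))
        (sum_mem fun i _ => genUp_mul_mem_fil _ ?_)
      rw [← h1, deg]
      have h4 := htpy_wval_mem w' (L.twist μ ⁅(u i : 𝔤), (c : 𝔤)⁆)
      rwa [h2] at h4
    | ne v =>
      rw [val, lap_genNe_mul, num, add_zero, ← mul_smul_comm, ← mul_sub]
      exact h
    | up p =>
      rw [val, lap_genUp_mul, num, add_zero, ← mul_smul_comm, ← mul_sub]
      exact h
    | xe a =>
      have h3 := lap_wval u w' (L.twist μ a)
      rw [twist_one, hμ, hπ, h1, h2] at h3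
      have h4 : ∀ i, L.htpy (L.twist μ ⁅(u i : 𝔤), (a : 𝔤)⁆) (wval w * s) -
          L.rBracket.σ (wval w * s) * L.genDown ⁅u i, a⁆ ∈ fil π (wdeg w + 1) := fun i => by
        have h4 := htpy_wval w' (L.twist μ ⁅(u i : 𝔤), (a : 𝔤)⁆)
        rw [twist_one, hμ, h1, h2] at h4
        have h5 : π ⁅(u i : 𝔤), (a : 𝔤)⁆ = ⁅u i, a⁆ := hπ ⁅u i, a⁆
        rwa [h5] at h4
      have h5 : ∀ i, (wval w * s * L.genUp (u.coord i) - L.genUp (u.coord i) *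
          L.rBracket.σ (wval w * s)) * L.genDown ⁅u i, a⁆ ∈ fil π (wdeg w + 1) := fun i => by
        have h5 := wval_genUp_comm w' (u.coord i) ⁅u i, a⁆
        rwa [h1, h2] at h5
      have h6 := X_comm_mem hπ w hs a
      -- The twisted Laplacian contributes right multiplication by `J_a = X_a + θ_a`. The `θ_a` part
      -- cancels against the sum over `φ^i`, and right multiplication by `X_a` equals left
      -- multiplication to leading order: one extra copy of the word.
      have key : L.lap μ u (L.X a * (wval w * s)) -
          ((wnum w + 1 + 1 : ℕ) : ℂ) • (L.X a * (wval w * s)) =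
          L.X a * (L.lap μ u (wval w * s) - ((wnum w + 1 : ℕ) : ℂ) • (wval w * s)) +
          (L.lap (L.twist μ a) u (wval w * s) - wval w * s * L.J u a) -
          (L.X a * (wval w * s) - wval w * s * L.X a) -
          ∑ i, L.genUp (u.coord i) * (L.htpy (L.twist μ ⁅(u i : 𝔤), (a : 𝔤)⁆) (wval w * s) -
            L.rBracket.σ (wval w * s) * L.genDown ⁅u i, a⁆) +
          ∑ i, (wval w * s * L.genUp (u.coord i) - L.genUp (u.coord i) *
            L.rBracket.σ (wval w * s)) * L.genDown ⁅u i, a⁆ := by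
        rw [lap_X_mul, J_apply, theta_apply, mul_add, Finset.mul_sum]
        simp only [mul_sub, sub_mul, Finset.sum_sub_distrib, mul_assoc, mul_smul_comm]
        push_cast
        module
      rw [val, num, add_right_comm, key]
      exact add_mem (sub_mem (sub_mem (add_mem h h3) h6)
        (sum_mem fun i _ => genUp_mul_mem_fil _ (h4 i))) (sum_mem fun i _ => h5 i)
    | down a =>
      have h3 := htpy_twist_sub_mem hμ w hs a
      rw [hπ] at h3
      have key : L.lap μ u (L.genDown a * (wval w * s)) -
          ((wnum w + 1 + 1 : ℕ) : ℂ) • (L.genDown a * (wval w * s)) =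
          L.genDown a * (L.lap μ u (wval w * s) - ((wnum w + 1 : ℕ) : ℂ) • (wval w * s)) +
          (L.htpy (L.twist μ a) (wval w * s) - L.genDown a * (wval w * s)) := by
        rw [lap_genDown_mul, mul_sub, mul_smul_comm]
        push_cast
        module
      rw [val, num, add_right_comm, key]
      exact add_mem h h3

/-- All diagonal entries `wnum w + 1` are positive, and the filtration starts at zero. -/
theorem fil_le_unitTorsion (k : ℕ) : fil π k ≤ unitTorsion (L.lap μ u) := by
  induction k with
  | zero => rw [fil_zero]; exact bot_le
  | succ k ih =>
    refine Submodule.span_le.mpr ?_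
    rintro _ ⟨w, s, hs, hk, rfl⟩
    refine mem_unitTorsion_of_sub (q := ((wnum w + 1 : ℕ) : ℂ))
      (Nat.cast_ne_zero.mpr (Nat.succ_ne_zero _))
      (ih (fil_mono (by omega) (lap_wval_mul u hπ hμ1 hμ w hs)))

theorem vacIdeal_le_unitTorsion {A : L.CI} (hA : A ∈ L.vacIdeal) :
    A ∈ unitTorsion (L.lap μ u) := by
  have key : ∀ s ∈ L.tails, ∀ A : L.CI, ∃ k, A * s ∈ fil π k := by
    intro s hs
    let S : Submodule ℂ L.CI :=
      { carrier := {A | ∃ k, A * s ∈ fil π k}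
        add_mem' := by
          rintro A B ⟨k, hA⟩ ⟨k', hB⟩
          refine ⟨max k k', ?_⟩
          rw [add_mul]
          exact add_mem (fil_mono (le_max_left _ _) hA) (fil_mono (le_max_right _ _) hB)
        zero_mem' := ⟨0, by rw [zero_mul]; exact zero_mem _⟩
        smul_mem' := by
          rintro c A ⟨k, hA⟩
          exact ⟨k, by rw [smul_mul_assoc]; exact Submodule.smul_mem _ _ hA⟩ }
    refine L.CI_induction S ?_ ?_ ?_ ?_ ?_
    · exact ⟨1, wval_mul_mem_fil (w := []) hs le_rfl⟩
    · rintro b A ⟨k, hA⟩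
      exact ⟨_, by rw [mul_assoc]; exact genG_mul_mem_fil hπ b hA⟩
    · rintro b A ⟨k, hA⟩
      exact ⟨_, by rw [mul_assoc]; exact genNe_mul_mem_fil b hA⟩
    · rintro b A ⟨k, hA⟩
      exact ⟨_, by rw [mul_assoc]; exact genUp_mul_mem_fil b hA⟩
    · rintro b A ⟨k, hA⟩
      exact ⟨_, by rw [mul_assoc]; exact genDown_mul_mem_fil b hA⟩
  -- The unit torsion is only a complex subspace, not a left ideal. Quantifying over `B` makes the
  -- span induction over `C^I` go through.
  have h : ∀ B : L.CI, B * A ∈ unitTorsion (L.lap μ u) := by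
    induction hA using Submodule.span_induction with
    | mem s hs =>
      intro B
      obtain ⟨k, hk⟩ := key s hs B
      exact fil_le_unitTorsion u hπ hμ1 hμ k hk
    | zero => intro B; rw [mul_zero]; exact zero_mem _
    | add x y _ _ hx hy => intro B; rw [mul_add]; exact add_mem (hx B) (hy B)
    | smul c x _ hx => intro B; rw [smul_eq_mul, ← mul_assoc]; exact hx _
  have h1 := h 1
  rwa [one_mul] at h1

end Htpy

end IsotropicSubspace


/-! ### Adapted bases -/

namespace GoodPair

variable {𝔤 : Type*} [LieRing 𝔤] [LieAlgebra ℂ 𝔤] (P : GoodPair 𝔤)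

theorem iSupIndep_gr : iSupIndep P.gr := by
  have h := Module.End.eigenspaces_iSupIndep (LieAlgebra.ad ℂ 𝔤 P.x)
  refine h.comp (f := fun k : ℤ => (k : ℂ) / 2) fun i j hij => ?_
  have : (i : ℂ) = j := by linear_combination 2 * hij
  exact_mod_cast this

theorem iSup_gr : ⨆ k, P.gr k = ⊤ := P.diagonalizable

/-- `ad f` is injective in positive degrees. -/
theorem eq_zero_of_form_lie {a : 𝔤} (ha : a ∈ P.ge 1) (h : ∀ b, P.form P.f ⁅a, b⁆ = 0) :
    a = 0 := by
  -- By invariance `(f | [a, b]) = ([f, a] | b)`, so `a` centralizes `f` and lies in degrees `≤ 0`,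
  -- which are independent of degrees `≥ 1/2`.
  have h1 : ⁅P.f, a⁆ = 0 :=
    P.form_nondegenerate.1 _ fun b => by rw [P.form_invariant, h]
  have hd : Disjoint (P.ge 1) (⨆ (k : ℤ) (_ : k ≤ 0), P.gr k) :=
    P.iSupIndep_gr.disjoint_biSup_biSup (s := {k | 1 ≤ k}) (t := {k | k ≤ 0})
      (Set.disjoint_left.mpr fun k (hk : 1 ≤ k) (hk' : k ≤ 0) => by omega)
  exact Submodule.disjoint_def.mp hd a ha (P.centralizer_le a h1)

theorem form_f_lie_gr {i j : ℤ} (h : i + j ≠ 2) {a b : 𝔤} (ha : a ∈ P.gr i) (hb : b ∈ P.gr j) :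
    P.form P.f ⁅a, b⁆ = 0 :=
  P.form_f_gr h (P.lie_mem_gr ha hb)

/-- For `a ∈ 𝔤_{k/2}` the functional `(f | [a, b])` of `b` factors through the component of
degree `1 - k/2`. -/
theorem exists_component (k : ℤ) (b : 𝔤) :
    ∃ b' ∈ P.gr (2 - k), ∀ a ∈ P.gr k, P.form P.f ⁅a, b'⁆ = P.form P.f ⁅a, b⁆ := by
  have hb : b ∈ ⨆ k, P.gr k := by rw [P.iSup_gr]; exact Submodule.mem_top
  induction hb using Submodule.iSup_induction' with
  | mem i b hb =>
    by_cases hi : i = 2 - k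
    · exact ⟨b, hi ▸ hb, fun _ _ => rfl⟩
    · refine ⟨0, zero_mem _, fun a ha => ?_⟩
      rw [lie_zero, map_zero, P.form_f_lie_gr (by omega) ha hb]
  | zero => exact ⟨0, zero_mem _, fun _ _ => rfl⟩
  | add b c _ _ hb hc =>
    obtain ⟨b', hb', h1⟩ := hb
    obtain ⟨c', hc', h2⟩ := hc
    refine ⟨b' + c', add_mem hb' hc', fun a ha => ?_⟩
    rw [lie_add, lie_add, map_add, map_add, h1 a ha, h2 a ha]

end GoodPair

namespace IsotropicSubspace

variable {𝔤 : Type*} [LieRing 𝔤] [LieAlgebra ℂ 𝔤] {P : GoodPair 𝔤} (L : IsotropicSubspace P)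

/-- A homogeneous basis `u` of `𝔫` with homogeneous elements `w` of `𝔤` such that
`(f | [u_α, w_β]) = -δ_{αβ}`. -/
structure Frame (κ : Type*) where
  u : Module.Basis κ ℂ L.n
  k : κ → ℤ
  one_le : ∀ α, 1 ≤ k α
  u_mem : ∀ α, (u α : 𝔤) ∈ P.gr (k α)
  w : κ → 𝔤
  w_mem : ∀ α, w α ∈ P.gr (2 - k α)
  form_w : ∀ (a : L.n) (α : κ), P.form P.f ⁅(a : 𝔤), w α⁆ = -u.coord α a

/-- Goodness of the pair makes `𝔫 → 𝔤*`, `a ↦ (f | [a, ·])`, injective, so the transpose `𝔤 → 𝔫*` is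
surjective. -/
theorem exists_w (p : Module.Dual ℂ L.n) [FiniteDimensional ℂ 𝔤] :
    ∃ b : 𝔤, ∀ a : L.n, P.form P.f ⁅(a : 𝔤), b⁆ = -p a := by
  let Θ : L.n →ₗ[ℂ] Module.Dual ℂ 𝔤 := P.neForm ∘ₗ L.n.toSubmodule.subtype
  have hΘ : Function.Injective Θ := by
    rw [← LinearMap.ker_eq_bot, LinearMap.ker_eq_bot']
    intro a ha
    exact Subtype.ext (P.eq_zero_of_form_lie (sup_le_ge L.perp_le_gr a.2)
      fun b => LinearMap.congr_fun ha b)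
  obtain ⟨q, hq⟩ := LinearMap.dualMap_surjective_iff.mpr hΘ (-p)
  obtain ⟨b, rfl⟩ := (Module.evalEquiv ℂ 𝔤).surjective q
  exact ⟨b, fun a => LinearMap.congr_fun hq a⟩

/-- The homogeneous elements of degree `≥ 1/2` span `𝔫`, so a basis can be extracted from them, and
the dual vectors can be cut down to the complementary degree. -/
theorem exists_frame [FiniteDimensional ℂ 𝔤] :
    ∃ (κ : Set L.n) (_ : Fintype κ), Nonempty (L.Frame κ) := by
  let S : Set L.n := {a | ∃ k : ℤ, 1 ≤ k ∧ (a : 𝔤) ∈ P.gr k}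
  have hS : ⊤ ≤ Submodule.span ℂ S := by
    have h1 : L.perp ≤ (Submodule.span ℂ S).map L.n.toSubmodule.subtype := fun a ha =>
      ⟨⟨a, Submodule.mem_sup_left ha⟩, Submodule.subset_span ⟨1, le_rfl, L.perp_le_gr ha⟩, rfl⟩
    have h2 : P.ge 2 ≤ (Submodule.span ℂ S).map L.n.toSubmodule.subtype :=
      iSup₂_le fun i hi a ha => ⟨⟨a, Submodule.mem_sup_right (P.gr_le_ge hi ha)⟩,
        Submodule.subset_span ⟨i, by omega, ha⟩, rfl⟩
    intro a _
    obtain ⟨b, hb, hab⟩ := sup_le h1 h2 a.2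
    have : b = a := Subtype.ext hab
    rwa [← this]
  let u := Module.Basis.ofSpan hS
  have hu : ∀ α, ∃ k : ℤ, 1 ≤ k ∧ (u α : 𝔤) ∈ P.gr k := fun α =>
    Module.Basis.ofSpan_subset hS ⟨α, rfl⟩
  choose k hk hk' using hu
  have hw : ∀ α, ∃ b ∈ P.gr (2 - k α), ∀ a : L.n, P.form P.f ⁅(a : 𝔤), b⁆ = -u.coord α a := by
    intro α
    obtain ⟨b, hb⟩ := L.exists_w (u.coord α)
    obtain ⟨b', hb', h⟩ := P.exists_component (k α) b
    refine ⟨b', hb', fun a => ?_⟩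
    -- Basis vectors of degree `k α` cannot tell `b'` from `b`; those of any other degree pair to
    -- zero with `b'`, and their `α`-coordinate is zero as well.
    have key : P.neForm.flip b' ∘ₗ L.n.toSubmodule.subtype = -u.coord α := by
      refine u.ext fun β => ?_
      change P.form P.f ⁅(u β : 𝔤), b'⁆ = -u.coord α (u β)
      by_cases hβ : k β = k α
      · rw [h _ (hβ ▸ hk' β), hb]
      · rw [P.form_f_lie_gr (by omega) (hk' β) hb', Module.Basis.coord_apply, u.repr_self,
          Finsupp.single_eq_of_ne (fun h => hβ (by rw [h])), neg_zero]
    exact LinearMap.congr_fun key a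
  choose w hw hw' using hw
  have : FiniteDimensional ℂ L.n := inferInstanceAs (FiniteDimensional ℂ L.n.toSubmodule)
  refine ⟨_, FiniteDimensional.fintypeBasisIndex u, ⟨?_⟩⟩
  exact ⟨u, k, hk, hk', w, hw, fun a α => hw' α a⟩

/-- A projection `𝔤 → 𝔫` extends to a functional on `End 𝔤` that vanishes at the identity. -/
theorem exists_functional [LieAlgebra.IsSimple ℂ 𝔤] : ∃ π : 𝔤 →ₗ[ℂ] L.n, (∀ a : L.n, π a = a) ∧
    ∃ μ : Module.End ℂ 𝔤 →ₗ[ℂ] L.n, μ 1 = 0 ∧ ∀ b, μ (LieAlgebra.ad ℂ 𝔤 b) = π b := by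
  obtain ⟨π, hπ⟩ := LinearMap.exists_leftInverse_of_injective L.n.toSubmodule.subtype
    (Submodule.ker_subtype _)
  -- Once `(z, b) ↦ z + ad b` is injective, a left inverse followed by the second projection reads
  -- off `b` and forgets the identity.
  let F : ℂ × 𝔤 →ₗ[ℂ] Module.End ℂ 𝔤 := (Algebra.linearMap ℂ (Module.End ℂ 𝔤)).coprod
    (LieAlgebra.ad ℂ 𝔤 : 𝔤 →ₗ[ℂ] Module.End ℂ 𝔤)
  have had : ∀ b : 𝔤, LieAlgebra.ad ℂ 𝔤 b = 0 → b = 0 := fun b hb => by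
    have h : b ∈ LieAlgebra.center ℂ 𝔤 := by
      rw [← LieAlgebra.self_module_ker_eq_center, ← LieAlgebra.ad_ker_eq_self_module_ker,
        LieHom.mem_ker]
      exact hb
    have h2 : LieAlgebra.center ℂ 𝔤 = ⊥ := by
      refine (LieAlgebra.IsSimple.eq_bot_or_eq_top _).resolve_right fun h => ?_
      exact LieAlgebra.IsSimple.non_abelian ℂ (L := 𝔤)
        ((LieAlgebra.isLieAbelian_iff_center_eq_top ℂ 𝔤).mpr h)
    rw [h2] at h
    exact h
  have hF : LinearMap.ker F = ⊥ := by
    rw [LinearMap.ker_eq_bot']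
    rintro ⟨z, b⟩ h
    have h1 : ∀ c : 𝔤, z • c + ⁅b, c⁆ = 0 := fun c => LinearMap.congr_fun h c
    -- Evaluating `z + ad b = 0` at `b` gives `z b = 0`. If `z ≠ 0`, then `b = 0`, and the identity
    -- itself vanishes on `𝔤`.
    have hz : z = 0 := by
      by_contra hz
      have hb : b = 0 := by
        have h2 := h1 b
        rw [lie_self, add_zero] at h2
        exact (smul_eq_zero.mp h2).resolve_left hz
      have h3 : ∀ c : 𝔤, c = 0 := fun c => by
        have h2 := h1 c
        rw [hb, zero_lie, add_zero] at h2
        exact (smul_eq_zero.mp h2).resolve_left hz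
      exact LieAlgebra.IsSimple.non_abelian ℂ (L := 𝔤) ⟨fun x y => h3 _⟩
    have hb : b = 0 := had b (LinearMap.ext fun c => by
      have h2 := h1 c
      rw [hz, zero_smul, zero_add] at h2
      exact h2)
    rw [hz, hb]
    rfl
  obtain ⟨G, hG⟩ := LinearMap.exists_leftInverse_of_injective F hF
  refine ⟨π, fun a => LinearMap.congr_fun hπ a, π ∘ₗ LinearMap.snd ℂ _ _ ∘ₗ G, ?_, fun b => ?_⟩
  · have h := LinearMap.congr_fun hG (1, 0)
    have h1 : F (1, 0) = 1 := by simp [F]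
    rw [LinearMap.comp_apply, h1] at h
    rw [LinearMap.comp_apply, LinearMap.comp_apply, h]
    simp
  · have h := LinearMap.congr_fun hG (0, b)
    have h1 : F (0, b) = LieAlgebra.ad ℂ 𝔤 b := by simp [F]
    rw [LinearMap.comp_apply, h1] at h
    rw [LinearMap.comp_apply, LinearMap.comp_apply, h]
    simp

/-! ### The subalgebra `U(𝔤)` of `C^I` -/

/-- The inclusion of `𝔤` as a homomorphism of Lie algebras. -/
def genGLie : 𝔤 →ₗ⁅ℂ⁆ L.CI :=
  { L.genG with
    map_lie' := fun {b c} => by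
      change L.genG ⁅b, c⁆ = L.genG b * L.genG c - L.genG c * L.genG b
      rw [genG_genG, add_sub_cancel_left] }

/-- The homomorphism `U(𝔤) → C^I`. -/
def genU : UniversalEnvelopingAlgebra ℂ 𝔤 →ₐ[ℂ] L.CI := UniversalEnvelopingAlgebra.lift ℂ L.genGLie

theorem genU_ι (b : 𝔤) : L.genU (UniversalEnvelopingAlgebra.ι ℂ b) = L.genG b :=
  UniversalEnvelopingAlgebra.lift_ι_apply ℂ _ b

theorem genU_comm {y : L.CI} (hy : ∀ b, L.genG b * y = y * L.genG b)
    (B : UniversalEnvelopingAlgebra ℂ 𝔤) : L.genU B * y = y * L.genU B := by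
  have h := mem_of_ι_mem ((Subalgebra.centralizer ℂ {y}).comap L.genU) (fun b => by
    rw [Subalgebra.mem_comap, genU_ι, Subalgebra.mem_centralizer_iff]
    rintro _ rfl
    exact (hy b).symm) B
  rw [Subalgebra.mem_comap, Subalgebra.mem_centralizer_iff] at h
  exact (h y rfl).symm

theorem genU_genDown (B : UniversalEnvelopingAlgebra ℂ 𝔤) (a : L.n) :
    L.genU B * L.genDown a = L.genDown a * L.genU B :=
  L.genU_comm (fun b => L.genG_genDown b a) B

theorem genU_genNe (B : UniversalEnvelopingAlgebra ℂ 𝔤) (v : L.Ne) :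
    L.genU B * L.genNe v = L.genNe v * L.genU B :=
  L.genU_comm (fun b => (L.genNe_genG v b).symm) B

/-- The scalar and `Φ` parts of `X_a` commute with `U(𝔤)`. On `U(𝔤) vac`, `X_a` therefore acts as
the adjoint action of `a` on `M⁰`. -/
theorem X_genU (a : L.n) (B : UniversalEnvelopingAlgebra ℂ 𝔤) :
    L.X a * L.genU B = L.genU B * L.X a + L.genU (adU (a : 𝔤) B) := by
  rw [adU_apply, map_sub, map_mul, map_mul, genU_ι, X_def, add_mul, add_mul, mul_add, mul_add,
    genU_genNe, Algebra.commutes]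
  abel

end IsotropicSubspace


/-! ### The vacuum module -/

namespace IsotropicSubspace

variable {𝔤 : Type*} [LieRing 𝔤] [LieAlgebra ℂ 𝔤] {P : GoodPair 𝔤} (L : IsotropicSubspace P)

/-- The left `C^I`-module obtained by dividing out the left ideal generated by the elements `X_a`
and `φ_a`. -/
abbrev VacModule : Type _ := L.CI ⧸ L.vacIdeal

/-- The vacuum vector. -/
def vac : L.VacModule := Submodule.Quotient.mk 1

theorem smul_vac (A : L.CI) : A • L.vac = Submodule.Quotient.mk A := by
  rw [vac, ← Submodule.Quotient.mk_smul, smul_eq_mul, mul_one]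

theorem smul_vac_eq_zero {A : L.CI} : A • L.vac = 0 ↔ A ∈ L.vacIdeal := by
  rw [smul_vac, Submodule.Quotient.mk_eq_zero]

theorem X_smul_vac (a : L.n) : L.X a • L.vac = 0 :=
  L.smul_vac_eq_zero.mpr (Submodule.subset_span (X_mem_tails a))

theorem genDown_smul_vac (a : L.n) : L.genDown a • L.vac = 0 :=
  L.smul_vac_eq_zero.mpr (Submodule.subset_span (genDown_mem_tails a))

section

variable {ι : Type*} [Fintype ι] (u : Module.Basis ι ℂ L.n)

theorem θ_smul_vac (a : L.n) : L.θ u a • L.vac = 0 := by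
  rw [theta_apply, Finset.sum_smul]
  refine Finset.sum_eq_zero fun j _ => ?_
  rw [mul_smul, genDown_smul_vac, smul_zero]

theorem J_smul_vac (a : L.n) : L.J u a • L.vac = 0 := by
  rw [J_apply, add_smul, X_smul_vac, θ_smul_vac, add_zero]

theorem dI_smul_vac : L.dI u • L.vac = 0 := by
  rw [dI_eq, add_smul, smul_assoc, Finset.sum_smul, Finset.sum_smul]
  simp only [mul_smul, X_smul_vac, θ_smul_vac, smul_zero, Finset.sum_const_zero, add_zero]

/-- As `d` kills the vacuum, the second term of the supercommutator drops out, and `ad d` descends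
to left multiplication by `d`. -/
theorem D_smul_vac (A : L.CI) : L.D u A • L.vac = L.dI u • A • L.vac := by
  rw [D_apply, sub_smul, mul_smul, mul_smul, dI_smul_vac, smul_zero, sub_zero]

end

/-- The shifted generators `b + (f | b)`. -/
def gbar : 𝔤 →ₗ[ℂ] L.CI := L.genG + Algebra.linearMap ℂ L.CI ∘ₗ P.form P.f

theorem gbar_apply (b : 𝔤) : L.gbar b = L.genG b + algebraMap ℂ L.CI (P.form P.f b) := rfl

theorem genG_eq (b : 𝔤) : L.genG b = L.gbar b - algebraMap ℂ L.CI (P.form P.f b) := by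
  rw [gbar_apply, add_sub_cancel_right]

theorem genG_smul (b : 𝔤) (m : L.VacModule) :
    L.genG b • m = L.gbar b • m - P.form P.f b • m := by
  rw [genG_eq, sub_smul, algebraMap_smul]

theorem genG_gbar (b c : 𝔤) : L.genG b * L.gbar c = L.gbar c * L.genG b + L.genG ⁅b, c⁆ := by
  rw [gbar_apply, mul_add, add_mul, genG_genG, Algebra.commutes]
  abel

theorem gbar_gbar (b c : 𝔤) : L.gbar b * L.gbar c = L.gbar c * L.gbar b + L.genG ⁅b, c⁆ := by
  rw [L.gbar_apply b, mul_add, add_mul, genG_gbar, Algebra.commutes]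
  abel

theorem gbar_genUp (b : 𝔤) (p : Module.Dual ℂ L.n) :
    L.gbar b * L.genUp p = L.genUp p * L.gbar b := by
  rw [gbar_apply, mul_add, add_mul, genG_genUp, Algebra.commutes]

theorem gbar_genDown (b : 𝔤) (a : L.n) : L.gbar b * L.genDown a = L.genDown a * L.gbar b := by
  rw [gbar_apply, mul_add, add_mul, genG_genDown, Algebra.commutes]

theorem genNe_gbar (v : L.Ne) (b : 𝔤) : L.genNe v * L.gbar b = L.gbar b * L.genNe v := by
  rw [gbar_apply, mul_add, add_mul, genNe_genG, Algebra.commutes]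

theorem J_gbar {ι : Type*} [Fintype ι] (u : Module.Basis ι ℂ L.n) (a : L.n) (b : 𝔤) :
    L.J u a * L.gbar b = L.gbar b * L.J u a + L.genG ⁅(a : 𝔤), b⁆ := by
  rw [gbar_apply, mul_add, add_mul, J_genG, Algebra.commutes]
  abel

theorem X_eq_gbar (a : L.n) : L.X a = L.gbar a + L.genNe (L.toNe a) := rfl

/-- The shift by `(f | b)` in `gbar` is chosen so that `𝔤_{≥1}` annihilates the vacuum. -/
theorem gbar_smul_vac {b : 𝔤} (hb : b ∈ P.ge 2) : L.gbar b • L.vac = 0 := by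
  have h := L.X_smul_vac ⟨b, Submodule.mem_sup_right hb⟩
  rwa [X_eq_gbar, L.toNe_eq_zero hb, map_zero, add_zero] at h

theorem genNe_smul_vac (a : L.n) : L.genNe (L.toNe a) • L.vac = -(L.gbar a • L.vac) := by
  have h := L.X_smul_vac a
  rw [X_eq_gbar, add_smul] at h
  exact eq_neg_of_add_eq_zero_right h

/-- The elements of `𝔤_{k/2}` orthogonal to `𝔫` for the form `(f | [a, b])`. -/
def orth (k : ℤ) : Submodule ℂ 𝔤 := P.gr k ⊓ ⨅ a : L.n, LinearMap.ker (P.neForm (a : 𝔤))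

theorem mem_orth {k : ℤ} {b : 𝔤} :
    b ∈ L.orth k ↔ b ∈ P.gr k ∧ ∀ a : L.n, P.form P.f ⁅(a : 𝔤), b⁆ = 0 := by
  simp only [orth, Submodule.mem_inf, Submodule.mem_iInf, LinearMap.mem_ker]
  rfl

/-! ### Words spanning the vacuum module, and their weights. -/

namespace Frame

variable {L} {κ : Type*} (F : L.Frame κ)

theorem coord_eq_zero {γ : κ} {j : ℤ} {a : L.n} (ha : (a : 𝔤) ∈ P.gr j) (h : F.k γ ≠ j) :
    F.u.coord γ a = 0 := by
  have h1 := F.form_w a γ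
  rw [P.form_f_lie_gr (by omega) ha (F.w_mem γ)] at h1
  exact neg_eq_zero.mp h1.symm

theorem form_w_eq_zero (α : κ) : P.form P.f (F.w α) = 0 :=
  P.form_f_gr (by have := F.one_le α; omega) (F.w_mem α)

theorem genG_w (α : κ) : L.genG (F.w α) = L.gbar (F.w α) := by
  rw [gbar_apply, form_w_eq_zero, map_zero, add_zero]

/-- Letters for the words that span the vacuum module. -/
inductive Letter (F : L.Frame κ)
  | w (α : κ)
  | z (k : ℤ) (b : L.orth k)
  | up (α : κ)

variable {F}

namespace Letter

/-- The element of `C^I` corresponding to a letter. -/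
def val : F.Letter → L.CI
  | w α => L.gbar (F.w α)
  | z _ b => L.gbar (b : 𝔤)
  | up α => L.genUp (F.u.coord α)

/-- The weight of a letter. -/
def wt : F.Letter → ℤ
  -- A vector of `𝔤_{k/2}` gets twice its Kazhdan degree `2 - k`, minus one; for `w α`, of index `2
  -- - k α`, this is `2 k α - 1`. The extra `-1` puts a product of two letters of `𝔤` strictly below
  -- a single letter of the same Kazhdan degree.
  | w α => 2 * F.k α - 1
  | z k _ => 3 - 2 * k
  | up α => 2 * F.k α

/-- The number of factors `φ^α` (`0` or `1`). -/
def ups : F.Letter → ℕ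
  | w _ => 0
  | z _ _ => 0
  | up _ => 1

/-- The eigenvalue of the leading part of the Laplacian. -/
def num : F.Letter → ℕ
  | w _ => 1
  | z _ _ => 0
  | up _ => 1

end Letter

open _root_.FiniteW.IsotropicSubspace.Frame.Letter

/-- The product of the letters of a word. -/
def wval : List F.Letter → L.CI
  | [] => 1
  | y :: w => y.val * wval w

/-- The weight of a word. -/
def wwt : List F.Letter → ℤ
  | [] => 0
  | y :: w => wwt w + y.wt

/-- The number of factors `φ^α` of a word. -/
def wups : List F.Letter → ℕ
  | [] => 0
  | y :: w => wups w + y.ups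

/-- The eigenvalue of the leading part of the Laplacian on a word. -/
def wnum : List F.Letter → ℕ
  | [] => 0
  | y :: w => wnum w + y.num

theorem wups_le_wnum (w : List F.Letter) : wups w ≤ wnum w := by
  induction w with
  | nil => exact le_rfl
  | cons y w ih =>
    rw [wups, wnum]
    refine add_le_add ih ?_
    cases y <;> simp [ups, num]

variable (F) in
/-- The span of the words with a given property, applied to the vacuum. -/
def span (p : List F.Letter → Prop) : Submodule ℂ L.VacModule :=
  Submodule.span ℂ {m | ∃ w, p w ∧ m = wval w • L.vac}

theorem wval_mem_span {p : List F.Letter → Prop} {w : List F.Letter} (hw : p w) :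
    wval w • L.vac ∈ F.span p := Submodule.subset_span ⟨w, hw, rfl⟩

theorem smul_mem_span {p : List F.Letter → Prop} {S : Submodule ℂ L.VacModule} {A : L.CI}
    (h : ∀ w, p w → A • wval w • L.vac ∈ S) {m : L.VacModule} (hm : m ∈ F.span p) : A • m ∈ S := by
  have : F.span p ≤ S.comap (Algebra.lsmul ℂ ℂ L.VacModule A) := by
    refine Submodule.span_le.mpr ?_
    rintro _ ⟨w, hw, rfl⟩
    exact h w hw
  exact this hm

theorem span_mono {p q : List F.Letter → Prop} (h : ∀ w, p w → q w) : F.span p ≤ F.span q :=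
  Submodule.span_mono fun _ ⟨w, hw, hm⟩ => ⟨w, h w hw, hm⟩

theorem val_smul_mem_span {p q : List F.Letter → Prop} (y : F.Letter) (h : ∀ w, p w → q (y :: w))
    {m : L.VacModule} (hm : m ∈ F.span p) : y.val • m ∈ F.span q :=
  smul_mem_span (fun w hw => by
    rw [← mul_smul]
    exact wval_mem_span (w := y :: w) (h w hw)) hm

variable [Fintype κ]

-- By duality, subtracting these multiples of the `w α` makes the rest orthogonal to `𝔫`; only the
-- `w α` of the degree of `b` occur.
variable (F) in
theorem exists_decomp {k : ℤ} {b : 𝔤} (hb : b ∈ P.gr k) : ∃ z ∈ L.orth k,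
    b = ∑ α, (-P.form P.f ⁅(F.u α : 𝔤), b⁆) • F.w α + z := by
  refine ⟨b - ∑ α, (-P.form P.f ⁅(F.u α : 𝔤), b⁆) • F.w α, L.mem_orth.mpr ⟨?_, fun a => ?_⟩,
    by abel⟩
  · refine sub_mem hb (sum_mem fun α _ => ?_)
    by_cases h : F.k α + k = 2
    · have : k = 2 - F.k α := by omega
      rw [this]
      exact Submodule.smul_mem _ _ (F.w_mem α)
    · rw [P.form_f_lie_gr h (F.u_mem α) hb, neg_zero, zero_smul]
      exact zero_mem _
  · have h := sum_coord_smul F.u (P.neForm.flip b ∘ₗ L.n.toSubmodule.subtype) a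
    have h2 : ∀ α, P.form P.f ⁅(a : 𝔤), (-P.form P.f ⁅(F.u α : 𝔤), b⁆) • F.w α⁆ =
        F.u.coord α a • P.form P.f ⁅(F.u α : 𝔤), b⁆ := fun α => by
      rw [lie_smul, map_smul, F.form_w, smul_eq_mul, smul_eq_mul]
      ring
    rw [lie_sub, map_sub, lie_sum, map_sum, Finset.sum_congr rfl fun α _ => h2 α]
    exact sub_eq_zero.mpr h.symm

theorem gbar_smul_mem_span {p q : List F.Letter → Prop} {k : ℤ} {b : 𝔤} (hb : b ∈ P.gr k)
    (h : ∀ (w : List F.Letter) (y : F.Letter), p w → y.wt = 3 - 2 * k → y.ups = 0 → q (y :: w))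
    {m : L.VacModule} (hm : m ∈ F.span p) : L.gbar b • m ∈ F.span q := by
  obtain ⟨z, hz, hbz⟩ := F.exists_decomp hb
  rw [hbz, map_add, map_sum, add_smul, Finset.sum_smul]
  refine add_mem (sum_mem fun α _ => ?_) ?_
  · by_cases hα : F.k α + k = 2
    · rw [map_smul, smul_assoc]
      refine Submodule.smul_mem _ _ (val_smul_mem_span (.w α) (fun w hw => ?_) hm)
      exact h w _ hw (by rw [wt]; omega) rfl
    · rw [P.form_f_lie_gr hα (F.u_mem α) hb, neg_zero, zero_smul, map_zero, zero_smul]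
      exact zero_mem _
  · exact val_smul_mem_span (.z k ⟨z, hz⟩) (fun w hw => h w _ hw rfl rfl) hm

/-! #### Words of negative weight vanish -/

variable (F) in
/-- The span of the words of weight at most `l` and length at most `N`. -/
def filLen (l : ℤ) (N : ℕ) : Submodule ℂ L.VacModule :=
  F.span fun w => wwt w ≤ l ∧ w.length ≤ N

omit [Fintype κ] in
theorem filLen_mono {l l' : ℤ} {N N' : ℕ} (h : l ≤ l') (h' : N ≤ N') :
    F.filLen l N ≤ F.filLen l' N' := span_mono fun _ hw => ⟨hw.1.trans h, hw.2.trans h'⟩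

theorem gbar_smul_mem_filLen {k : ℤ} {b : 𝔤} (hb : b ∈ P.gr k) {l : ℤ} {N : ℕ}
    {m : L.VacModule} (hm : m ∈ F.filLen l N) : L.gbar b • m ∈ F.filLen (l + 3 - 2 * k) (N + 1) :=
  gbar_smul_mem_span hb (fun w y hw hy _ =>
    ⟨by rw [wwt]; omega, by rw [List.length_cons]; omega⟩) hm

/-- The bound for `gbar b` is `3 - 2 k`. The additional `1` is needed only for `k = 2`, where the
scalar `(f | b)` may be non-zero and has weight `0`. -/
theorem genG_smul_mem_filLen {k : ℤ} {b : 𝔤} (hb : b ∈ P.gr k) {l : ℤ} {N : ℕ}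
    {m : L.VacModule} (hm : m ∈ F.filLen l N) : L.genG b • m ∈ F.filLen (l + 4 - 2 * k) (N + 1) := by
  rw [genG_smul]
  refine sub_mem (filLen_mono (by omega) le_rfl (gbar_smul_mem_filLen hb hm)) ?_
  by_cases hk : k = 2
  · exact Submodule.smul_mem _ _ (filLen_mono (by omega) (by omega) hm)
  · rw [P.form_f_gr hk hb, zero_smul]
    exact zero_mem _

/-- Move `b` to the right until it hits the vacuum, which it kills since `k ≥ 2`. Only commutators
remain; they merge two letters into one and lie below the expected weight `wwt w + 3 - 2 k`. -/
theorem gbar_smul_wval_mem {k : ℤ} (hk : 2 ≤ k) {b : 𝔤} (hb : b ∈ P.gr k) (w : List F.Letter) :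
    L.gbar b • wval w • L.vac ∈ F.filLen (wwt w + 2 - 2 * k) w.length := by
  induction w with
  | nil =>
    rw [wval, one_smul, L.gbar_smul_vac (P.gr_le_ge hk hb)]
    exact zero_mem _
  | cons y w ih =>
    have h1 : y.val • L.gbar b • wval w • L.vac ∈
        F.filLen (wwt (y :: w) + 2 - 2 * k) (y :: w).length :=
      val_smul_mem_span y (fun w' hw' => ⟨by rw [wwt, wwt]; omega,
        by rw [List.length_cons, List.length_cons]; omega⟩) ih
    have h2 : wval w • L.vac ∈ F.filLen (wwt w) w.length := wval_mem_span ⟨le_rfl, le_rfl⟩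
    have key : ∀ (k' : ℤ) (c : 𝔤), c ∈ P.gr k' → y.val = L.gbar c → y.wt = 3 - 2 * k' →
        L.gbar b • wval (y :: w) • L.vac ∈
          F.filLen (wwt (y :: w) + 2 - 2 * k) (y :: w).length := by
      intro k' c hc hy hw
      rw [wval, mul_smul, hy, ← mul_smul, gbar_gbar, add_smul, mul_smul, ← hy]
      refine add_mem h1 ?_
      refine filLen_mono ?_ le_rfl (genG_smul_mem_filLen (P.lie_mem_gr hb hc) h2)
      rw [wwt]
      omega
    cases y with
    | w α => exact key (2 - F.k α) (F.w α) (F.w_mem α) rfl (by rw [wt]; omega)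
    | z k' c => exact key k' c (L.mem_orth.mp c.2).1 rfl rfl
    | up α =>
      rw [wval, mul_smul, Letter.val, ← mul_smul, gbar_genUp, mul_smul]
      exact h1

/-- The only letters of negative weight are the `z k b` with `k ≥ 2`, and these can be absorbed at
the cost of length. Induction on the length reduces to the empty word, of weight `0`. -/
theorem filLen_eq_bot (N : ℕ) : ∀ l : ℤ, l < 0 → F.filLen l N = ⊥ := by
  induction N with
  | zero =>
    intro l hl
    refine Submodule.span_eq_bot.mpr ?_
    rintro _ ⟨w, ⟨hw, hN⟩, rfl⟩
    rw [List.eq_nil_of_length_eq_zero (Nat.le_zero.mp hN), wwt] at hw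
    omega
  | succ N ih =>
    intro l hl
    refine Submodule.span_eq_bot.mpr ?_
    rintro _ ⟨w, ⟨hw, hN⟩, rfl⟩
    cases w with
    | nil => rw [wwt] at hw; omega
    | cons y w =>
      rw [List.length_cons] at hN
      rw [wwt] at hw
      by_cases hw0 : wwt w < 0
      · have h : wval w • L.vac ∈ F.filLen (wwt w) N := wval_mem_span ⟨le_rfl, by omega⟩
        rw [ih _ hw0, Submodule.mem_bot] at h
        rw [wval, mul_smul, h, smul_zero]
      · cases y with
        | w α => have := F.one_le α; rw [wt] at hw; omega
        | up α => have := F.one_le α; rw [wt] at hw; omega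
        | z k b =>
          rw [wt] at hw
          have h := filLen_mono (le_refl _) (show w.length ≤ N by omega)
            (gbar_smul_wval_mem (show 2 ≤ k by omega) (L.mem_orth.mp b.2).1 w)
          rw [ih _ (by omega), Submodule.mem_bot] at h
          rw [wval, mul_smul]
          exact h

/-! #### The filtration by weight and the number of factors `φ^α` -/

variable (F) in
/-- The span of the words of weight at most `l` with at least `n` factors `φ^α`. -/
def fil (l : ℤ) (n : ℕ) : Submodule ℂ L.VacModule :=
  F.span fun w => wwt w ≤ l ∧ n ≤ wups w

omit [Fintype κ] in
theorem fil_mono {l l' : ℤ} {n n' : ℕ} (h : l ≤ l') (h' : n' ≤ n) : F.fil l n ≤ F.fil l' n' :=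
  span_mono fun _ hw => ⟨hw.1.trans h, h'.trans hw.2⟩

/-- The filtration is thus bounded below, so triangularity can be exploited by induction on the
weight. -/
theorem fil_eq_bot {l : ℤ} (hl : l < 0) (n : ℕ) : F.fil l n = ⊥ := by
  refine Submodule.span_eq_bot.mpr ?_
  rintro _ ⟨w, ⟨hw, -⟩, rfl⟩
  have h : wval w • L.vac ∈ F.filLen l w.length := wval_mem_span ⟨hw, le_rfl⟩
  rwa [filLen_eq_bot _ l hl, Submodule.mem_bot] at h

omit [Fintype κ] in
theorem wval_mem_fil (w : List F.Letter) : wval w • L.vac ∈ F.fil (wwt w) (wups w) :=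
  wval_mem_span ⟨le_rfl, le_rfl⟩

theorem gbar_smul_mem_fil {k : ℤ} {b : 𝔤} (hb : b ∈ P.gr k) {l : ℤ} {n : ℕ}
    {m : L.VacModule} (hm : m ∈ F.fil l n) : L.gbar b • m ∈ F.fil (l + 3 - 2 * k) n :=
  gbar_smul_mem_span hb (fun w y hw hy _ =>
    ⟨by rw [wwt]; omega, by rw [wups]; omega⟩) hm

theorem genG_smul_mem_fil {k : ℤ} {b : 𝔤} (hb : b ∈ P.gr k) {l : ℤ} {n : ℕ}
    {m : L.VacModule} (hm : m ∈ F.fil l n) : L.genG b • m ∈ F.fil (l + 4 - 2 * k) n := by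
  rw [genG_smul]
  refine sub_mem (fil_mono (by omega) le_rfl (gbar_smul_mem_fil hb hm)) ?_
  by_cases hk : k = 2
  · exact Submodule.smul_mem _ _ (fil_mono (by omega) le_rfl hm)
  · rw [P.form_f_gr hk hb, zero_smul]
    exact zero_mem _

omit [Fintype κ] in
theorem val_smul_mem_fil (y : F.Letter) {l : ℤ} {n : ℕ} {m : L.VacModule} (hm : m ∈ F.fil l n) :
    y.val • m ∈ F.fil (l + y.wt) (n + y.ups) :=
  val_smul_mem_span y (fun w hw => ⟨by rw [wwt]; omega, by rw [wups]; omega⟩) hm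

omit [Fintype κ] in
theorem genUp_smul_mem_fil (α : κ) {l : ℤ} {n : ℕ} {m : L.VacModule} (hm : m ∈ F.fil l n) :
    L.genUp (F.u.coord α) • m ∈ F.fil (l + 2 * F.k α) (n + 1) :=
  val_smul_mem_fil (.up α) hm

-- Moved towards the vacuum, `φ_α` meets only letters `φ^β` that matter. By homogeneity of the basis
-- the contraction vanishes unless `k β = k α`, hence the exact weight drop.
omit [Fintype κ] in
theorem genDown_smul_wval_mem (α : κ) (w : List F.Letter) :
    L.genDown (F.u α) • wval w • L.vac ∈ F.fil (wwt w - 2 * F.k α) (wups w - 1) := by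
  induction w with
  | nil =>
    rw [wval, one_smul, genDown_smul_vac]
    exact zero_mem _
  | cons y w ih =>
    have h1 := val_smul_mem_fil y ih
    rw [wval, wups, wwt, mul_smul]
    have key : ∀ c : 𝔤, y.val = L.gbar c → y.ups = 0 → L.genDown (F.u α) • y.val • wval w • L.vac ∈
        F.fil (wwt w + y.wt - 2 * F.k α) (wups w + y.ups - 1) := by
      intro c hy hu
      rw [hy, ← mul_smul, ← gbar_genDown, mul_smul, ← hy]
      exact fil_mono (by omega) (by omega) h1
    cases y with
    | w β => exact key _ rfl rfl
    | z k c => exact key _ rfl rfl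
    | up β =>
      rw [Letter.val, ← mul_smul, genDown_genUp, sub_smul, algebraMap_smul, mul_smul]
      refine sub_mem ?_ (fil_mono (by omega) (by rw [ups]; omega) h1)
      by_cases h : F.k β = F.k α
      · refine Submodule.smul_mem _ _ (fil_mono ?_ ?_ (wval_mem_fil w))
        · rw [wt]; omega
        · rw [ups]; omega
      · rw [F.coord_eq_zero (F.u_mem α) h, zero_smul]
        exact zero_mem _

omit [Fintype κ] in
theorem genDown_smul_mem_fil (α : κ) {l : ℤ} {n : ℕ} {m : L.VacModule} (hm : m ∈ F.fil l n) :
    L.genDown (F.u α) • m ∈ F.fil (l - 2 * F.k α) (n - 1) :=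
  smul_mem_span (fun w hw => fil_mono (by omega) (by omega) (genDown_smul_wval_mem α w)) hm

/-- The `+ 1` allows for the scalar `(f | [u_α, c])` in the commutator with a letter `c`. So `d`
raises weights by at most one, and `η` lowers them by one. -/
theorem J_smul_wval_mem (α : κ) (w : List F.Letter) :
    L.J F.u (F.u α) • wval w • L.vac ∈ F.fil (wwt w - 2 * F.k α + 1) (wups w) := by
  induction w with
  | nil =>
    rw [wval, one_smul, J_smul_vac]
    exact zero_mem _
  | cons y w ih =>
    have h1 := val_smul_mem_fil y ih
    have h2 := wval_mem_fil w
    rw [wval, wups, wwt, mul_smul]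
    have key : ∀ (k' : ℤ) (c : 𝔤), c ∈ P.gr k' → y.val = L.gbar c → y.wt = 3 - 2 * k' →
        y.ups = 0 → L.J F.u (F.u α) • y.val • wval w • L.vac ∈
        F.fil (wwt w + y.wt - 2 * F.k α + 1) (wups w + y.ups) := by
      intro k' c hc hy hw hu
      rw [hy, ← mul_smul, J_gbar, add_smul, mul_smul, ← hy]
      refine add_mem (fil_mono (by omega) le_rfl h1) ?_
      exact fil_mono (by omega) (by omega) (genG_smul_mem_fil (P.lie_mem_gr (F.u_mem α) hc) h2)
    cases y with
    | w β => exact key (2 - F.k β) (F.w β) (F.w_mem β) rfl (by rw [wt]; omega) rfl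
    | z k' c => exact key k' c (L.mem_orth.mp c.2).1 rfl rfl rfl
    | up β =>
      rw [Letter.val, ← mul_smul, J_genUp, add_smul, mul_smul, Finset.sum_smul]
      refine add_mem (fil_mono (by omega) le_rfl h1) (sum_mem fun γ _ => ?_)
      rw [smul_assoc]
      by_cases h : F.k β = F.k γ + F.k α
      · refine Submodule.smul_mem _ _ (fil_mono ?_ le_rfl (genUp_smul_mem_fil γ h2))
        rw [wt]
        omega
      · rw [F.coord_eq_zero (a := ⁅F.u γ, F.u α⁆) (P.lie_mem_gr (F.u_mem γ) (F.u_mem α)) h,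
          zero_smul]
        exact zero_mem _

theorem J_smul_mem_fil (α : κ) {l : ℤ} {n : ℕ} {m : L.VacModule} (hm : m ∈ F.fil l n) :
    L.J F.u (F.u α) • m ∈ F.fil (l - 2 * F.k α + 1) n :=
  smul_mem_span (fun w hw => fil_mono (by omega) (by omega) (J_smul_wval_mem α w)) hm

end Frame

end IsotropicSubspace


namespace IsotropicSubspace

variable {𝔤 : Type*} [LieRing 𝔤] [LieAlgebra ℂ 𝔤] {P : GoodPair 𝔤} {L : IsotropicSubspace P}

/-! ### The Laplacian of the vacuum module -/

variable (L) in
theorem toNe_surjective : Function.Surjective L.toNe :=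
  L.neEquiv.symm.surjective.comp (Submodule.mkQ_surjective _)

namespace Frame

variable {κ : Type*} (F : L.Frame κ) [Fintype κ]

/-- The element `∑_α w^α φ_α` of `C^I`, whose left multiplication is a homotopy of the vacuum
module. -/
def eta : L.CI := ∑ α, L.genG (F.w α) * L.genDown (F.u α)

/-- The Laplacian `[d, η]` of the vacuum module. -/
def box : L.CI := L.dI F.u * F.eta + F.eta * L.dI F.u

/-- `η` is odd, so the anticommutator is `D η`, and `D` is a superderivation with `D φ_α = J_α`. -/
theorem box_eq : F.box = ∑ α, (L.genG (F.w α) * L.J F.u (F.u α) +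
    ∑ β, L.genUp (F.u.coord β) * L.genG ⁅(F.u β : 𝔤), F.w α⁆ * L.genDown (F.u α)) := by
  have h : F.box = L.D F.u F.eta := by
    have hσ : L.rBracket.σ F.eta = -F.eta := by
      rw [eta, map_sum, ← Finset.sum_neg_distrib]
      refine Finset.sum_congr rfl fun α _ => ?_
      rw [map_mul L.rBracket.σ, σ_genG, σ_genDown, mul_neg]
    rw [D_apply, hσ, neg_mul, sub_neg_eq_add, box]
  rw [h, eta, map_sum]
  refine Finset.sum_congr rfl fun α _ => ?_
  rw [D_mul, D_genG, σ_genG, D_genDown, Finset.sum_mul, add_comm]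

theorem box_gbar (b : 𝔤) : F.box * L.gbar b = L.gbar b * F.box +
    (∑ α, L.genG (F.w α) * L.genG ⁅(F.u α : 𝔤), b⁆ +
      ∑ α, L.genG ⁅F.w α, b⁆ * L.J F.u (F.u α) +
      ∑ α, ∑ β, L.genUp (F.u.coord β) * L.genG ⁅⁅(F.u β : 𝔤), F.w α⁆, b⁆ * L.genDown (F.u α)) := by
  rw [box_eq, Finset.sum_mul, Finset.mul_sum, ← Finset.sum_add_distrib, ← Finset.sum_add_distrib,
    ← Finset.sum_add_distrib]
  refine Finset.sum_congr rfl fun α _ => ?_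
  have h1 : L.genG (F.w α) * L.J F.u (F.u α) * L.gbar b =
      L.gbar b * (L.genG (F.w α) * L.J F.u (F.u α)) + L.genG ⁅F.w α, b⁆ * L.J F.u (F.u α) +
        L.genG (F.w α) * L.genG ⁅(F.u α : 𝔤), b⁆ := by
    rw [mul_assoc, J_gbar, mul_add, ← mul_assoc, genG_gbar, add_mul, mul_assoc]
  have h2 : ∀ β, L.genUp (F.u.coord β) * L.genG ⁅(F.u β : 𝔤), F.w α⁆ * L.genDown (F.u α) *
      L.gbar b = L.gbar b *
        (L.genUp (F.u.coord β) * L.genG ⁅(F.u β : 𝔤), F.w α⁆ * L.genDown (F.u α)) +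
      L.genUp (F.u.coord β) * L.genG ⁅⁅(F.u β : 𝔤), F.w α⁆, b⁆ * L.genDown (F.u α) := fun β => by
    rw [mul_assoc, ← gbar_genDown, ← mul_assoc, mul_assoc (L.genUp _), genG_gbar, mul_add, add_mul,
      ← mul_assoc, ← gbar_genUp]
    simp only [mul_assoc]
  rw [add_mul, mul_add, h1, Finset.sum_mul, Finset.sum_congr rfl fun β _ => h2 β,
    Finset.sum_add_distrib, Finset.mul_sum]
  abel

theorem box_genUp (p : Module.Dual ℂ L.n) : F.box * L.genUp p = L.genUp p * F.box +
    (∑ α, L.genG (F.w α) * ∑ k, p ⁅F.u k, F.u α⁆ • L.genUp (F.u.coord k) +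
      ∑ α, ∑ β, p (F.u α) • (L.genUp (F.u.coord β) * L.genG ⁅(F.u β : 𝔤), F.w α⁆)) := by
  rw [box_eq, Finset.sum_mul, Finset.mul_sum, ← Finset.sum_add_distrib, ← Finset.sum_add_distrib]
  refine Finset.sum_congr rfl fun α _ => ?_
  have h1 : L.genG (F.w α) * L.J F.u (F.u α) * L.genUp p =
      L.genUp p * (L.genG (F.w α) * L.J F.u (F.u α)) +
        L.genG (F.w α) * ∑ k, p ⁅F.u k, F.u α⁆ • L.genUp (F.u.coord k) := by
    rw [mul_assoc, J_genUp, mul_add, ← mul_assoc, genG_genUp, mul_assoc]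
  have h2 : ∀ β, L.genUp (F.u.coord β) * L.genG ⁅(F.u β : 𝔤), F.w α⁆ * L.genDown (F.u α) *
      L.genUp p = L.genUp p *
        (L.genUp (F.u.coord β) * L.genG ⁅(F.u β : 𝔤), F.w α⁆ * L.genDown (F.u α)) +
      p (F.u α) • (L.genUp (F.u.coord β) * L.genG ⁅(F.u β : 𝔤), F.w α⁆) := fun β => by
    rw [mul_assoc, genDown_genUp, mul_sub, ← Algebra.commutes, ← Algebra.smul_def,
      ← mul_assoc _ (L.genUp p), mul_assoc _ _ (L.genUp p), genG_genUp, ← mul_assoc _ (L.genUp p),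
      L.genUp_genUp _ p]
    noncomm_ring
  rw [add_mul, mul_add, h1, Finset.sum_mul, Finset.sum_congr rfl fun β _ => h2 β,
    Finset.sum_add_distrib, Finset.mul_sum Finset.univ _ (L.genUp p)]
  abel

variable {F}

/-- Of all corrections in `box_gbar` only the scalar part of `[u_α, b]`, multiplied by `w α`, keeps
the weight of `b`; the sum added back here cancels it. -/
theorem box_gbar_smul_sub_mem {k : ℤ} {b : 𝔤} (hb : b ∈ P.gr k) {l : ℤ} {n : ℕ} {m : L.VacModule}
    (hm : m ∈ F.fil l n) : F.box • L.gbar b • m - L.gbar b • F.box • m +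
      L.gbar (∑ α, P.form P.f ⁅(F.u α : 𝔤), b⁆ • F.w α) • m ∈ F.fil (l + 2 - 2 * k) n := by
  rw [← mul_smul, box_gbar, add_smul, mul_smul, add_sub_cancel_left, add_smul, add_smul,
    Finset.sum_smul, Finset.sum_smul, Finset.sum_smul, map_sum, Finset.sum_smul,
    add_right_comm, add_right_comm _ _ (∑ α, L.gbar _ • m), ← Finset.sum_add_distrib]
  refine add_mem (add_mem (sum_mem fun α _ => ?_) (sum_mem fun α _ => ?_)) (sum_mem fun α _ => ?_)
  · rw [mul_smul, genG_smul _ ⁅(F.u α : 𝔤), b⁆, smul_sub, genG_w, map_smul, smul_assoc,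
      smul_comm (L.gbar (F.w α)) (P.form P.f _), sub_add_cancel]
    exact fil_mono (by omega) le_rfl (gbar_smul_mem_fil (F.w_mem α)
      (gbar_smul_mem_fil (P.lie_mem_gr (F.u_mem α) hb) hm))
  · rw [mul_smul]
    exact fil_mono (by omega) le_rfl
      (genG_smul_mem_fil (P.lie_mem_gr (F.w_mem α) hb) (J_smul_mem_fil α hm))
  · rw [Finset.sum_smul]
    refine sum_mem fun β _ => ?_
    rw [mul_smul, mul_smul]
    exact fil_mono (by omega) (by omega) (genUp_smul_mem_fil β (genG_smul_mem_fil
      (P.lie_mem_gr (P.lie_mem_gr (F.u_mem β) (F.w_mem α)) hb) (genDown_smul_mem_fil α hm)))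

/-- The leading correction is `φ^γ` itself, from the scalar parts of `[u_β, w γ]`; it comes from
contracting the `φ_γ` in `η`. -/
theorem box_genUp_smul_sub_mem (γ : κ) {l : ℤ} {n : ℕ} {m : L.VacModule}
    (hm : m ∈ F.fil l n) : F.box • L.genUp (F.u.coord γ) • m -
      L.genUp (F.u.coord γ) • F.box • m - L.genUp (F.u.coord γ) • m ∈
        F.fil (l + 2 * F.k γ - 1) (n + 1) := by
  -- Duality rewrites `φ^γ` as a sum over `β`, matching term by term the scalars split off from
  -- `[u_β, w γ]`.
  have h0 : L.genUp (F.u.coord γ) • m = -∑ β, P.form P.f ⁅(F.u β : 𝔤), F.w γ⁆ •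
      L.genUp (F.u.coord β) • m := by
    classical
    rw [← Finset.sum_neg_distrib, Finset.sum_eq_single γ]
    · rw [F.form_w]; simp
    · intro β _ hβ
      rw [F.form_w]; simp [hβ]
    · simp
  have h1 : ∑ α, ∑ β, F.u.coord γ (F.u α) • (L.genUp (F.u.coord β) * L.genG ⁅(F.u β : 𝔤), F.w α⁆) =
      ∑ β, L.genUp (F.u.coord β) * L.genG ⁅(F.u β : 𝔤), F.w γ⁆ := by
    classical
    rw [Finset.sum_eq_single γ]
    · simp
    · intro β _ hβ
      simp [hβ]
    · simp
  rw [← mul_smul, box_genUp, h1, add_smul, mul_smul, add_sub_cancel_left]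
  rw [h0, sub_neg_eq_add, add_smul, Finset.sum_smul, Finset.sum_smul, add_assoc,
    ← Finset.sum_add_distrib]
  refine add_mem (sum_mem fun α _ => ?_) (sum_mem fun β _ => ?_)
  · rw [mul_smul, Finset.sum_smul, Finset.smul_sum, genG_w]
    refine sum_mem fun δ _ => ?_
    rw [smul_assoc]
    by_cases h : F.k γ = F.k δ + F.k α
    · rw [smul_comm (L.gbar _) (F.u.coord γ _)]
      exact Submodule.smul_mem _ _ (fil_mono (by omega) le_rfl
        (gbar_smul_mem_fil (F.w_mem α) (genUp_smul_mem_fil δ hm)))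
    · rw [F.coord_eq_zero (a := ⁅F.u δ, F.u α⁆) (P.lie_mem_gr (F.u_mem δ) (F.u_mem α)) h,
        zero_smul, smul_zero]
      exact zero_mem _
  · rw [mul_smul, genG_smul, smul_sub, smul_comm (L.genUp _) (P.form P.f _), sub_add_cancel]
    exact fil_mono (by omega) le_rfl (genUp_smul_mem_fil β
      (gbar_smul_mem_fil (P.lie_mem_gr (F.u_mem β) (F.w_mem γ)) hm))

/-- Letter by letter: `w γ` reproduces itself since `(f | [u_α, w γ]) = -δ`, `z` gives nothing by
orthogonality to `𝔫`, and `φ^γ` reproduces itself. -/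
theorem box_smul_wval_sub_mem (w : List F.Letter) :
    F.box • wval w • L.vac - (wnum w : ℂ) • wval w • L.vac ∈ F.fil (wwt w - 1) (wups w) := by
  induction w with
  | nil =>
    have h : F.box • L.vac = 0 := by
      rw [box_eq, Finset.sum_smul]
      refine Finset.sum_eq_zero fun α _ => ?_
      rw [add_smul, mul_smul, J_smul_vac, smul_zero, zero_add, Finset.sum_smul]
      refine Finset.sum_eq_zero fun β _ => ?_
      rw [mul_smul, genDown_smul_vac, smul_zero]
    rw [wval, one_smul, h, wnum, Nat.cast_zero, zero_smul, sub_zero]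
    exact zero_mem _
  | cons y w ih =>
    have h1 := val_smul_mem_fil y ih
    have h2 := wval_mem_fil w
    rw [wval, mul_smul, wnum, wwt, wups, Nat.cast_add, add_smul]
    suffices h : F.box • y.val • wval w • L.vac - y.val • F.box • wval w • L.vac -
        (y.num : ℂ) • y.val • wval w • L.vac ∈ F.fil (wwt w + y.wt - 1) (wups w + y.ups) by
      have h3 := add_mem h (fil_mono (by omega) le_rfl h1)
      rw [smul_sub, smul_comm y.val (wnum w : ℂ)] at h3
      convert h3 using 1
      abel
    cases y with
    | w γ =>
      have h := box_gbar_smul_sub_mem (F.w_mem γ) h2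
      have hw : ∑ α, P.form P.f ⁅(F.u α : 𝔤), F.w γ⁆ • F.w α = -F.w γ := by
        classical
        rw [Finset.sum_eq_single γ]
        · rw [F.form_w]; simp
        · intro β _ hβ
          rw [F.form_w]; simp [hβ.symm]
        · simp
      rw [hw, map_neg, neg_smul, ← sub_eq_add_neg] at h
      rw [Letter.num, Nat.cast_one, one_smul]
      exact fil_mono (by rw [Letter.wt]; omega) le_rfl h
    | z k b =>
      have h := box_gbar_smul_sub_mem (L.mem_orth.mp b.2).1 h2
      simp only [(L.mem_orth.mp b.2).2, zero_smul, Finset.sum_const_zero, map_zero, add_zero] at h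
      rw [Letter.num, Nat.cast_zero, zero_smul, sub_zero]
      exact fil_mono (by rw [Letter.wt]; omega) le_rfl h
    | up γ =>
      have h := box_genUp_smul_sub_mem γ h2
      rw [Letter.num, Nat.cast_one, one_smul]
      exact fil_mono (by rw [Letter.wt]) le_rfl h

/-- A word with some `φ^α` has a diagonal entry at least `1`. The corrections keep the number of
factors `φ^α` and lower the weight, which cannot become negative. -/
theorem fil_le_unitTorsion (l : ℤ) :
    F.fil l 1 ≤ unitTorsion (Algebra.lsmul ℂ ℂ L.VacModule F.box) := by
  have key : ∀ (N : ℕ) (l : ℤ), l < N →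
      F.fil l 1 ≤ unitTorsion (Algebra.lsmul ℂ ℂ L.VacModule F.box) := by
    intro N
    induction N with
    | zero =>
      intro l hl
      rw [fil_eq_bot (by exact_mod_cast hl)]
      exact bot_le
    | succ N ih =>
      intro l hl
      refine Submodule.span_le.mpr ?_
      rintro _ ⟨w, ⟨hw, hn⟩, rfl⟩
      refine mem_unitTorsion_of_sub (q := (wnum w : ℂ)) ?_
        (ih (wwt w - 1) (by push_cast at hl; omega)
          (fil_mono le_rfl hn (box_smul_wval_sub_mem w)))
      have := wups_le_wnum w
      exact_mod_cast (by omega : wnum w ≠ 0)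
  exact key (l.toNat + 1) l (by push_cast; omega)

/-! ### Words span the vacuum module; reduction of cocycles to `U(𝔤)`. -/

theorem gbar_smul_mem_span_top (b : 𝔤) {m : L.VacModule} (hm : m ∈ F.span fun _ => True) :
    L.gbar b • m ∈ F.span fun _ => True := by
  let S : Submodule ℂ 𝔤 := (F.span fun _ => True).comap
    ((LinearMap.toSpanSingleton L.CI L.VacModule m).restrictScalars ℂ ∘ₗ L.gbar)
  have hS : ⨆ k, P.gr k ≤ S := iSup_le fun k b hb =>
    gbar_smul_mem_span (q := fun _ => True) hb (fun _ _ _ _ _ => trivial) hm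
  rw [P.iSup_gr] at hS
  exact hS (Submodule.mem_top (x := b))

theorem span_true : F.span (fun _ => True) = ⊤ := by
  have hfil : ∀ l n, F.fil l n ≤ F.span (fun _ => True) := fun _ _ => span_mono fun _ _ => trivial
  let S : Submodule ℂ L.CI := (F.span fun _ => True).comap
    ((LinearMap.toSpanSingleton L.CI L.VacModule L.vac).restrictScalars ℂ)
  have hS : ∀ A, A ∈ S ↔ A • L.vac ∈ F.span fun _ => True := fun A => Iff.rfl
  refine Submodule.eq_top_iff'.mpr fun z => ?_
  obtain ⟨A, rfl⟩ := Submodule.Quotient.mk_surjective _ z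
  rw [← smul_vac, ← hS]
  refine L.CI_induction S ?_ ?_ ?_ ?_ ?_ A
  · rw [hS]
    exact wval_mem_span (w := []) trivial
  · intro b A hA
    rw [hS, mul_smul, genG_smul]
    exact sub_mem (gbar_smul_mem_span_top b hA) (Submodule.smul_mem _ _ hA)
  · intro v A hA
    rw [hS, mul_smul]
    refine smul_mem_span (p := fun _ => True) (fun w _ => ?_) hA
    -- No letters `Φ` are needed: `Φ` commutes with every letter, and on the vacuum `Φ_[a]` acts as
    -- `-(a + (f | a))`.
    induction w with
    | nil =>
      obtain ⟨a, rfl⟩ := L.toNe_surjective v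
      rw [wval, one_smul, genNe_smul_vac]
      refine neg_mem (gbar_smul_mem_span_top _ ?_)
      have h := wval_mem_span (F := F) (p := fun _ => True) (w := []) trivial
      rwa [wval, one_smul] at h
    | cons y w ih =>
      have h : L.genNe v * y.val = y.val * L.genNe v := by
        cases y
        · exact L.genNe_gbar _ _
        · exact L.genNe_gbar _ _
        · exact L.genNe_genUp _ _
      rw [wval, mul_smul, ← mul_smul, h, mul_smul]
      exact val_smul_mem_span y (fun _ _ => trivial) ih
  · intro p A hA
    rw [hS, mul_smul, ← F.u.sum_dual_apply_smul_coord p, map_sum, Finset.sum_smul]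
    refine sum_mem fun α _ => ?_
    rw [map_smul, smul_assoc]
    exact Submodule.smul_mem _ _ (val_smul_mem_span (.up α) (fun _ _ => trivial) hA)
  · intro a A hA
    rw [hS, mul_smul, ← F.u.sum_repr a, map_sum, Finset.sum_smul]
    refine sum_mem fun α _ => ?_
    rw [map_smul, smul_assoc]
    exact Submodule.smul_mem _ _
      (smul_mem_span (fun w _ => hfil _ _ (genDown_smul_wval_mem α w)) hA)

variable (L) in
/-- The map `U(𝔤) → C^I → VacModule`. -/
def genUVac : UniversalEnvelopingAlgebra ℂ 𝔤 →ₗ[ℂ] L.VacModule :=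
  (LinearMap.toSpanSingleton L.CI L.VacModule L.vac).restrictScalars ℂ ∘ₗ L.genU.toLinearMap

theorem genUVac_apply (B : UniversalEnvelopingAlgebra ℂ 𝔤) : genUVac L B = L.genU B • L.vac := rfl

omit [Fintype κ] in
theorem wval_mem_range_genU {w : List F.Letter} (hw : wups w = 0) : wval w ∈ L.genU.range := by
  have hgbar : ∀ b, L.gbar b ∈ L.genU.range := fun b => by
    rw [gbar_apply, ← genU_ι]
    exact add_mem ⟨_, rfl⟩ (Subalgebra.algebraMap_mem _ _)
  induction w with
  | nil => exact one_mem _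
  | cons y w ih =>
    rw [wups] at hw
    refine mul_mem ?_ (ih (by omega))
    cases y with
    | w α => exact hgbar _
    | z k b => exact hgbar _
    | up α => rw [Letter.ups] at hw; omega

/-- A spanning word either contains no `φ^α`, and then lies in `U(𝔤)`, or is in the unit torsion. -/
theorem range_genUVac_sup_unitTorsion :
    LinearMap.range (genUVac L) ⊔ unitTorsion (Algebra.lsmul ℂ ℂ L.VacModule F.box) = ⊤ := by
  rw [eq_top_iff, ← span_true (F := F)]
  refine Submodule.span_le.mpr ?_
  rintro _ ⟨w, -, rfl⟩
  by_cases hw : wups w = 0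
  · obtain ⟨B, hB⟩ := wval_mem_range_genU hw
    refine Submodule.mem_sup_left ⟨B, ?_⟩
    rw [genUVac_apply, ← hB]
    rfl
  · exact Submodule.mem_sup_right
      (fil_le_unitTorsion _ (fil_mono le_rfl (by omega) (wval_mem_fil w)))

/-- On `U(𝔤) vac` all `φ_a` act by zero, so `box` reduces to `B ↦ ∑ w_α [u_α, B]`. -/
theorem box_smul_genUVac_mem (B : UniversalEnvelopingAlgebra ℂ 𝔤) :
    F.box • genUVac L B ∈ LinearMap.range (genUVac L) := by
  have h1 : ∀ a, L.genDown a • L.genU B • L.vac = 0 := fun a => by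
    rw [← mul_smul, ← genU_genDown, mul_smul, genDown_smul_vac, smul_zero]
  rw [genUVac_apply, box_eq, Finset.sum_smul]
  refine sum_mem fun α _ => ⟨UniversalEnvelopingAlgebra.ι ℂ (F.w α) * adU (F.u α : 𝔤) B, ?_⟩
  rw [add_smul, Finset.sum_smul]
  simp only [mul_smul, h1, smul_zero, Finset.sum_const_zero, add_zero, J_apply, add_smul,
    theta_apply, Finset.sum_smul]
  rw [genUVac_apply, map_mul, genU_ι, mul_smul, ← mul_smul (L.X _), X_genU, add_smul, mul_smul,
    X_smul_vac, smul_zero, zero_add]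

/-- Every cocycle of the vacuum module is cohomologous to an element of `U(𝔤)`. -/
theorem exists_genU_smul_vac {z : L.VacModule} (hz : L.dI F.u • z = 0) :
    ∃ B y, z = L.genU B • L.vac + L.dI F.u • y := by
  let ρ : L.CI →ₐ[ℂ] Module.End ℂ L.VacModule := Algebra.lsmul ℂ ℂ L.VacModule
  have hbox : ρ (L.dI F.u) * ρ F.eta + ρ F.eta * ρ (L.dI F.u) = ρ F.box := by
    rw [box, map_add ρ, map_mul ρ, map_mul ρ]
  have hD : ∀ v, ρ (L.dI F.u) (ρ (L.dI F.u) v) = 0 := fun v => by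
    change L.dI F.u • L.dI F.u • v = 0
    rw [← mul_smul, show L.dI F.u * L.dI F.u = 0 from (L.differentialI F.u).d_mul_d, zero_smul]
  obtain ⟨_, ⟨B, rfl⟩, y, h⟩ := exists_mem_add_eq (h := ρ F.eta)
    (N := LinearMap.range (genUVac L)) hD
    (fun v hv => by
      obtain ⟨B, rfl⟩ := hv
      rw [hbox]
      exact box_smul_genUVac_mem B) hz
    (by rw [hbox, range_genUVac_sup_unitTorsion]; exact Submodule.mem_top)
  exact ⟨B, y, h⟩

end Frame

end IsotropicSubspace


/-- A criterion for a linear map to extend to the enveloping algebra. -/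
theorem SuperBracket.lift_eq_of_rel {V₀ V₁ : Type*} [AddCommGroup V₀] [Module ℂ V₀]
    [AddCommGroup V₁] [Module ℂ V₁] (β : SuperBracket V₀ V₁) {B : Type*} [Ring B] [Algebra ℂ B]
    (g : V₀ × V₁ →ₗ[ℂ] B) (l : V₀ × V₁ →ₗ[ℂ] V₀ × V₁ →ₗ[ℂ] V₀ × V₁)
    (c : V₀ × V₁ →ₗ[ℂ] V₀ × V₁ →ₗ[ℂ] ℂ)
    (hβ : ∀ r s, β.bracket r s = TensorAlgebra.ι ℂ (l r s) + algebraMap ℂ _ (c r s))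
    (h₀₀ : ∀ a b, g (a, 0) * g (b, 0) - g (b, 0) * g (a, 0) =
      g (l (a, 0) (b, 0)) + c (a, 0) (b, 0) • 1)
    (h₀₁ : ∀ a b, g (a, 0) * g (0, b) - g (0, b) * g (a, 0) =
      g (l (a, 0) (0, b)) + c (a, 0) (0, b) • 1)
    (h₁₀ : ∀ a b, g (0, a) * g (b, 0) - g (b, 0) * g (0, a) =
      g (l (0, a) (b, 0)) + c (0, a) (b, 0) • 1)
    (h₁₁ : ∀ a b, g (0, a) * g (0, b) + g (0, b) * g (0, a) =
      g (l (0, a) (0, b)) + c (0, a) (0, b) • 1)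
    ⦃s t : TensorAlgebra ℂ (V₀ × V₁)⦄ (h : β.Rel s t) :
    TensorAlgebra.lift ℂ g s = TensorAlgebra.lift ℂ g t := by
  have hb : ∀ r s, TensorAlgebra.lift ℂ g (β.bracket r s) = g (l r s) + c r s • 1 := fun r s => by
    rw [hβ, map_add, AlgHom.commutes, TensorAlgebra.lift_ι_apply, Algebra.algebraMap_eq_smul_one]
  cases h with
  | even_even a b =>
    rw [hb, ← h₀₀, map_sub, map_mul, map_mul, TensorAlgebra.lift_ι_apply,
      TensorAlgebra.lift_ι_apply]
  | even_odd a b =>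
    rw [hb, ← h₀₁, map_sub, map_mul, map_mul, TensorAlgebra.lift_ι_apply,
      TensorAlgebra.lift_ι_apply]
  | odd_even a b =>
    rw [hb, ← h₁₀, map_sub, map_mul, map_mul, TensorAlgebra.lift_ι_apply,
      TensorAlgebra.lift_ι_apply]
  | odd_odd a b =>
    rw [hb, ← h₁₁, map_add, map_mul, map_mul, TensorAlgebra.lift_ι_apply,
      TensorAlgebra.lift_ι_apply]

/-- The element `a + (f | a)` of `U(𝔤)`. -/
def GoodPair.ubar {𝔤 : Type*} [LieRing 𝔤] [LieAlgebra ℂ 𝔤] (P : GoodPair 𝔤) :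
    𝔤 →ₗ[ℂ] UniversalEnvelopingAlgebra ℂ 𝔤 :=
  (UniversalEnvelopingAlgebra.ι ℂ : 𝔤 →ₗ⁅ℂ⁆ UniversalEnvelopingAlgebra ℂ 𝔤).toLinearMap +
    Algebra.linearMap ℂ _ ∘ₗ P.form P.f

theorem GoodPair.ubar_apply {𝔤 : Type*} [LieRing 𝔤] [LieAlgebra ℂ 𝔤] (P : GoodPair 𝔤) (a : 𝔤) :
    P.ubar a = UniversalEnvelopingAlgebra.ι ℂ a + algebraMap ℂ _ (P.form P.f a) := rfl

namespace IsotropicSubspace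

variable {𝔤 : Type*} [LieRing 𝔤] [LieAlgebra ℂ 𝔤] {P : GoodPair 𝔤} (L : IsotropicSubspace P)

/-! ### Right multiplications on `M⁰` -/

theorem cls_mul_ι (A : UniversalEnvelopingAlgebra ℂ 𝔤) (y : L.m) :
    L.cls (A * UniversalEnvelopingAlgebra.ι ℂ (y : 𝔤)) = -P.form P.f (y : 𝔤) • L.cls A := by
  have h := L.cls_mul_iUm A (UniversalEnvelopingAlgebra.ι ℂ y)
  rw [iUm_ι] at h
  rw [h, rhoChi_ι, negChi_apply, ← smul_eq_mul, TensorProduct.tmul_smul]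
  rfl

section

variable {V : Type*} [AddCommGroup V] [Module ℂ V]
  (ρ : UniversalEnvelopingAlgebra ℂ 𝔤 →ₐ[ℂ] Module.End ℂ V) {w : V}
  (hw : ∀ y : L.m, ρ (UniversalEnvelopingAlgebra.ι ℂ (y : 𝔤)) w = -P.form P.f (y : 𝔤) • w)

include hw in
theorem rep_iUm_smul (u : UniversalEnvelopingAlgebra ℂ L.m) (z : ℂ) :
    ρ (L.iUm u) (z • w) = L.rhoChi u z • w := by
  let S : Subalgebra ℂ (UniversalEnvelopingAlgebra ℂ L.m) :=
    { carrier := {u | ∀ z : ℂ, ρ (L.iUm u) (z • w) = L.rhoChi u z • w}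
      mul_mem' := by
        intro a b ha hb z
        rw [map_mul L.iUm, map_mul ρ, Module.End.mul_apply, hb, ha, map_mul L.rhoChi,
          Module.End.mul_apply]
      add_mem' := by
        intro a b ha hb z
        rw [map_add, map_add, LinearMap.add_apply, hb, ha, map_add, LinearMap.add_apply, add_smul]
      algebraMap_mem' := fun r z => by
        rw [AlgHom.commutes, AlgHom.commutes, AlgHom.commutes, Module.algebraMap_end_apply,
          Module.algebraMap_end_apply, smul_assoc] }
  have hS : u ∈ S := by
    refine mem_of_ι_mem S (fun y z => ?_) u
    rw [iUm_ι, rhoChi_ι, negChi_apply, map_smul, hw, smul_smul, mul_comm]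
  exact hS z

variable (w) in
/-- The map `A ⊗ z ↦ ρ(A) z w`. -/
def evalTensor : UniversalEnvelopingAlgebra ℂ 𝔤 ⊗[ℂ] ℂ →ₗ[ℂ] V :=
  (LinearMap.applyₗ w ∘ₗ ρ.toLinearMap) ∘ₗ
    (TensorProduct.rid ℂ (UniversalEnvelopingAlgebra ℂ 𝔤)).toLinearMap

theorem evalTensor_tmul (A : UniversalEnvelopingAlgebra ℂ 𝔤) (z : ℂ) :
    evalTensor ρ w (A ⊗ₜ z) = ρ A (z • w) := by
  change ρ (z • A) w = _
  rw [map_smul, map_smul, LinearMap.smul_apply]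

theorem evalTensor_smul (A : UniversalEnvelopingAlgebra ℂ 𝔤)
    (t : UniversalEnvelopingAlgebra ℂ 𝔤 ⊗[ℂ] ℂ) :
    evalTensor ρ w (A • t) = ρ A (evalTensor ρ w t) := by
  induction t using TensorProduct.induction_on with
  | zero => rw [smul_zero, map_zero, map_zero]
  | tmul B z =>
    rw [TensorProduct.smul_tmul', smul_eq_mul, evalTensor_tmul, evalTensor_tmul, map_mul,
      Module.End.mul_apply]
  | add s t hs ht => rw [smul_add, map_add, map_add, map_add, hs, ht]

include hw in
theorem evalTensor_eq_zero {t : UniversalEnvelopingAlgebra ℂ 𝔤 ⊗[ℂ] ℂ}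
    (ht : t ∈ indRel L.iUm L.rhoChi) : evalTensor ρ w t = 0 := by
  induction ht using Submodule.span_induction with
  | mem t ht =>
    obtain ⟨a, u, v, rfl⟩ := ht
    rw [map_sub, evalTensor_tmul, evalTensor_tmul, map_mul, Module.End.mul_apply,
      L.rep_iUm_smul ρ hw, sub_self]
  | zero => exact map_zero _
  | add s t _ _ hs ht => rw [map_add, hs, ht, add_zero]
  | smul A t ht h => rw [evalTensor_smul, h, map_zero]

/-- For a vector `w` of weight `-χ` for `𝔪`, the linear map on `M⁰` with `A ⊗ 1 ↦ ρ(A) w`. -/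
def mulVec : L.M0 →ₗ[ℂ] V :=
  ((indRel L.iUm L.rhoChi).restrictScalars ℂ).liftQ (evalTensor ρ w)
    (fun _ ht => L.evalTensor_eq_zero ρ hw ht) ∘ₗ
    (Submodule.Quotient.restrictScalarsEquiv ℂ (indRel L.iUm L.rhoChi)).symm.toLinearMap

theorem mulVec_cls (A : UniversalEnvelopingAlgebra ℂ 𝔤) : L.mulVec ρ hw (L.cls A) = ρ A w :=
  (evalTensor_tmul ρ A 1).trans (by rw [one_smul])

end

theorem cls_mul_ubar (A : UniversalEnvelopingAlgebra ℂ 𝔤) (y : L.m) :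
    L.cls (A * P.ubar y) = 0 := by
  rw [P.ubar_apply, mul_add, map_add, cls_mul_ι, ← Algebra.commutes, ← Algebra.smul_def,
    ← neg_add_cancel (P.form P.f (y : 𝔤) • L.cls A)]
  rw [neg_smul]
  rfl

/-- Since `[𝔫, 𝔪] ⊆ 𝔪` and `f` is orthogonal to `[𝔫, 𝔪]`, the vector has weight `-χ` for `𝔪`. This
makes right multiplication by `a + (f | a)` well defined on `M⁰`. -/
theorem ι_smul_cls_ubar (a : L.n) (y : L.m) :
    UniversalEnvelopingAlgebra.ι ℂ (y : 𝔤) • L.cls (P.ubar a) =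
      -P.form P.f (y : 𝔤) • L.cls (P.ubar a) := by
  have h1 : UniversalEnvelopingAlgebra.ι ℂ (y : 𝔤) * P.ubar a =
      P.ubar a * UniversalEnvelopingAlgebra.ι ℂ (y : 𝔤) -
        1 * UniversalEnvelopingAlgebra.ι ℂ ⁅(a : 𝔤), (y : 𝔤)⁆ := by
    rw [LieHom.map_lie, LieRing.of_associative_ring_bracket, P.ubar_apply, mul_add, add_mul,
      Algebra.commutes]
    noncomm_ring
  have h2 := L.cls_mul_ι 1 ⟨_, L.lie_n_m a.2 y.2⟩
  rw [L.form_lie_n_m a.2 y.2, neg_zero, zero_smul] at h2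
  rw [← map_smul, smul_eq_mul, h1, map_sub, cls_mul_ι, h2, sub_zero]

/-- The operator `A ⊗ 1 ↦ A (a + (f | a)) ⊗ 1` on `M⁰`, for `a ∈ 𝔫`. -/
def rightMul (a : L.n) : Module.End ℂ L.M0 :=
  L.mulVec (Algebra.lsmul ℂ ℂ L.M0) (w := L.cls (P.ubar a)) (L.ι_smul_cls_ubar a)

theorem rightMul_cls (a : L.n) (A : UniversalEnvelopingAlgebra ℂ 𝔤) :
    L.rightMul a (L.cls A) = L.cls (A * P.ubar a) := by
  rw [← smul_eq_mul, map_smul]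
  exact L.mulVec_cls _ _ A

/-- The operators `A ⊗ 1 ↦ A (a + (f | a)) ⊗ 1` on `M⁰`, as a linear function of `a ∈ 𝔫`. -/
def rightOp : L.n →ₗ[ℂ] Module.End ℂ L.M0 where
  toFun := L.rightMul
  map_add' a b := LinearMap.ext fun w => by
    obtain ⟨A, rfl⟩ := L.cls_surjective w
    have h : P.ubar ((a + b : L.n) : 𝔤) = P.ubar a + P.ubar b := P.ubar.map_add a b
    rw [LinearMap.add_apply, rightMul_cls, rightMul_cls, rightMul_cls, h, mul_add, map_add]
  map_smul' c a := LinearMap.ext fun w => by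
    obtain ⟨A, rfl⟩ := L.cls_surjective w
    have h : P.ubar ((c • a : L.n) : 𝔤) = c • P.ubar a := P.ubar.map_smul c a
    rw [RingHom.id_apply, LinearMap.smul_apply, rightMul_cls, rightMul_cls, h, mul_smul_comm]
    exact (L.cls.restrictScalars ℂ).map_smul c _

theorem rightOp_cls (a : L.n) (A : UniversalEnvelopingAlgebra ℂ 𝔤) :
    L.rightOp a (L.cls A) = L.cls (A * P.ubar a) := L.rightMul_cls a A

theorem rightOp_smul (a : L.n) (A : UniversalEnvelopingAlgebra ℂ 𝔤) (w : L.M0) :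
    L.rightOp a (A • w) = A • L.rightOp a w := by
  obtain ⟨B, rfl⟩ := L.cls_surjective w
  rw [← map_smul, rightOp_cls, rightOp_cls, ← map_smul, smul_eq_mul, smul_eq_mul, mul_assoc]

theorem rightOp_eq_zero {a : L.n} (ha : (a : 𝔤) ∈ L.m) : L.rightOp a = 0 := by
  refine LinearMap.ext fun w => ?_
  obtain ⟨A, rfl⟩ := L.cls_surjective w
  rw [rightOp_cls]
  exact L.cls_mul_ubar A ⟨a, ha⟩

/-- Right multiplications compose in reverse order, and the commutator `[a, b]` lies in `𝔪`, where
it acts by `-(f | [a, b])`; the two signs cancel. -/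
theorem rightOp_rightOp (a b : L.n) (w : L.M0) : L.rightOp a (L.rightOp b w) =
    L.rightOp b (L.rightOp a w) + P.form P.f ⁅(a : 𝔤), (b : 𝔤)⁆ • w := by
  obtain ⟨A, rfl⟩ := L.cls_surjective w
  have h1 : A * P.ubar b * P.ubar a = A * P.ubar a * P.ubar b -
      A * UniversalEnvelopingAlgebra.ι ℂ ⁅(a : 𝔤), (b : 𝔤)⁆ := by
    rw [LieHom.map_lie, LieRing.of_associative_ring_bracket, mul_assoc, mul_assoc, ← mul_sub]
    congr 1
    have := sub_mul_algebraMap (UniversalEnvelopingAlgebra.ι ℂ (a : 𝔤))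
      (UniversalEnvelopingAlgebra.ι ℂ (b : 𝔤)) (P.form P.f a) (P.form P.f b)
    rw [← this, P.ubar_apply, P.ubar_apply, sub_sub_cancel]
  have hm : ⁅(a : 𝔤), (b : 𝔤)⁆ ∈ L.m :=
    Submodule.mem_sup_right (lie_mem_sup L.perp_le_gr L.perp_le_gr a.2 b.2)
  rw [rightOp_cls, rightOp_cls, rightOp_cls, rightOp_cls, h1, map_sub, L.cls_mul_ι A ⟨_, hm⟩,
    neg_smul, sub_neg_eq_add]

/-- The operators `A ⊗ 1 ↦ -A (a + (f | a)) ⊗ 1` on `M⁰`, for `[a] ∈ 𝔩^⊥/𝔩`. -/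
def neOp : L.Ne →ₗ[ℂ] Module.End ℂ L.M0 :=
  Submodule.liftQ _
    -- With the minus sign `a + (f | a) + Φ_[a]` kills the vacuum. The bracket of two `Φ` is
    -- quadratic and does not see it.
    (-L.rightOp ∘ₗ Submodule.inclusion (show L.perp ≤ L.n.toSubmodule from le_sup_left))
    (fun b hb => by
      have h : L.rightOp (Submodule.inclusion (show L.perp ≤ L.n.toSubmodule from le_sup_left) b) =
          0 := L.rightOp_eq_zero (Submodule.mem_sup_left hb)
      change -L.rightOp _ = 0
      rw [h, neg_zero])

theorem neOp_toNe (a : L.n) : L.neOp (L.toNe a) = -L.rightOp a := by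
  obtain ⟨b, hb, c, hc, h⟩ := Submodule.mem_sup.mp (L.mem_n.mp a.2)
  have hb' : b - a ∈ P.ge 2 := by
    rw [← h]
    simpa using hc
  rw [L.toNe_eq_mk (b := ⟨b, hb⟩) hb', neOp, Submodule.liftQ_apply]
  change -L.rightOp ⟨b, _⟩ = _
  rw [neg_inj, ← sub_eq_zero, ← map_sub]
  exact L.rightOp_eq_zero (Submodule.mem_sup_right hb')

theorem neOp_smul (v : L.Ne) (A : UniversalEnvelopingAlgebra ℂ 𝔤) (w : L.M0) :
    L.neOp v (A • w) = A • L.neOp v w := by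
  obtain ⟨a, rfl⟩ := toNe_surjective L v
  rw [neOp_toNe, LinearMap.neg_apply, LinearMap.neg_apply, rightOp_smul, smul_neg]

theorem neOp_neOp (v v' : L.Ne) (w : L.M0) :
    L.neOp v (L.neOp v' w) = L.neOp v' (L.neOp v w) + L.neForm v v' • w := by
  obtain ⟨a, rfl⟩ := toNe_surjective L v
  obtain ⟨b, rfl⟩ := toNe_surjective L v'
  simp only [neOp_toNe, LinearMap.neg_apply, map_neg, neg_neg, neForm_toNe]
  exact L.rightOp_rightOp a b w

/-! ### The representation of `C^I` on `Hom(Λ(𝔫), M⁰)` -/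

/-- The space `Hom(Λ(𝔫), M⁰)`. -/
abbrev Forms : Type _ := ExteriorAlgebra ℂ L.n →ₗ[ℂ] L.M0

/-- The linear map underlying the action of the generators of `C^I` on `Hom(Λ(𝔫), M⁰)`. -/
def formsMap : L.R →ₗ[ℂ] Module.End ℂ L.Forms :=
  LinearMap.coprod
    (LinearMap.llcomp ℂ (ExteriorAlgebra ℂ L.n) L.M0 L.M0 ∘ₗ
      LinearMap.coprod ((Algebra.lsmul ℂ ℂ L.M0).toLinearMap ∘ₗ
        (UniversalEnvelopingAlgebra.ι ℂ : 𝔤 →ₗ⁅ℂ⁆ UniversalEnvelopingAlgebra ℂ 𝔤).toLinearMap) L.neOp)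
    -- The odd generators act by precomposition: `φ^ψ` through contraction with `ψ`, `φ_a` through
    -- left multiplication by `a` in `Λ(𝔫)`.
    ((LinearMap.llcomp ℂ (ExteriorAlgebra ℂ L.n) (ExteriorAlgebra ℂ L.n) L.M0).flip ∘ₗ
      LinearMap.coprod (CliffordAlgebra.contractLeft (Q := (0 : QuadraticForm ℂ L.n)))
        (LinearMap.mul ℂ (ExteriorAlgebra ℂ L.n) ∘ₗ ExteriorAlgebra.ι ℂ))

theorem formsMap_apply (r : L.R) (s : L.Forms) (x : ExteriorAlgebra ℂ L.n) :
    L.formsMap r s x = UniversalEnvelopingAlgebra.ι ℂ r.1.1 • s x + L.neOp r.1.2 (s x) +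
      s (CliffordAlgebra.contractLeft r.2.1 x + ExteriorAlgebra.ι ℂ r.2.2 * x) := rfl

theorem formsMap_even (a : L.REven) (s : L.Forms) (x : ExteriorAlgebra ℂ L.n) :
    L.formsMap (a, 0) s x = UniversalEnvelopingAlgebra.ι ℂ a.1 • s x + L.neOp a.2 (s x) := by
  rw [formsMap_apply]
  simp only [Prod.fst_zero, Prod.snd_zero, map_zero, LinearMap.zero_apply, zero_mul, add_zero]

theorem formsMap_odd (a : L.ROdd) (s : L.Forms) (x : ExteriorAlgebra ℂ L.n) :
    L.formsMap (0, a) s x = s (CliffordAlgebra.contractLeft a.1 x + ExteriorAlgebra.ι ℂ a.2 * x) := by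
  rw [formsMap_apply]
  simp only [Prod.fst_zero, Prod.snd_zero, map_zero, LinearMap.zero_apply, zero_smul, zero_add]

/-- The algebra of endomorphisms of `Hom(Λ(𝔫), M⁰)`. -/
def FormsEnd : Type _ := Module.End ℂ L.Forms

instance : Ring L.FormsEnd := inferInstanceAs (Ring (Module.End ℂ L.Forms))

instance : Algebra ℂ L.FormsEnd := inferInstanceAs (Algebra ℂ (Module.End ℂ L.Forms))

/-- The action of an endomorphism. -/
def act : L.FormsEnd →ₗ[ℂ] L.Forms →ₗ[ℂ] L.Forms :=
  (LinearMap.id : Module.End ℂ L.Forms →ₗ[ℂ] Module.End ℂ L.Forms)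

theorem act_mul (g h : L.FormsEnd) (s : L.Forms) : L.act (g * h) s = L.act g (L.act h s) := rfl

theorem act_one (s : L.Forms) : L.act 1 s = s := rfl

theorem act_ext {g h : L.FormsEnd} (H : ∀ s x, L.act g s x = L.act h s x) : g = h :=
  LinearMap.ext fun s => LinearMap.ext fun x => H s x

/-- The action of the generators of `C^I` on `Hom(Λ(𝔫), M⁰)`. -/
def formsGen : L.R →ₗ[ℂ] L.FormsEnd := L.formsMap

theorem act_formsGen_even (a : L.REven) (s : L.Forms) (x : ExteriorAlgebra ℂ L.n) :
    L.act (L.formsGen (a, 0)) s x =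
      UniversalEnvelopingAlgebra.ι ℂ a.1 • s x + L.neOp a.2 (s x) := L.formsMap_even a s x

theorem act_formsGen_odd (a : L.ROdd) (s : L.Forms) (x : ExteriorAlgebra ℂ L.n) :
    L.act (L.formsGen (0, a)) s x =
      s (CliffordAlgebra.contractLeft a.1 x + ExteriorAlgebra.ι ℂ a.2 * x) := L.formsMap_odd a s x

theorem formsGen_even_even (a b : L.REven) :
    L.formsGen (a, 0) * L.formsGen (b, 0) - L.formsGen (b, 0) * L.formsGen (a, 0) =
      L.formsGen (L.lieBracket (a, 0) (b, 0)) + L.scalarBracket (a, 0) (b, 0) • 1 := by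
  have h1 : L.lieBracket (a, 0) (b, 0) = ((⁅a.1, b.1⁆, 0), 0) := rfl
  have h2 : L.scalarBracket (a, 0) (b, 0) = L.neForm a.2 b.2 := by simp [scalarBracket]
  refine L.act_ext fun s x => ?_
  rw [h1, h2]
  simp only [map_sub, map_add, map_smul, act_mul, act_one, LinearMap.sub_apply,
    LinearMap.add_apply, LinearMap.smul_apply, act_formsGen_even, smul_add, map_zero, LinearMap.zero_apply,
    neOp_smul]
  rw [L.neOp_neOp a.2 b.2, LieHom.map_lie, LieRing.of_associative_ring_bracket, sub_smul, mul_smul,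
    mul_smul]
  abel

theorem formsGen_even_odd (a : L.REven) (b : L.ROdd) :
    L.formsGen (a, 0) * L.formsGen (0, b) - L.formsGen (0, b) * L.formsGen (a, 0) = 0 := by
  refine L.act_ext fun s x => ?_
  rw [map_sub, LinearMap.sub_apply, LinearMap.sub_apply, act_mul, act_mul, act_formsGen_even,
    act_formsGen_odd, act_formsGen_odd, act_formsGen_even, sub_self, map_zero]
  rfl

/-- Precomposition reverses products, but an anticommutator is symmetric, so the Clifford relation
between contraction and exterior multiplication carries over. -/
theorem formsGen_odd_odd (a b : L.ROdd) :
    L.formsGen (0, a) * L.formsGen (0, b) + L.formsGen (0, b) * L.formsGen (0, a) =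
      L.scalarBracket (0, a) (0, b) • 1 := by
  have h2 : L.scalarBracket (0, a) (0, b) = a.1 b.2 + b.1 a.2 := by simp [scalarBracket]
  refine L.act_ext fun s x => ?_
  rw [h2]
  have h3 : ExteriorAlgebra.ι ℂ b.2 * (ExteriorAlgebra.ι ℂ a.2 * x) =
      -(ExteriorAlgebra.ι ℂ a.2 * (ExteriorAlgebra.ι ℂ b.2 * x)) := by
    rw [← mul_assoc, ← mul_assoc, ← neg_mul]
    congr 1
    exact eq_neg_of_add_eq_zero_left (ExteriorAlgebra.ι_add_mul_swap b.2 a.2)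
  have h4 : ∀ (p : Module.Dual ℂ L.n) (c : L.n) (y : ExteriorAlgebra ℂ L.n),
      CliffordAlgebra.contractLeft p (ExteriorAlgebra.ι ℂ c * y) =
        p c • y - ExteriorAlgebra.ι ℂ c * CliffordAlgebra.contractLeft p y := fun p c y =>
    CliffordAlgebra.contractLeft_ι_mul (Q := (0 : QuadraticForm ℂ L.n)) (d := p) c y
  have h5 : CliffordAlgebra.contractLeft b.1 (CliffordAlgebra.contractLeft a.1 x) =
      -CliffordAlgebra.contractLeft a.1 (CliffordAlgebra.contractLeft b.1 x) :=
    CliffordAlgebra.contractLeft_comm (Q := (0 : QuadraticForm ℂ L.n)) (d := b.1) a.1 x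
  rw [map_add, LinearMap.add_apply, LinearMap.add_apply, act_mul, act_mul, act_formsGen_odd,
    act_formsGen_odd, act_formsGen_odd, act_formsGen_odd, map_smul, LinearMap.smul_apply,
    LinearMap.smul_apply, act_one, ← map_add, ← map_smul]
  congr 1
  simp only [map_add, mul_add, h4, h3, h5]
  module

theorem formsGen_rel ⦃s t : TensorAlgebra ℂ L.R⦄ (h : L.rBracket.Rel s t) :
    TensorAlgebra.lift ℂ L.formsGen s = TensorAlgebra.lift ℂ L.formsGen t := by
  refine L.rBracket.lift_eq_of_rel (B := L.FormsEnd) L.formsGen L.lieBracket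
    L.scalarBracket (fun _ _ => rfl) L.formsGen_even_even (fun a b => ?_) (fun a b => ?_)
    (fun a b => ?_) h
  · rw [lieBracket_odd, map_zero, show L.scalarBracket (a, 0) (0, b) = 0 by simp [scalarBracket],
      zero_smul, add_zero]
    exact L.formsGen_even_odd a b
  · rw [show L.lieBracket (0, a) (b, 0) = 0 by simp [lieBracket], map_zero,
      show L.scalarBracket (0, a) (b, 0) = 0 by simp [scalarBracket], zero_smul, add_zero]
    exact sub_eq_zero.mpr (sub_eq_zero.mp (L.formsGen_even_odd b a)).symm
  · rw [lieBracket_odd, map_zero, zero_add]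
    exact L.formsGen_odd_odd a b

/-- The representation of `C^I` on `Hom(Λ(𝔫), M⁰)`. -/
def formsRep : L.CI →ₐ[ℂ] L.FormsEnd :=
  L.rBracket.lift (B := L.FormsEnd) (TensorAlgebra.lift ℂ L.formsGen)
    L.formsGen_rel

theorem formsRep_ι (r : L.R) : L.formsRep (L.rBracket.ι r) = L.formsGen r :=
  (L.rBracket.lift_proj (B := L.FormsEnd) (TensorAlgebra.lift ℂ L.formsGen) L.formsGen_rel _).trans
    (TensorAlgebra.lift_ι_apply _ _)

theorem formsRep_genG (b : 𝔤) (s : L.Forms) (x : ExteriorAlgebra ℂ L.n) :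
    L.act (L.formsRep (L.genG b)) s x = UniversalEnvelopingAlgebra.ι ℂ b • s x := by
  change L.act (L.formsRep (L.rBracket.ι ((b, 0), 0))) s x = _
  rw [formsRep_ι, act_formsGen_even, map_zero, LinearMap.zero_apply, add_zero]

theorem formsRep_genNe (v : L.Ne) (s : L.Forms) (x : ExteriorAlgebra ℂ L.n) :
    L.act (L.formsRep (L.genNe v)) s x = L.neOp v (s x) := by
  change L.act (L.formsRep (L.rBracket.ι ((0, v), 0))) s x = _
  rw [formsRep_ι, act_formsGen_even, map_zero, zero_smul, zero_add]

theorem formsRep_genUp (p : Module.Dual ℂ L.n) (s : L.Forms) (x : ExteriorAlgebra ℂ L.n) :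
    L.act (L.formsRep (L.genUp p)) s x = s (CliffordAlgebra.contractLeft p x) := by
  change L.act (L.formsRep (L.rBracket.ι (0, (p, 0)))) s x = _
  rw [formsRep_ι, act_formsGen_odd, map_zero, zero_mul, add_zero]

theorem formsRep_genDown (a : L.n) (s : L.Forms) (x : ExteriorAlgebra ℂ L.n) :
    L.act (L.formsRep (L.genDown a)) s x = s (ExteriorAlgebra.ι ℂ a * x) := by
  change L.act (L.formsRep (L.rBracket.ι (0, (0, a)))) s x = _
  rw [formsRep_ι, act_formsGen_odd, map_zero, LinearMap.zero_apply, zero_add]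

/-- The vacuum vector of `Hom(Λ(𝔫), M⁰)`. -/
def formsVac : L.Forms :=
  (LinearMap.toSpanSingleton ℂ L.M0 (L.cls 1)) ∘ₗ ExteriorAlgebra.algebraMapInv.toLinearMap

theorem formsVac_apply (x : ExteriorAlgebra ℂ L.n) :
    L.formsVac x = ExteriorAlgebra.algebraMapInv x • L.cls 1 := rfl

/-- The projection `C^I → M⁰` that annihilates the vacuum ideal and `φ^ψ C^I`. -/
def pr : L.CI →ₗ[ℂ] L.M0 :=
  LinearMap.applyₗ (1 : ExteriorAlgebra ℂ L.n) ∘ₗ LinearMap.applyₗ L.formsVac ∘ₗ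
    L.act ∘ₗ L.formsRep.toLinearMap

theorem pr_apply (A : L.CI) : L.pr A = L.act (L.formsRep A) L.formsVac 1 := rfl

theorem formsRep_genDown_formsVac (a : L.n) : L.act (L.formsRep (L.genDown a)) L.formsVac = 0 := by
  refine LinearMap.ext fun x => ?_
  have h : ExteriorAlgebra.algebraMapInv (ExteriorAlgebra.ι ℂ a * x) = (0 : ℂ) := by
    rw [map_mul]
    simp [ExteriorAlgebra.algebraMapInv]
  rw [formsRep_genDown, formsVac_apply, h, zero_smul]
  rfl

/-- Applied to the class of `1`, left multiplication by `a + (f | a)` and `Φ_[a]`, minus right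
multiplication by the same element, cancel. -/
theorem formsRep_X_formsVac (a : L.n) : L.act (L.formsRep (L.X a)) L.formsVac = 0 := by
  refine LinearMap.ext fun x => ?_
  rw [X_def, map_add, map_add, map_add, map_add, AlgHom.commutes, Algebra.algebraMap_eq_smul_one,
    map_smul]
  simp only [LinearMap.add_apply, LinearMap.smul_apply, act_one, formsRep_genG, formsRep_genNe,
    formsVac_apply, map_smul, neOp_toNe, LinearMap.neg_apply, rightOp_cls, one_mul]
  rw [P.ubar_apply, map_add, Algebra.algebraMap_eq_smul_one]
  have h1 : L.cls (P.form P.f (a : 𝔤) • 1) = P.form P.f (a : 𝔤) • L.cls 1 :=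
    (L.cls.restrictScalars ℂ).map_smul _ _
  have h2 : L.cls (UniversalEnvelopingAlgebra.ι ℂ (a : 𝔤)) =
      UniversalEnvelopingAlgebra.ι ℂ (a : 𝔤) • L.cls 1 := by
    rw [← map_smul, smul_eq_mul, mul_one]
  rw [h1, h2, smul_comm, smul_comm (P.form P.f (a : 𝔤)), ← smul_add, smul_neg, add_neg_cancel]
  rfl

theorem pr_eq_zero {A : L.CI} (hA : A ∈ L.vacIdeal) : L.pr A = 0 := by
  have h : L.act (L.formsRep A) L.formsVac = 0 := by
    refine Submodule.span_induction (p := fun A _ => L.act (L.formsRep A) L.formsVac = 0) ?_ ?_ ?_ ?_ hA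
    · intro y hy
      obtain ⟨a, rfl⟩ | ⟨a, rfl⟩ := hy
      · exact L.formsRep_X_formsVac a
      · exact L.formsRep_genDown_formsVac a
    · rw [map_zero]; rfl
    · intro x y _ _ hx hy
      rw [map_add, map_add, LinearMap.add_apply, hx, hy, add_zero]
    · intro c x _ hx
      rw [smul_eq_mul, map_mul, act_mul, hx, map_zero]
  rw [pr_apply, h]
  rfl

/-- `pr` evaluates a form at `1 ∈ Λ(𝔫)`, and every contraction of `1` vanishes. -/
theorem pr_genUp_mul (p : Module.Dual ℂ L.n) (A : L.CI) : L.pr (L.genUp p * A) = 0 := by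
  rw [pr_apply, map_mul, act_mul, formsRep_genUp]
  exact (congrArg _ (CliffordAlgebra.contractLeft_one (Q := (0 : QuadraticForm ℂ L.n)) p)).trans
    (map_zero _)

theorem pr_genU_mul (B : UniversalEnvelopingAlgebra ℂ 𝔤) (A : L.CI) :
    L.pr (L.genU B * A) = B • L.pr A := by
  let S : Subalgebra ℂ (UniversalEnvelopingAlgebra ℂ 𝔤) :=
    { carrier := {B | ∀ A, L.pr (L.genU B * A) = B • L.pr A}
      mul_mem' := fun {B C} hB hC A => by rw [map_mul L.genU, mul_assoc, hB, hC, mul_smul]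
      add_mem' := fun {B C} hB hC A => by rw [map_add, add_mul, map_add, hB, hC, add_smul]
      algebraMap_mem' := fun r A => by
        rw [AlgHom.commutes, ← Algebra.smul_def, map_smul, algebraMap_smul] }
  refine mem_of_ι_mem S (fun b A => ?_) B A
  rw [genU_ι, pr_apply, map_mul, act_mul, formsRep_genG, pr_apply]

theorem pr_genU (B : UniversalEnvelopingAlgebra ℂ 𝔤) : L.pr (L.genU B) = L.cls B := by
  have h1 : L.pr 1 = L.cls 1 := by
    rw [pr_apply, map_one L.formsRep, act_one, formsVac_apply,
      map_one ExteriorAlgebra.algebraMapInv, one_smul]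
  rw [← mul_one (L.genU B), pr_genU_mul, h1, ← map_smul, smul_eq_mul, mul_one]

/-- Every term of `d` begins with some `φ^α`. -/
theorem pr_dI_mul {ι : Type*} [Fintype ι] (u : Module.Basis ι ℂ L.n) (A : L.CI) :
    L.pr (L.dI u * A) = 0 := by
  rw [dI_eq, add_mul, smul_mul_assoc, map_add, map_smul, Finset.sum_mul, Finset.sum_mul, map_sum,
    map_sum]
  simp only [mul_assoc, pr_genUp_mul, Finset.sum_const_zero, smul_zero, add_zero]

theorem genU_ι_smul_vac (y : L.m) :
    L.genU (UniversalEnvelopingAlgebra.ι ℂ (y : 𝔤)) • L.vac = -P.form P.f (y : 𝔤) • L.vac := by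
  have h0 : L.toNe ⟨y, L.m_le_n y.2⟩ = 0 := by
    have : (Submodule.Quotient.mk ⟨(y : 𝔤), L.m_le_n y.2⟩ : L.NModM) = 0 :=
      (Submodule.Quotient.mk_eq_zero (L.m.toSubmodule.comap L.n.toSubmodule.subtype)).mpr y.2
    change L.neEquiv.symm (Submodule.Quotient.mk _) = 0
    rw [this, map_zero]
  have h := L.X_smul_vac ⟨y, L.m_le_n y.2⟩
  rw [X_def, h0, map_zero, add_zero, add_smul, algebraMap_smul] at h
  rw [genU_ι, neg_smul]
  exact eq_neg_of_add_eq_zero_left h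

/-- One direction applies `pr`. The other is the universal property of `M⁰`, as the vacuum has
weight `-χ` for `𝔪`. Together they embed `M⁰` in the vacuum module. -/
theorem genU_mem_vacIdeal {B : UniversalEnvelopingAlgebra ℂ 𝔤} :
    L.genU B ∈ L.vacIdeal ↔ L.cls B = 0 := by
  refine ⟨fun h => by rw [← pr_genU, L.pr_eq_zero h], fun h => ?_⟩
  have h2 := L.mulVec_cls ((Algebra.lsmul ℂ ℂ L.VacModule).comp L.genU) (w := L.vac)
    L.genU_ι_smul_vac B
  rw [h, map_zero] at h2
  exact L.smul_vac_eq_zero.mp h2.symm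

end IsotropicSubspace


namespace IsotropicSubspace

variable {𝔤 : Type*} [LieRing 𝔤] [LieAlgebra ℂ 𝔤] {P : GoodPair 𝔤} (L : IsotropicSubspace P)

/-! ### The isomorphism of the two `W`-algebras -/

theorem htpy_mem_vacIdeal (μ : Module.End ℂ 𝔤 →ₗ[ℂ] L.n) (A : L.CI) :
    L.htpy μ A ∈ L.vacIdeal := by
  rw [htpy_apply]
  generalize L.coact (L.rBracket.σ A) = t
  induction t using L.CIEnd_induction with
  | h0 => rw [map_zero]; exact zero_mem _
  | htmul B g =>
    rw [contr_tmul]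
    exact Submodule.smul_mem _ B (Submodule.subset_span (genDown_mem_tails _))
  | hadd s t hs ht => rw [map_add]; exact add_mem hs ht

/-- The vacuum ideal is only a left ideal. Stability under right multiplication by invariants is
what allows `pr` to respect products. -/
theorem mul_genU_mem_vacIdeal {A : L.CI} (hA : A ∈ L.vacIdeal)
    {B : UniversalEnvelopingAlgebra ℂ 𝔤} (hB : L.cls B ∈ L.WII) :
    A * L.genU B ∈ L.vacIdeal := by
  refine Submodule.span_induction (p := fun A _ => A * L.genU B ∈ L.vacIdeal) ?_ ?_ ?_ ?_ hA
  · intro y hy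
    obtain ⟨a, rfl⟩ | ⟨a, rfl⟩ := hy
    · rw [X_genU]
      refine add_mem (Submodule.smul_mem _ _ (Submodule.subset_span (X_mem_tails a)))
        (L.genU_mem_vacIdeal.mpr ?_)
      rw [← adM0_cls]
      exact L.mem_WII.mp hB a
    · rw [← genU_genDown]
      exact Submodule.smul_mem _ _ (Submodule.subset_span (genDown_mem_tails a))
  · rw [zero_mul]
    exact zero_mem _
  · intro x y _ _ hx hy
    rw [add_mul]
    exact add_mem hx hy
  · intro c x _ hx
    rw [smul_eq_mul, mul_assoc]
    exact Submodule.smul_mem _ c hx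

section

variable {ι : Type*} [Fintype ι] (u : Module.Basis ι ℂ L.n)

theorem dI_mem_vacIdeal : L.dI u ∈ L.vacIdeal := L.smul_vac_eq_zero.mp (L.dI_smul_vac u)

/-- In `d A - σ(A) d` the first term begins with factors `φ^α`, and the second lies in the vacuum
ideal. -/
theorem pr_D (A : L.CI) : L.pr (L.D u A) = 0 := by
  have h := L.pr_eq_zero (Submodule.smul_mem _ (L.rBracket.σ A) (L.dI_mem_vacIdeal u))
  rw [smul_eq_mul] at h
  rw [D_apply, map_sub, pr_dI_mul, h, sub_zero]

theorem J_eq (a : L.n) : L.J u a = L.dI u * L.genDown a + L.genDown a * L.dI u := by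
  rw [← D_genDown, D_apply, σ_genDown, neg_mul, sub_neg_eq_add]

/-- Anticommuting `d` with `φ_a` yields `J_a`, which acts on `U(𝔤) vac` as the adjoint action of
`a`. Conversely, `d` lies in the vacuum ideal, which invariants preserve from the right. -/
theorem dI_smul_genU_smul_vac {B : UniversalEnvelopingAlgebra ℂ 𝔤} :
    L.dI u • L.genU B • L.vac = 0 ↔ L.cls B ∈ L.WII := by
  constructor
  · intro h
    refine L.mem_WII.mpr fun a => ?_
    have h1 : ∀ a, L.genDown a • L.genU B • L.vac = 0 := fun a => by
      rw [← mul_smul, ← genU_genDown, mul_smul, genDown_smul_vac, smul_zero]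
    have h2 : L.J u a • L.genU B • L.vac = 0 := by
      rw [J_eq, add_smul, mul_smul, mul_smul, h, h1, smul_zero, smul_zero, add_zero]
    have h3 : L.θ u a • L.genU B • L.vac = 0 := by
      rw [theta_apply, Finset.sum_smul]
      exact Finset.sum_eq_zero fun j _ => by rw [mul_smul, h1, smul_zero]
    rw [J_apply, add_smul, h3, add_zero, ← mul_smul, X_genU, add_smul, mul_smul, X_smul_vac,
      smul_zero, zero_add, smul_vac_eq_zero] at h2
    rw [adM0_cls]
    exact L.genU_mem_vacIdeal.mp h2
  · intro h
    rw [← mul_smul, smul_vac_eq_zero]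
    exact L.mul_genU_mem_vacIdeal (L.dI_mem_vacIdeal u) h

theorem pr_cocycle {A : L.CI} {B : UniversalEnvelopingAlgebra ℂ 𝔤} {S : L.CI}
    (h : A - (L.genU B + L.D u S) ∈ L.vacIdeal) : L.pr A = L.cls B := by
  have h1 := L.pr_eq_zero h
  rw [map_sub, map_add, pr_D, add_zero, pr_genU] at h1
  exact sub_eq_zero.mp h1

/-- Acyclicity of the vacuum ideal. The primitive may be taken inside the ideal because every value
of the homotopy ends in a factor `φ`. -/
theorem exists_D_eq [LieAlgebra.IsSimple ℂ 𝔤] {A : L.CI} (hA : A ∈ L.vacIdeal) (hA0 : L.D u A = 0) :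
    ∃ S ∈ L.vacIdeal, A = L.D u S := by
  obtain ⟨π, hπ, μ, hμ1, hμ⟩ := L.exists_functional
  obtain ⟨y, hy⟩ := exists_eq_of_mem_unitTorsion (L.D_D u)
    (vacIdeal_le_unitTorsion u hπ hμ1 hμ hA) hA0
  exact ⟨_, L.htpy_mem_vacIdeal μ y, hy⟩

variable [FiniteDimensional ℂ 𝔤]

/-- Every cocycle is equivalent to an element of `U(𝔤)` modulo coboundaries and the vacuum ideal. -/
theorem exists_genU_of_cocycle {A : L.CI} (hA : L.D u A = 0) : ∃ B S, L.cls B ∈ L.WII ∧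
    A - (L.genU B + L.D u S) ∈ L.vacIdeal := by
  obtain ⟨κ, _, ⟨F⟩⟩ := L.exists_frame
  -- `d` does not depend on the basis, so the homogeneous frame may be used.
  have hz : L.dI F.u • A • L.vac = 0 := by
    rw [L.dI_eq_dI F.u u, ← D_smul_vac, hA, zero_smul]
  obtain ⟨B, y, h⟩ := Frame.exists_genU_smul_vac hz
  rw [L.dI_eq_dI F.u u] at h hz
  obtain ⟨S, rfl⟩ := Submodule.Quotient.mk_surjective _ y
  rw [← smul_vac, ← D_smul_vac] at h
  refine ⟨B, S, (L.dI_smul_genU_smul_vac u).mp ?_, ?_⟩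
  · rw [h, D_smul_vac, smul_add, ← mul_smul (L.dI u) (L.dI u),
      show L.dI u * L.dI u = 0 from (L.differentialI u).d_mul_d, zero_smul, add_zero] at hz
    exact hz
  · rw [← smul_vac_eq_zero, sub_smul, add_smul, h, sub_self]

theorem pr_mem_WII {A : L.CI} (hA : L.D u A = 0) : L.pr A ∈ L.WII := by
  obtain ⟨B, S, hB, h⟩ := L.exists_genU_of_cocycle u hA
  rw [L.pr_cocycle u h]
  exact hB

theorem pr_mul {A A' : L.CI} (hA : L.D u A = 0) (hA' : L.D u A' = 0) :
    L.pr (A * A') = L.mulRight ⟨L.pr A', L.pr_mem_WII u hA'⟩ (L.pr A) := by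
  obtain ⟨B, S, hB, h⟩ := L.exists_genU_of_cocycle u hA
  obtain ⟨B', S', hB', h'⟩ := L.exists_genU_of_cocycle u hA'
  -- The error of `A'` in the vacuum ideal stays there under left multiplication by `A`, and `A · D
  -- S'` is a coboundary because `A` is a cocycle.
  have e1 : L.pr (A * A') = L.pr (A * L.genU B') := by
    have h1 := L.pr_eq_zero (Submodule.smul_mem _ A h')
    have h2 : A * L.D u S' = L.D u (L.rBracket.σ A * S') := by
      rw [D_mul, D_σ, hA, map_zero, neg_zero, zero_mul, zero_add, L.rBracket.σ_σ]
    rw [smul_eq_mul, mul_sub, mul_add, h2, map_sub, map_add, pr_D, add_zero] at h1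
    exact sub_eq_zero.mp h1
  -- Now the errors of `A` are multiplied on the right by `B'`: invariance of `B'` preserves the
  -- ideal, and moving `D` off `S` costs a term with `D B'`, which is in the ideal too.
  have e2 : L.pr (A * L.genU B') = L.pr (L.genU B * L.genU B') := by
    have h1 := L.pr_eq_zero (L.mul_genU_mem_vacIdeal h hB')
    have h2 : L.D u S * L.genU B' =
        L.D u (S * L.genU B') - L.rBracket.σ S * L.D u (L.genU B') := by
      rw [D_mul, add_sub_cancel_right]
    have h3 : L.D u (L.genU B') ∈ L.vacIdeal := by
      rw [← smul_vac_eq_zero, D_smul_vac, dI_smul_genU_smul_vac]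
      exact hB'
    have h4 := L.pr_eq_zero (Submodule.smul_mem _ (L.rBracket.σ S) h3)
    rw [smul_eq_mul] at h4
    rw [sub_mul, add_mul, h2, map_sub, map_add, map_sub, pr_D, h4, sub_zero, add_zero] at h1
    exact sub_eq_zero.mp h1
  rw [e1, e2, ← map_mul, pr_genU, L.pr_cocycle u h, mulRight_cls, Subtype.coe_mk,
    L.pr_cocycle u h', ← map_smul, smul_eq_mul]

/-- The homomorphism from the algebra of cocycles of `C^I` to `W^II`. -/
def cocyclesToWII : (L.differentialI u).cocycles →ₐ[ℂ] L.WII :=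
  AlgHom.ofLinearMap
    ((L.pr ∘ₗ (L.differentialI u).cocycles.val.toLinearMap).codRestrict L.WII
      fun A => L.pr_mem_WII u A.2)
    (Subtype.ext (by
      have h := L.pr_genU 1
      rw [map_one] at h
      exact h))
    (fun A A' => Subtype.ext (L.pr_mul u A.2 A'.2))

theorem coe_cocyclesToWII (A : (L.differentialI u).cocycles) :
    (L.cocyclesToWII u A : L.M0) = L.pr A := rfl

variable [LieAlgebra.IsSimple ℂ 𝔤]

/-- If `pr A = 0`, the representative `B` is itself in the vacuum ideal. Then `A - D S` is a cocycle
in that ideal, hence exact. -/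
theorem cocyclesToWII_eq_zero (A : (L.differentialI u).cocycles) :
    L.cocyclesToWII u A = 0 ↔ A ∈ (L.differentialI u).coboundaries := by
  constructor
  · intro h0
    have h0' : L.pr A = 0 := congrArg Subtype.val h0
    obtain ⟨B, S, hB, h⟩ := L.exists_genU_of_cocycle u A.2
    rw [L.pr_cocycle u h, ← genU_mem_vacIdeal] at h0'
    have h1 : (A : L.CI) - L.D u S ∈ L.vacIdeal := by
      have h2 := add_mem h h0'
      rwa [sub_add_eq_sub_sub_swap, sub_add_cancel] at h2
    obtain ⟨S', -, hS'⟩ := L.exists_D_eq u h1 (by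
      rw [map_sub, D_D, sub_zero]
      exact A.2)
    exact ⟨S + S', by rw [map_add, ← hS', add_sub_cancel]⟩
  · rintro ⟨S, hS⟩
    refine Subtype.ext ?_
    rw [coe_cocyclesToWII, ← hS, pr_D]
    rfl

/-- An invariant `B` is a cocycle only modulo the vacuum ideal. Acyclicity supplies a correction in
the ideal, which `pr` does not see. -/
theorem cocyclesToWII_surjective : Function.Surjective (L.cocyclesToWII u) := by
  rintro ⟨w, hw⟩
  obtain ⟨B, rfl⟩ := L.cls_surjective w
  have h1 : L.D u (L.genU B) ∈ L.vacIdeal := by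
    rw [← smul_vac_eq_zero, D_smul_vac, dI_smul_genU_smul_vac]
    exact hw
  obtain ⟨S, hS, h⟩ := L.exists_D_eq u h1 (L.D_D u _)
  refine ⟨⟨L.genU B - S, ?_⟩, Subtype.ext ?_⟩
  · change L.D u (L.genU B - S) = 0
    rw [map_sub, h, sub_self]
  · rw [coe_cocyclesToWII, map_sub, L.pr_eq_zero hS, sub_zero, pr_genU]

/-- The isomorphism `W^I ≃ W^II`. -/
def equivWII : L.WI u ≃ₐ[ℂ] L.WII :=
  AlgEquiv.ofBijective
    (Ideal.Quotient.liftₐ (L.differentialI u).coboundaries (L.cocyclesToWII u)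
      fun A hA => (L.cocyclesToWII_eq_zero u A).mpr hA) (by
    constructor
    · rw [injective_iff_map_eq_zero]
      intro q hq
      obtain ⟨A, rfl⟩ := Ideal.Quotient.mk_surjective q
      exact Ideal.Quotient.eq_zero_iff_mem.mpr ((L.cocyclesToWII_eq_zero u A).mp hq)
    · intro w
      obtain ⟨A, rfl⟩ := L.cocyclesToWII_surjective u w
      exact ⟨Ideal.Quotient.mk _ A, rfl⟩)

end

end IsotropicSubspace

end FiniteW

end

theorem mainTheorem7 {𝔤 : Type*} [LieRing 𝔤] [LieAlgebra ℂ 𝔤] [FiniteDimensional ℂ 𝔤]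
    [LieAlgebra.IsSimple ℂ 𝔤] (P : FiniteW.GoodPair 𝔤) (L : FiniteW.IsotropicSubspace P)
    {ι : Type*} [Fintype ι] (u : Module.Basis ι ℂ L.n) :
    Nonempty (L.WI u ≃ₐ[ℂ] L.WII) :=
  ⟨L.equivWII u⟩
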